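/- **Instances.** Let $k\ge 0$, $\gamma\ge 1$. A $(k,\gamma)$-QSAT instance $\mathcal I=(n,m,\{S_i\}_{i\in[m]},\{C_i\}_{i\in[m]})$ consists of subsets $S_i\subseteq[n]$ with $|S_i|=k$, where $m$ is a power of $2$, and of circuits $C_i$ with at most $\gamma$ gates from $\{\mathsf{CNOT},\mathsf P,\mathsf H,\mathsf T\}$ acting on $k$ qubits and $\gamma$ ancilla qubits. For an $n$-qubit state $\sigma$, $\mathsf{val}_{\mathcal I}(\sigma)=\frac1m\sum_i\Pr[C_i(\sigma_{S_i})=1]$, where $C_i$ is run on the reduced state $\sigma_{S_i}$ with all ancilla qubits in $|0\rangle$ and the first ancilla qubit is measured; $\mathsf{val}(\mathcal I)=\sup_\sigma\mathsf{val}_{\mathcal I}(\sigma)$. **Code.** Let $\mathsf{Enc}$ be the $5$-fold concatenated Steane code, with block length $N=7^5$; $U^{\mathsf{Enc}}$ is an encoding circuit of one- and two-qubit gates (the Steane encoder with $2$ $\mathsf{CNOT}$s, $3$ $\mathsf H$s and $9$ $\mathsf{CNOT}$s, concatenated recursively), $U^{\mathsf{Dec}}=(U^{\mathsf{Enc}})^\dagger$,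 and $U^{\mathsf{Chk}}$ measures the stabilizer generators $U^{\mathsf{Enc}}Z_qU^{\mathsf{Dec}}$, $q=2,\dots,N$, coherently into $N-1$ syndrome qubits (apply $U^{\mathsf{Dec}}$, a $\mathsf{CNOT}$ from each qubit $q\ge2$ to its syndrome qubit, then $U^{\mathsf{Enc}}$). Logical $\mathsf{CNOT}$, $\mathsf{CZ}$, $\mathsf H$ are transversal, logical $\mathsf P$ is transversal $\mathsf P^\dagger$, and logical $\mathsf T$ is a transversal $\mathsf{CNOT}$ from the data block to a block holding $\mathsf{Enc}(\mathsf T|+\rangle)$, followed by a physical controlled-$\mathsf P$ for every pair of a qubit of that magic block and a qubit of the data block. **Verifier.** The state register consists of $N$-qubit blocks $\mathsf{Edata}\{u\}$ ($u\le n$) and $\mathsf{Eotp}\{u\}$ ($u\le 2n$), which form the witness, and of the ancilla: $\log m$ blocks $\mathsf{Eidx}$, $\log m$ blocks $\mathsf{Emidx}$, $\gamma$ blocks $\mathsf{Emagic}$, $\gamma$ blocks $\mathsf{Eanc}$, and $3k$ blocks of $N-1$ qubits $\mathsf{Echk}$. The verifier is the following sequence of unitaries $U_1,\dots,U_T$.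 (1) $\mathsf H$, then $\mathsf T$, on the first qubit of every magic block. (2) The gates of $U^{\mathsf{Enc}}$, each applied simultaneously to all blocks of $\mathsf{Eanc},\mathsf{Emagic},\mathsf{Eidx},\mathsf{Emidx}$. (3) For each position $q\in[N]$, $\mathsf H$ on qubit $q$ of all blocks of $\mathsf{Eidx}$. (4) For each $q\in[N]$, $\mathsf{CNOT}$ from $\mathsf{Eidx}$ to $\mathsf{Emidx}$ on qubit $q$ of all corresponding blocks. (5) Controlled on $\mathsf{Eidx}$ being $\mathsf{Enc}(i)$, gate by gate, $U^{\mathsf{Chk}}$ on $\mathsf{Edata}\{u\}$ for $u\in S_i$, then on $\mathsf{Eotp}\{u\}$ for $u\in S_i$, then on $\mathsf{Eotp}\{u+n\}$ for $u\in S_i$, each with its own block of $\mathsf{Echk}$. (6) Controlled on $\mathsf{Eidx}$ being $\mathsf{Enc}(i)$, $(N^2+3N)\gamma$ layers: for each $q\in[N]$, $\mathsf{CNOT}$ from qubit $q$ of $\mathsf{Eotp}\{u\}$ to that of $\mathsf{Edata}\{u\}$ for all $u\in S_i$; for each $q\in[N]$, $\mathsf{CZ}$ between qubit $q$ of $\mathsf{Eotp}\{u+n\}$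 and that of $\mathsf{Edata}\{u\}$ for all $u\in S_i$; then the physical gates of the encoded $C_i$ on $\mathsf{Edata}\{u\}$, $u\in S_i$, and $\mathsf{Eanc}$, where a $\mathsf T$ gate in position $r$ uses $\mathsf{Emagic}\{r\}$; then identities. (7) The gates of $U^{\mathsf{Dec}}$ on $\mathsf{Eanc}\{1\}$. Here a controlled step is $\sum_i W_i\otimes|\mathsf{Enc}(i)\rangle\langle\mathsf{Enc}(i)|_{\mathsf{Eidx}}$ plus the identity on the orthogonal complement of the span of the $|\mathsf{Enc}(i)\rangle$. **Hamiltonian.** On a $T$-qubit clock and the state register let $H^{\mathsf{enc}}(\mathcal I)=\sum_{t=1}^TH^{\rm prop}_t+\sum_{b=1}^5H^{\rm in}_b+\sum_{t=1}^{T-1}H^{\rm stab}_t+H^{\rm out}$. For $1<t<T$, $$H^{\rm prop}_t=\tfrac12\big(|10\rangle\langle10|+|11\rangle\langle11|-U_t|11\rangle\langle10|-U_t^\dagger|10\rangle\langle11|\big)_{\mathsf{clock}[t-1,t]}\otimes|0\rangle\langle0|_{\mathsf{clock}(t+1)},$$ $$H^{\rm prop}_1=\tfrac12\big(|00\rangle\langle00|+|10\rangle\langle10|-U_1|10\rangle\langle00|-U_1^\dagger|00\rangle\langle10|\big)_{\mathsf{clock}[1,2]},$$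 $$H^{\rm prop}_T=\tfrac12\big(|10\rangle\langle10|+|11\rangle\langle11|-U_T|11\rangle\langle10|-U_T^\dagger|10\rangle\langle11|\big)_{\mathsf{clock}[T-1,T]}.$$ Moreover $H^{\rm stab}_t=|01\rangle\langle01|_{\mathsf{clock}[t,t+1]}$; $H^{\rm in}_b=(I-|0\cdots0\rangle\langle0\cdots0|)_{A_b}\otimes|0\rangle\langle0|_{\mathsf{clock}(1)}$ for $A_1,\dots,A_5=\mathsf{Eidx},\mathsf{Emidx},\mathsf{Eanc},\mathsf{Emagic},\mathsf{Echk}$; and $H^{\rm out}=(I-|10\cdots0\rangle\langle10\cdots0|)_{\mathsf{Eanc}(1),\mathsf{Echk}}\otimes|1\rangle\langle1|_{\mathsf{clock}(T)}$. A history state is $\frac1{\sqrt{T+1}}\sum_{t=0}^T|1^t0^{T-t}\rangle\otimes U_t\cdots U_1(|\phi\rangle_{\rm witness}\otimes|0\cdots0\rangle_{\rm ancilla})$ for a witness state $|\phi\rangle$. **Lemma.** There is a polynomial $p$ in two variables, positive at all pairs of natural numbers, such that for all $k\ge0$, $\gamma\ge1$ and every $(k,\gamma)$-QSAT instance $\mathcal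 I$ as above, $H^{\mathsf{enc}}(\mathcal I)$ is Hermitian and its minimum eigenvalue satisfies $$\Big(\frac{1-\mathsf{val}(\mathcal I)}{p(k,\gamma)}\Big)^2\le\lambda_{\min}(H^{\mathsf{enc}}(\mathcal I))\le1-\mathsf{val}(\mathcal I).$$ Moreover, (soundness) if a unit vector $|\Phi\rangle$ satisfies $\langle\Phi|H^{\mathsf{enc}}(\mathcal I)|\Phi\rangle\le\delta$, then $\mathsf{val}(\mathcal I)\ge1-p(k,\gamma)\sqrt\delta$; and (completeness) there is a history state $|\Psi\rangle$ with $\langle\Psi|H^{\mathsf{enc}}(\mathcal I)|\Psi\rangle\le1-\mathsf{val}(\mathcal I)$. -/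

import Mathlib

open scoped Matrix Kronecker ComplexOrder

noncomputable section

namespace EncHam

/-! ### Qubit registers, gates and circuits

A register is a finite type `Q` of qubits. Its computational basis is `Q → ZMod 2`, vectors are
functions `(Q → ZMod 2) → ℂ` and operators are matrices indexed by `Q → ZMod 2`. -/

/-- Operators on the register `Q`. -/
abbrev Op (Q : Type) : Type := Matrix (Q → ZMod 2) (Q → ZMod 2) ℂ

/-- The physical one- and two-qubit gates. `P = diag(1, i)`, `Pdg = diag(1, -i)`,
`T = diag(1, e^{iπ/4})`, `cp` is the controlled `P` gate. -/
inductive Gate (Q : Type) : Type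
  | H (q : Q)
  | P (q : Q)
  | Pdg (q : Q)
  | T (q : Q)
  | cnot (control target : Q)
  | cz (a b : Q)
  | cp (a b : Q)

/-- Relabelling of the qubits of a gate. -/
def Gate.map {Q R : Type} (f : Q → R) : Gate Q → Gate R
  | .H q => .H (f q)
  | .P q => .P (f q)
  | .Pdg q => .Pdg (f q)
  | .T q => .T (f q)
  | .cnot c t => .cnot (f c) (f t)
  | .cz a b => .cz (f a) (f b)
  | .cp a b => .cp (f a) (f b)

/-- The diagonal one-qubit gate `diag(1, z)` on the qubit `q`. -/
def phaseOp {Q : Type} [Fintype Q] [DecidableEq Q] (z : ℂ) (q : Q) : Op Q :=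
  Matrix.diagonal fun x => if x q = 1 then z else 1

/-- The diagonal two-qubit gate `diag(1, 1, 1, z)` on the qubits `a`, `b`. -/
def cphaseOp {Q : Type} [Fintype Q] [DecidableEq Q] (z : ℂ) (a b : Q) : Op Q :=
  Matrix.diagonal fun x => if x a = 1 ∧ x b = 1 then z else 1

/-- The operator of a gate, acting as the identity on all other qubits. -/
def Gate.op {Q : Type} [Fintype Q] [DecidableEq Q] : Gate Q → Op Q
  | .H q => Matrix.of fun x y =>
      if ∀ r, r ≠ q → x r = y r then
        (if x q = 1 ∧ y q = 1 then -1 else 1) / ((Real.sqrt 2 : ℝ) : ℂ)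
      else 0
  | .P q => phaseOp Complex.I q
  | .Pdg q => phaseOp (-Complex.I) q
  | .T q => phaseOp (Complex.exp (Complex.I * (Real.pi / 4))) q
  | .cnot c t => Matrix.of fun x y => if x = Function.update y t (y t + y c) then 1 else 0
  | .cz a b => cphaseOp (-1) a b
  | .cp a b => cphaseOp Complex.I a b

/-- The operator of a list of gates; the head of the list is applied first. -/
def opOf {Q : Type} [Fintype Q] [DecidableEq Q] : List (Gate Q) → Op Q
  | [] => 1
  | g :: l => opOf l * g.op

/-- The logical gate set `{CNOT, P, H, T}`. -/
inductive CTGate (Q : Type) : Type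
  | cnot (control target : Q) (h : control ≠ target)
  | P (q : Q)
  | H (q : Q)
  | T (q : Q)

/-- A logical gate as an (unencoded) gate. -/
def CTGate.toGate {Q : Type} : CTGate Q → Gate Q
  | .cnot c t _ => .cnot c t
  | .P q => .P q
  | .H q => .H q
  | .T q => .T q

/-! ### The problem `(k, γ)`-QSAT -/

/-- A Clifford + T circuit of size at most `γ` on `k` input qubits (`Sum.inl`) and `γ` ancilla
qubits (`Sum.inr`). Unused ancilla qubits are allowed. -/
structure Circuit (k γ : ℕ) : Type where
  gates : List (CTGate (Fin k ⊕ Fin γ))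
  size_le : gates.length ≤ γ

/-- An instance `(n, m, {S_i}, {C_i})`. -/
structure QSAT (k γ : ℕ) : Type where
  n : ℕ
  m : ℕ
  S : Fin m → Finset (Fin n)
  card_S : ∀ i, (S i).card = k
  C : Fin m → Circuit k γ

/-- Density matrices on the register `Q`. -/
def IsDensity {Q : Type} [Fintype Q] [DecidableEq Q] (σ : Op Q) : Prop :=
  σ.PosSemidef ∧ σ.trace = 1

/-- Partial trace: the reduced density matrix of `σ` on the qubits `e a`, `a : A`
(for injective `e`). -/
def reduced {A Q : Type} [Fintype Q] [DecidableEq Q] [Fintype A] [DecidableEq A]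
    (e : A → Q) (σ : Op Q) : Op A :=
  Matrix.of fun a b => ∑ x : Q → ZMod 2, ∑ y : Q → ZMod 2,
    if x ∘ e = a ∧ y ∘ e = b ∧ ∀ q, (∀ c, e c ≠ q) → x q = y q then σ x y else 0

/-- `ρ ⊗ |0⟩⟨0|`, with the zero state on the second register. -/
def withZeros {A B : Type} [Fintype B] (ρ : Op A) : Op (A ⊕ B) :=
  Matrix.of fun x y =>
    if (∀ b, x (Sum.inr b) = 0) ∧ (∀ b, y (Sum.inr b) = 0) then
      ρ (x ∘ Sum.inl) (y ∘ Sum.inl)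
    else 0

/-- The unitary of a circuit. -/
def Circuit.op {k γ : ℕ} (C : Circuit k γ) : Op (Fin k ⊕ Fin γ) :=
  opOf (C.gates.map CTGate.toGate)

/-- The probability that, after `C` is run on `ρ` with all ancilla qubits in `|0⟩`, a measurement
of the first ancilla qubit gives `1`. -/
def Circuit.prOne {k γ : ℕ} [NeZero γ] (C : Circuit k γ) (ρ : Op (Fin k)) : ℝ :=
  ((Matrix.diagonal fun x : Fin k ⊕ Fin γ → ZMod 2 => if x (Sum.inr 0) = 1 then (1 : ℂ) else 0)
    * (C.op * withZeros ρ * C.opᴴ)).trace.re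

namespace QSAT

variable {k γ : ℕ}

/-- `S_{i,τ}`, the `τ`-th element of `S_i` in increasing order. -/
def elt (I : QSAT k γ) (i : Fin I.m) (τ : Fin k) : Fin I.n :=
  (I.S i).orderEmbOfFin (I.card_S i) τ

/-- The value of an instance at a state `σ`. -/
def valAt [NeZero γ] (I : QSAT k γ) (σ : Op (Fin I.n)) : ℝ :=
  (∑ i, (I.C i).prOne (reduced (I.elt i) σ)) / I.m

/-- The value of an instance: the supremum over all states. -/
def val [NeZero γ] (I : QSAT k γ) : ℝ :=
  sSup {v | ∃ σ : Op (Fin I.n), IsDensity σ ∧ v = I.valAt σ}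

end QSAT

/-! ### History states and history Hamiltonians

`U : List (Op Q)` is a sequence `U_1, …, U_T` of unitaries with `T = U.length`. Clock qubits are
numbered `0, …, T - 1`. The function `part` describes the ancilla qubits and their partition into
`B` sets: `part q = none` for a witness qubit and `part q = some i` for `q ∈ S_i`. -/

/-- The joint basis of clock and state registers. -/
abbrev HIdx (T : ℕ) (Q : Type) : Type := (Fin T → ZMod 2) × (Q → ZMod 2)

/-- `|1⟩⟨1| ⊗ |a⟩⟨b| ⊗ |0⟩⟨0|` on the clock qubits `t - 1, t, t + 1`, where the first factor is
omitted for the first clock qubit and the last one for the last clock qubit. -/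
def clockStep {T : ℕ} (t : Fin T) (a b : ZMod 2) : Op (Fin T) :=
  Matrix.of fun x y =>
    if x t = a ∧ y t = b ∧ (∀ s, s ≠ t → x s = y s) ∧
        (∀ s : Fin T, s.val + 1 = t.val → x s = 1) ∧
        (∀ s : Fin T, s.val = t.val + 1 → x s = 0)
    then 1 else 0

/-- `|0⟩⟨0|` on the first clock qubit. -/
def clockFirst (T : ℕ) : Op (Fin T) :=
  Matrix.diagonal fun x => if ∀ t : Fin T, t.val = 0 → x t = 0 then 1 else 0

/-- `|1⟩⟨1|` on the last clock qubit. -/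
def clockLast (T : ℕ) : Op (Fin T) :=
  Matrix.diagonal fun x => if ∀ t : Fin T, t.val + 1 = T → x t = 1 then 1 else 0

section History

variable {Q : Type} [Fintype Q] [DecidableEq Q]

def hProp (U : List (Op Q)) : Matrix (HIdx U.length Q) (HIdx U.length Q) ℂ :=
  ∑ t : Fin U.length, (1 / 2 : ℂ) •
    (clockStep t 0 0 ⊗ₖ (1 : Op Q) + clockStep t 1 1 ⊗ₖ (1 : Op Q)
      - clockStep t 1 0 ⊗ₖ U.get t - clockStep t 0 1 ⊗ₖ (U.get t)ᴴ)

def hStab (T : ℕ) (Q : Type) [Fintype Q] [DecidableEq Q] : Matrix (HIdx T Q) (HIdx T Q) ℂ :=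
  ∑ s : Fin T, ∑ t : Fin T,
    if s.val + 1 = t.val then
      (Matrix.diagonal fun x : Fin T → ZMod 2 => if x s = 0 ∧ x t = 1 then (1 : ℂ) else 0)
        ⊗ₖ (1 : Op Q)
    else 0

def hIn (T : ℕ) {B : ℕ} (part : Q → Option (Fin B)) : Matrix (HIdx T Q) (HIdx T Q) ℂ :=
  ∑ i : Fin B, clockFirst T ⊗ₖ
    (1 - Matrix.diagonal fun x : Q → ZMod 2 =>
      if ∀ q, part q = some i → x q = 0 then (1 : ℂ) else 0)

/-- The history Hamiltonian `H^prop + H^in + H^stab`. -/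
def historyHam (U : List (Op Q)) {B : ℕ} (part : Q → Option (Fin B)) :
    Matrix (HIdx U.length Q) (HIdx U.length Q) ℂ :=
  hProp U + hIn U.length part + hStab U.length Q

/-- Unit vectors. -/
def IsState {ι : Type} [Fintype ι] (v : ι → ℂ) : Prop := star v ⬝ᵥ v = 1

/-- `⟨Φ| H |Φ⟩` -/
def energy {ι : Type} [Fintype ι] (H : Matrix ι ι ℂ) (Φ : ι → ℂ) : ℝ :=
  (star Φ ⬝ᵥ (H *ᵥ Φ)).re

/-- The clock state `1^t 0^(T-t)`. -/
def unary (T t : ℕ) : Fin T → ZMod 2 := fun s => if s.val < t then 1 else 0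

/-- `U_{[1,t]} = U_t ⋯ U_1` -/
def prefixOp (U : List (Op Q)) (t : ℕ) : Op Q := (U.take t).foldl (fun A V => V * A) 1

/-- History states. The condition on `ψ₀` says that it is a witness state tensored with the zero
state of the ancilla qubits. -/
def IsHistoryState (U : List (Op Q)) {B : ℕ} (part : Q → Option (Fin B))
    (Ψ : HIdx U.length Q → ℂ) : Prop :=
  ∃ ψ₀ : (Q → ZMod 2) → ℂ, IsState ψ₀ ∧
    (∀ x, (∃ q, part q ≠ none ∧ x q ≠ 0) → ψ₀ x = 0) ∧
    ∀ c x, Ψ (c, x) = (1 / (Real.sqrt (U.length + 1) : ℝ) : ℂ) *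
      ∑ t ∈ Finset.range (U.length + 1),
        (if c = unary U.length t then (1 : ℂ) else 0) * (prefixOp U t *ᵥ ψ₀) x

/-- The minimum eigenvalue of a Hermitian matrix. -/
def lambdaMin {ι : Type} [Fintype ι] [DecidableEq ι] (H : Matrix ι ι ℂ) : ℝ :=
  sInf {r : ℝ | Module.End.HasEigenvalue (Matrix.toLin' H) (r : ℂ)}

end History

/-! ### The concatenated Steane code

The `7^L` physical qubits of a block of the `L`-fold concatenated code are indexed by
`Fin L → Fin 7`; coordinate `0` belongs to the outermost code. -/

/-- Generators of the `[7,3]` simplex code. -/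
def steaneGen : Matrix (Fin 3) (Fin 7) (ZMod 2) :=
  !![0, 0, 0, 1, 1, 1, 1;
     1, 1, 0, 0, 0, 1, 1;
     1, 0, 1, 0, 1, 0, 1]

/-- Amplitudes of the logical basis state `|b⟩` of the Steane code: the uniform superposition of
the simplex code (`b = 0`) or of its translate by the all-ones word (`b = 1`). -/
def steaneAmp (b : ZMod 2) (c : Fin 7 → ZMod 2) : ℂ :=
  if ∃ s : Fin 3 → ZMod 2, c = (s ᵥ* steaneGen) + fun _ => b then
    1 / ((Real.sqrt 8 : ℝ) : ℂ)
  else 0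

/-- Amplitudes of the logical basis state `|b⟩` of the `L`-fold concatenated Steane code: each
qubit of a Steane codeword is encoded by the `(L-1)`-fold concatenated code. -/
def encAmp : (L : ℕ) → ZMod 2 → ((Fin L → Fin 7) → ZMod 2) → ℂ
  | 0, b, x => if x ![] = b then 1 else 0
  | L + 1, b, x => ∑ c : Fin 7 → ZMod 2, steaneAmp b c *
      ∏ a : Fin 7, encAmp L (c a) (fun w => x (Fin.cons a w))

/-- An encoding circuit of the Steane code, from the state of qubit `0` and zeros on the other
qubits. -/
def steaneEnc : List (Gate (Fin 7)) :=
  [.cnot 0 4, .cnot 0 5, .H 1, .H 2, .H 3,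
   .cnot 3 4, .cnot 3 5, .cnot 3 6,
   .cnot 1 0, .cnot 1 5, .cnot 1 6,
   .cnot 2 0, .cnot 2 4, .cnot 2 6]

/-- An encoding circuit of the concatenated code: the outermost Steane code first, on the first
qubits of the seven sub-blocks, and then each sub-block. -/
def encGates : (L : ℕ) → List (Gate (Fin L → Fin 7))
  | 0 => []
  | L + 1 => steaneEnc.map (Gate.map fun a => Fin.cons a fun _ => 0) ++
      (List.finRange 7).flatMap fun a => (encGates L).map (Gate.map (Fin.cons a))

/-- The physical qubits of one block of the `5`-fold concatenated Steane code; the first qubit of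
a block is `0 : Blk`. -/
abbrev Blk : Type := Fin 5 → Fin 7

/-- The block length `N`. -/
def blockLen : ℕ := 7 ^ 5

/-- The qubits of a block, listed in order. -/
def blkList : List Blk := List.ofFn fun j : Fin (7 ^ 5) => finFunctionFinEquiv.symm j

/-- The `N - 1` syndrome qubits of a block. -/
abbrev Syn : Type := {q : Blk // q ≠ 0}

/-- The two-local gates of `U^Enc`. -/
def uEnc : List (Gate Blk) := encGates 5

/-- The two-local gates of `U^Dec = (U^Enc)†`: every gate of `U^Enc` is a `CNOT` or an `H`, hence
its own inverse. -/
def uDec : List (Gate Blk) := uEnc.reverse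

/-- The two-local gates of `U^Chk`, the coherent measurement of the `N - 1` stabilizer generators
`U^Enc Z_q (U^Enc)†`, `q ≠ 0`, into the syndrome qubits. -/
def uChk : List (Gate (Blk ⊕ Syn)) :=
  uDec.map (Gate.map Sum.inl) ++
    blkList.filterMap (fun q =>
      if h : q ≠ 0 then some (Gate.cnot (Sum.inl q) (Sum.inr ⟨q, h⟩)) else none) ++
    uEnc.map (Gate.map Sum.inl)

/-! ### The encoded verifier -/

/-- The state register (witness and ancilla qubits), with `l = log m`. `otpX u` is the `u`-th and
`otpZ u` the `(u+n)`-th block of the one-time-pad register, `chk s τ` is the `(τ + s k)`-th block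
of the syndrome register. -/
inductive StQ (n k γ l : ℕ) : Type
  | data (u : Fin n) (q : Blk)
  | otpX (u : Fin n) (q : Blk)
  | otpZ (u : Fin n) (q : Blk)
  | chk (s : Fin 3) (τ : Fin k) (q : Syn)
  | idx (j : Fin l) (q : Blk)
  | midx (j : Fin l) (q : Blk)
  | magic (r : Fin γ) (q : Blk)
  | anc (r : Fin γ) (q : Blk)
  deriving DecidableEq, Fintype

/-- Witness qubits (`none`) and the partition of the ancilla qubits into five sets. -/
def ancPart {n k γ l : ℕ} : StQ n k γ l → Option (Fin 5)
  | .data _ _ => none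
  | .otpX _ _ => none
  | .otpZ _ _ => none
  | .idx _ _ => some 0
  | .midx _ _ => some 1
  | .anc _ _ => some 2
  | .magic _ _ => some 3
  | .chk _ _ _ => some 4

/-- The fault-tolerant version of a logical gate, as a list of layers. `blk a` is the block of the
logical qubit `a` and `mg` a block holding an encoded magic state `T|+⟩`. `CNOT` and `H` are
transversal; transversal `P†` is the logical `P` since `7^5 ≡ 3` modulo `4`. For `T`, a transversal
`CNOT` onto the magic block is followed by the logical controlled `P` from the magic block, the
coherent form of the `P` correction conditioned on the value of the magic qubit; it is performed
by a controlled `P` for each pair of physical qubits since the number of ones in a codeword of `b`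
is `3 b` modulo `4`. -/
def ftGate {A R : Type} (blk : A → Blk → R) (mg : Blk → R) : CTGate A → List (List (Gate R))
  | .cnot a b _ => blkList.map fun q => [.cnot (blk a q) (blk b q)]
  | .P a => blkList.map fun q => [.Pdg (blk a q)]
  | .H a => blkList.map fun q => [.H (blk a q)]
  | .T a => (blkList.map fun q => [.cnot (blk a q) (mg q)]) ++
      blkList.flatMap fun q => blkList.map fun q' => [.cp (mg q) (blk a q')]

/-- The number of layers of the encoded test per unit of circuit size. -/
def cTest : ℕ := blockLen ^ 2 + 3 * blockLen

theorem ftGate_length_le {A R : Type} (blk : A → Blk → R) (mg : Blk → R) (g : CTGate A) :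
    (ftGate blk mg g).length ≤ blockLen ^ 2 + blockLen := by
  have h : blkList.length = blockLen := by simp only [blkList, List.length_ofFn, blockLen]
  cases g <;> simp only [ftGate, List.length_map, List.length_append, List.length_flatMap, h,
    List.map_const', List.sum_replicate, smul_eq_mul] <;> nlinarith [Nat.zero_le blockLen]

namespace QSAT

variable {k γ : ℕ}

/-- `log m` -/
abbrev logm (I : QSAT k γ) : ℕ := Nat.log 2 I.m

/-- The qubits of the state register for the instance `I`. -/
abbrev St (I : QSAT k γ) : Type := StQ I.n k γ I.logm

/-- The `j`-th binary digit of an index. -/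
def idxBit (I : QSAT k γ) (i : Fin I.m) (j : Fin I.logm) : ZMod 2 :=
  if i.val.testBit j.val then 1 else 0

/-- `|Enc(i)⟩⟨Enc(i)|` on the index register. -/
def idxProj (I : QSAT k γ) (i : Fin I.m) : Op I.St :=
  Matrix.of fun x y =>
    if ∀ q : I.St, (∀ j w, q ≠ .idx j w) → x q = y q then
      (∏ j, encAmp 5 (I.idxBit i j) fun w => x (.idx j w)) *
        star (∏ j, encAmp 5 (I.idxBit i j) fun w => y (.idx j w))
    else 0

/-- `∑ i, W_i ⊗ |Enc(i)⟩⟨Enc(i)|`, made unitary by the identity on the orthogonal complement of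
the span of the `|Enc(i)⟩`. The `W i` do not act on the index register. -/
def select (I : QSAT k γ) (W : Fin I.m → List (Gate I.St)) : Op I.St :=
  (∑ i, opOf (W i) * I.idxProj i) + (1 - ∑ i, I.idxProj i)

/-- The block holding the logical qubit `a` of the circuit `C_i`. -/
def circBlk (I : QSAT k γ) (i : Fin I.m) : Fin k ⊕ Fin γ → Blk → I.St
  | .inl τ => .data (I.elt i τ)
  | .inr r => .anc r

/-- The block of the witness whose encoding is checked. -/
def chkBlk (I : QSAT k γ) (i : Fin I.m) (τ : Fin k) : Fin 3 → Blk → I.St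
  | 0 => .data (I.elt i τ)
  | 1 => .otpX (I.elt i τ)
  | 2 => .otpZ (I.elt i τ)

/-- The layers of the encoded test for the index `i`: undo the one-time pad transversally on all
blocks in `S_i`, then run the fault-tolerant version of `C_i`, whose `r`-th gate uses the `r`-th
magic block if it is a `T` gate. -/
def testLayers (I : QSAT k γ) (i : Fin I.m) : List (List (Gate I.St)) :=
  (blkList.map fun q => (List.finRange k).map fun τ =>
    Gate.cnot (.otpX (I.elt i τ) q) (.data (I.elt i τ) q)) ++
  (blkList.map fun q => (List.finRange k).map fun τ =>
    Gate.cz (.otpZ (I.elt i τ) q) (.data (I.elt i τ) q)) ++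
  (List.finRange γ).flatMap fun r =>
    match (I.C i).gates[r.val]? with
    | none => []
    | some g => ftGate (I.circBlk i) (.magic r) g

/-- The encoded test fits into `cTest * γ` layers. -/
theorem testLayers_length_le [NeZero γ] (I : QSAT k γ) (i : Fin I.m) :
    (I.testLayers i).length ≤ cTest * γ := by
  have h : blkList.length = blockLen := by simp only [blkList, List.length_ofFn, blockLen]
  have hγ : 1 ≤ γ := NeZero.one_le
  have h2 : ∀ r ∈ (List.finRange γ).map (fun r : Fin γ => (match (I.C i).gates[r.val]? with
      | none => []
      | some g => ftGate (I.circBlk i) (StQ.magic r) g : List (List (Gate I.St))).length),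
      r ≤ blockLen ^ 2 + blockLen := by
    intro r hr
    obtain ⟨a, -, rfl⟩ := List.mem_map.1 hr
    split
    · exact Nat.zero_le _
    · exact ftGate_length_le _ _ _
  have h3 := List.sum_le_card_nsmul _ _ h2
  simp only [List.length_map, List.length_finRange, smul_eq_mul] at h3
  simp only [testLayers, List.length_append, List.length_map, List.length_flatMap, h, cTest]
  have h4 : 2 * blockLen ≤ 2 * blockLen * γ := Nat.le_mul_of_pos_right _ hγ
  calc _ ≤ blockLen + blockLen + γ * (blockLen ^ 2 + blockLen) := Nat.add_le_add_left h3 _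
    _ = 2 * blockLen + γ * (blockLen ^ 2 + blockLen) := by ring
    _ ≤ 2 * blockLen * γ + γ * (blockLen ^ 2 + blockLen) := Nat.add_le_add_right h4 _
    _ = _ := by ring

/-- 1. Set-up of the magic states. -/
def stage1 (I : QSAT k γ) : List (Op I.St) :=
  [opOf ((List.finRange γ).map fun r => .H (.magic r 0)),
   opOf ((List.finRange γ).map fun r => .T (.magic r 0))]

/-- 2. Encoding. -/
def stage2 (I : QSAT k γ) : List (Op I.St) :=
  uEnc.map fun g => opOf <|
    ((List.finRange γ).map fun r => g.map (.anc r)) ++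
    ((List.finRange γ).map fun r => g.map (.magic r)) ++
    ((List.finRange I.logm).map fun j => g.map (.idx j)) ++
    ((List.finRange I.logm).map fun j => g.map (.midx j))

/-- 3. Encoded Hadamard. -/
def stage3 (I : QSAT k γ) : List (Op I.St) :=
  blkList.map fun q => opOf <| (List.finRange I.logm).map fun j => .H (.idx j q)

/-- 4. Encoded `CNOT`. -/
def stage4 (I : QSAT k γ) : List (Op I.St) :=
  blkList.map fun q => opOf <| (List.finRange I.logm).map fun j => .cnot (.idx j q) (.midx j q)

/-- 5. Check encoding. -/
def stage5 (I : QSAT k γ) : List (Op I.St) :=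
  (List.finRange 3).flatMap fun s => (List.finRange k).flatMap fun τ => uChk.map fun g =>
    I.select fun i => [g.map (Sum.elim (I.chkBlk i τ s) (.chk s τ))]

/-- 6. Encoded test, of length `cTest * γ`, padded by identities. -/
def stage6 (I : QSAT k γ) : List (Op I.St) :=
  (List.range (cTest * γ)).map fun j => I.select fun i => (I.testLayers i).getD j []

/-- 7. Decoding of the first block of `anc`. -/
def stage7 [NeZero γ] (I : QSAT k γ) : List (Op I.St) :=
  uDec.map fun g => opOf [g.map (.anc 0)]

/-- The sequence of unitaries of the encoded verifier, in the order of application. -/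
def vEnc [NeZero γ] (I : QSAT k γ) : List (Op I.St) :=
  I.stage1 ++ I.stage2 ++ I.stage3 ++ I.stage4 ++ I.stage5 ++ I.stage6 ++ I.stage7

/-- The output term: penalizes, at the last time step, all outcomes except `1` on the first qubit
of `anc` and `0` on all syndrome qubits. -/
def hOut [NeZero γ] (I : QSAT k γ) :
    Matrix (HIdx I.vEnc.length I.St) (HIdx I.vEnc.length I.St) ℂ :=
  clockLast I.vEnc.length ⊗ₖ
    (1 - Matrix.diagonal fun x : I.St → ZMod 2 =>
      if x (.anc 0 0) = 1 ∧ ∀ s τ q, x (.chk s τ q) = 0 then (1 : ℂ) else 0)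

/-- The encoded Hamiltonian `H^enc(I)`. -/
def hEnc [NeZero γ] (I : QSAT k γ) :
    Matrix (HIdx I.vEnc.length I.St) (HIdx I.vEnc.length I.St) ℂ :=
  historyHam I.vEnc ancPart + I.hOut

end QSAT

end EncHam

end

/-!
The Hamiltonian is Kitaev's clock construction for the verifier `vEnc`, so its ground energy is
controlled by the largest acceptance probability of the verifier. There are two independent parts.

**The clock.** On the clock states `1^t 0^(T-t)` a vector `Φ` of energy `δ` is, up to errors of
order `T √δ`, the evolution under `U_t ⋯ U_1` of its slice at time `0`, and this slice is close to a
vector with zeros on the ancilla qubits. The output term measures the rejection probability of that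
evolution, so if no witness is accepted with probability more than `v`, then `1 - v` is at most
`(1 + 16 (T + 1)^3) √δ` (`history_soundness`). Conversely the energy of the history state of a
witness is its rejection probability divided by `T + 1` (`energy_historyState`). The number `T` of
unitaries is linear in `k` and `γ` (`vEnc_length`), hence the polynomial.

**The verifier.** It remains to show that the maximal acceptance probability is exactly `val`. The
encoding isometry intertwines logical and transversal operations: this is the duality between the
simplex and the Hamming code for `H` (`encAmp_hadamard`) and a count of weights modulo `4` for the
phase gates. The `T` gadget is exact because `T|+⟩` is a catalyst: a `CNOT` onto it followed by a
controlled `P` from it is `T` on the data qubit, and the magic state is left unchanged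
(`gadget_magic`). So, on the image of the encoding isometry, the encoded test is the logical circuit
preceded by the removal of the one-time pad (`testLayers_semiconj`).

The index register is maximally entangled with its copy. All later operators commute with the
projections onto the `|Enc(i)⟩`, so the acceptance probability is by Pythagoras the average over `i`
of that of the `i`-th test (`accept_eq`). For a fixed `i`, the check conditioned on a zero syndrome
is the projection onto the code space of the tested blocks (`zeroProj_mul_checkGates`), which
the encoding unitaries turn into a projection onto zeros. Up to unitaries on other blocks the test
thus becomes the circuit `C_i` on the witness decoded and unpadded by one and the same unitary
`decodeOp` for all `i`, followed by that projection. Dropping the projection shows that the verifier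
accepts at most as often as the instance is satisfied by the reduced state of the decoded witness
(`sum_accOp_le`). The value is the largest eigenvalue of an observable, so it is attained at a pure
state, and the encoding of this state is accepted with probability exactly `val`
(`exists_sum_accOp_eq`).

Operators on part of a register are handled by `lift`, simultaneous operators on disjoint blocks by
`par`, and commutation of operators with disjoint supports by the submonoids `loc`.
-/


noncomputable section

set_option linter.unusedSectionVars false

namespace EncHam

/-! ### Operators acting on part of a register -/

section Lift

variable {A B R S : Type} [Fintype A] [DecidableEq A] [Fintype B] [DecidableEq B]
  [Fintype R] [DecidableEq R] [Fintype S] [DecidableEq S]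

/-- The operator `M` acting on the qubits `e a`, `a : A`, of the register `R` and as the identity
on all other qubits (for injective `e`). -/
def lift (e : A → R) (M : Op A) : Op R :=
  Matrix.of fun x y => if ∀ r, (∀ a, e a ≠ r) → x r = y r then M (x ∘ e) (y ∘ e) else 0

theorem extend_comp_self {e : A → R} (he : e.Injective) (u : A → ZMod 2) (x : R → ZMod 2) :
    Function.extend e u x ∘ e = u := by
  funext a; exact he.extend_apply _ _ _

theorem extend_off {e : A → R} (u : A → ZMod 2) (x : R → ZMod 2) {r : R} (h : ∀ a, e a ≠ r) :
    Function.extend e u x r = x r :=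
  Function.extend_apply' _ _ _ (by rintro ⟨a, ha⟩; exact h a ha)

theorem eq_extend {e : A → R} (he : e.Injective) {x y : R → ZMod 2}
    (h : ∀ r, (∀ a, e a ≠ r) → x r = y r) : y = Function.extend e (y ∘ e) x := by
  funext r
  by_cases hr : ∃ a, e a = r
  · obtain ⟨a, rfl⟩ := hr
    rw [he.extend_apply]; rfl
  · push Not at hr
    rw [extend_off _ _ hr, h r hr]

/-- A sum over the configurations that agree with `x` off the range of `e` is a sum over the
configurations of the domain of `e`. -/
theorem sum_agree {β : Type} [AddCommMonoid β] {e : A → R} (he : e.Injective) (x : R → ZMod 2)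
    (f : (R → ZMod 2) → β) :
    (∑ y, if ∀ r, (∀ a, e a ≠ r) → x r = y r then f y else 0) =
      ∑ u : A → ZMod 2, f (Function.extend e u x) := by
  rw [← Finset.sum_filter]
  refine Finset.sum_nbij' (fun y => y ∘ e) (fun u => Function.extend e u x) ?_ ?_ ?_ ?_ ?_
  · simp
  · intro u _
    simp only [Finset.mem_filter, Finset.mem_univ, true_and]
    intro r hr
    rw [extend_off _ _ hr]
  · intro y hy
    exact (eq_extend he (Finset.mem_filter.1 hy).2).symm
  · intro u _
    exact extend_comp_self he u x
  · intro y hy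
    rw [← eq_extend he (Finset.mem_filter.1 hy).2]

theorem lift_mulVec_apply {e : A → R} (he : e.Injective) (M : Op A) (v : (R → ZMod 2) → ℂ)
    (x : R → ZMod 2) :
    (lift e M *ᵥ v) x = ∑ u, M (x ∘ e) u * v (Function.extend e u x) := by
  have := sum_agree he x (fun y => M (x ∘ e) (y ∘ e) * v y)
  simp only [extend_comp_self he] at this
  rw [← this]
  simp only [Matrix.mulVec, dotProduct, lift, Matrix.of_apply, ite_mul, zero_mul]

theorem lift_mul_apply {e : A → R} (he : e.Injective) (M : Op A) (N : Op R)
    (x z : R → ZMod 2) :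
    (lift e M * N) x z = ∑ u, M (x ∘ e) u * N (Function.extend e u x) z :=
  lift_mulVec_apply he M (fun y => N y z) x

theorem mul_lift_apply {e : A → R} (he : e.Injective) (M : Op A) (N : Op R)
    (x z : R → ZMod 2) :
    (N * lift e M) x z = ∑ u, N x (Function.extend e u z) * M u (z ∘ e) := by
  have := sum_agree he z (fun y => N x y * M (y ∘ e) (z ∘ e))
  simp only [extend_comp_self he] at this
  rw [← this, Matrix.mul_apply]
  refine Finset.sum_congr rfl fun y _ => ?_
  simp only [lift, Matrix.of_apply, mul_ite, mul_zero]
  congr 1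
  simp only [eq_comm]

theorem lift_mul {e : A → R} (he : e.Injective) (M N : Op A) :
    lift e (M * N) = lift e M * lift e N := by
  ext x z
  rw [lift_mul_apply he, lift, Matrix.of_apply, Matrix.mul_apply]
  by_cases h : ∀ r, (∀ a, e a ≠ r) → x r = z r
  · rw [if_pos h]
    refine Finset.sum_congr rfl fun u _ => ?_
    rw [lift, Matrix.of_apply, extend_comp_self he, if_pos]
    intro r hr
    rw [extend_off _ _ hr, h r hr]
  · rw [if_neg h]
    refine (Finset.sum_eq_zero fun u _ => ?_).symm
    rw [lift, Matrix.of_apply, if_neg, mul_zero]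
    intro h'
    refine h fun r hr => ?_
    rw [← h' r hr, extend_off _ _ hr]

theorem eq_iff_comp_off (e : A → R) (x y : R → ZMod 2) :
    x = y ↔ (x ∘ e = y ∘ e ∧ ∀ r, (∀ a, e a ≠ r) → x r = y r) := by
  constructor
  · rintro rfl; exact ⟨rfl, fun _ _ => rfl⟩
  · rintro ⟨h1, h2⟩
    funext r
    by_cases hr : ∃ a, e a = r
    · obtain ⟨a, rfl⟩ := hr
      exact congrFun h1 a
    · push Not at hr
      exact h2 r hr

theorem lift_diagonal (e : A → R) (d : (A → ZMod 2) → ℂ) :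
    lift e (Matrix.diagonal d) = Matrix.diagonal fun x => d (x ∘ e) := by
  ext x y
  simp only [lift, Matrix.of_apply, Matrix.diagonal_apply]
  by_cases h : x = y
  · subst h; simp
  · rw [if_neg h]
    split_ifs with h1 h2
    · exact absurd ((eq_iff_comp_off e x y).2 ⟨h2, h1⟩) h
    · rfl
    · rfl

theorem lift_one (e : A → R) : lift e (1 : Op A) = 1 := by
  rw [← Matrix.diagonal_one, lift_diagonal, Matrix.diagonal_one]

theorem lift_conjTranspose (e : A → R) (M : Op A) : (lift e M)ᴴ = lift e Mᴴ := by
  ext x y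
  simp only [lift, Matrix.of_apply, Matrix.conjTranspose_apply]
  rw [apply_ite star, star_zero]
  congr 1
  simp only [eq_comm]

theorem lift_id (M : Op A) : lift id M = M := by
  ext x y
  simp only [lift, Matrix.of_apply]
  rw [if_pos (fun r hr => absurd rfl (hr r))]
  rfl

theorem lift_comp {f : B → R} (hf : f.Injective) (e : A → B) (M : Op A) :
    lift (f ∘ e) M = lift f (lift e M) := by
  ext x y
  simp only [lift, Matrix.of_apply]
  by_cases h : ∀ r, (∀ b, f b ≠ r) → x r = y r
  · rw [if_pos h]
    refine if_congr ⟨fun h' b hb => ?_, fun h' r hr => ?_⟩ rfl rfl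
    · exact h' (f b) fun a ha => hb a (hf ha)
    · by_cases hr' : ∃ b, f b = r
      · obtain ⟨b, rfl⟩ := hr'
        exact h' b fun a ha => hr a (congrArg f ha)
      · push Not at hr'
        exact h r hr'
  · rw [if_neg h, if_neg]
    exact fun h' => h fun r hr => h' r fun a => hr (e a)

/-- Entries of a product of operators on disjoint sets of qubits. The expression is symmetric in the
two factors, so they commute. -/
theorem lift_mul_lift_apply {e : A → R} {f : B → R} (he : e.Injective) (h : ∀ a b, e a ≠ f b)
    (M : Op A) (N : Op B) (x z : R → ZMod 2) :
    (lift e M * lift f N) x z =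
      if ∀ r, (∀ a, e a ≠ r) → (∀ b, f b ≠ r) → x r = z r then
        M (x ∘ e) (z ∘ e) * N (x ∘ f) (z ∘ f) else 0 := by
  rw [lift_mul_apply he]
  have h1 : ∀ u, Function.extend e u x ∘ f = x ∘ f := fun u => by
    funext b
    exact extend_off _ _ fun a => h a b
  have h2 : ∀ u : A → ZMod 2, lift f N (Function.extend e u x) z =
      if u = z ∘ e then (if ∀ r, (∀ a, e a ≠ r) → (∀ b, f b ≠ r) → x r = z r then
        N (x ∘ f) (z ∘ f) else 0) else 0 := by
    intro u
    rw [lift, Matrix.of_apply, h1]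
    by_cases hu : u = z ∘ e
    · subst hu
      rw [if_pos rfl]
      refine if_congr ⟨fun h' r hr hr' => ?_, fun h' r hr => ?_⟩ rfl rfl
      · rw [← h' r hr', extend_off _ _ hr]
      · by_cases hr' : ∃ a, e a = r
        · obtain ⟨a, rfl⟩ := hr'
          rw [he.extend_apply]; rfl
        · push Not at hr'
          rw [extend_off _ _ hr', h' r hr' hr]
    · rw [if_neg hu, if_neg]
      intro h'
      refine hu (funext fun a => ?_)
      rw [Function.comp_apply, ← h' (e a) fun b hb => h a b hb.symm, he.extend_apply]
  simp only [h2, mul_ite, mul_zero, Finset.sum_ite_eq', Finset.mem_univ, if_true]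

theorem lift_commute {e : A → R} {f : B → R} (he : e.Injective) (hf : f.Injective)
    (h : ∀ a b, e a ≠ f b) (M : Op A) (N : Op B) : Commute (lift e M) (lift f N) := by
  ext x z
  rw [lift_mul_lift_apply he h, lift_mul_lift_apply hf fun b a hb => h a b hb.symm]
  refine if_congr ⟨fun h' r hr hr' => h' r hr' hr, fun h' r hr hr' => h' r hr' hr⟩ ?_ rfl
  rw [mul_comm]

theorem Gate.op_map {e : A → R} (he : e.Injective) (g : Gate A) :
    (g.map e).op = lift e g.op := by
  cases g with
  | P q => simp only [Gate.map, Gate.op, phaseOp, lift_diagonal, Function.comp_apply]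
  | Pdg q => simp only [Gate.map, Gate.op, phaseOp, lift_diagonal, Function.comp_apply]
  | T q => simp only [Gate.map, Gate.op, phaseOp, lift_diagonal, Function.comp_apply]
  | cz a b => simp only [Gate.map, Gate.op, cphaseOp, lift_diagonal, Function.comp_apply]
  | cp a b => simp only [Gate.map, Gate.op, cphaseOp, lift_diagonal, Function.comp_apply]
  | H q =>
    ext x y
    simp only [Gate.map, Gate.op, lift, Matrix.of_apply, Function.comp_apply]
    by_cases h : ∀ r, (∀ a, e a ≠ r) → x r = y r
    · rw [if_pos h]
      refine if_congr ⟨fun h' a ha => h' _ fun hh => ha (he hh), fun h' r hr => ?_⟩ rfl rfl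
      by_cases hr' : ∃ a, e a = r
      · obtain ⟨a, rfl⟩ := hr'
        exact h' a fun hh => hr (congrArg e hh)
      · push Not at hr'
        exact h r hr'
    · rw [if_neg h, if_neg]
      exact fun h' => h fun r hr => h' r (hr q).symm
  | cnot c t =>
    ext x y
    simp only [Gate.map, Gate.op, lift, Matrix.of_apply, Function.comp_apply]
    by_cases h : ∀ r, (∀ a, e a ≠ r) → x r = y r
    · rw [if_pos h]
      refine if_congr ?_ rfl rfl
      rw [eq_iff_comp_off e]
      have h1 : Function.update y (e t) (y (e t) + y (e c)) ∘ e =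
          Function.update (y ∘ e) t (y (e t) + y (e c)) := by
        rw [Function.update_comp_eq_of_injective _ he]
      rw [h1]
      refine ⟨fun h' => h'.1, fun h' => ⟨h', fun r hr => ?_⟩⟩
      rw [Function.update_of_ne (hr t).symm, h r hr]
    · rw [if_neg h, if_neg]
      intro h'
      refine h fun r hr => ?_
      rw [h', Function.update_of_ne (hr t).symm]

theorem opOf_map {e : A → R} (he : e.Injective) (l : List (Gate A)) :
    opOf (l.map (Gate.map e)) = lift e (opOf l) := by
  induction l with
  | nil => exact (lift_one e).symm
  | cons g l ih => rw [List.map_cons, opOf, opOf, ih, Gate.op_map he, lift_mul he]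

theorem opOf_append (l l' : List (Gate R)) : opOf (l ++ l') = opOf l' * opOf l := by
  induction l with
  | nil => simp [opOf]
  | cons g l ih => rw [List.cons_append, opOf, opOf, ih, mul_assoc]

theorem opOf_eq_prod (l : List (Gate R)) : opOf l = (l.map Gate.op).reverse.prod := by
  induction l with
  | nil => simp [opOf]
  | cons g l ih => simp [opOf, ih]

theorem opOf_flatten (l : List (List (Gate R))) :
    opOf l.flatten = (l.map opOf).reverse.prod := by
  induction l with
  | nil => simp [opOf]
  | cons g l ih => simp [opOf_append, ih]

end Lift

/-! ### Locality -/

section Loc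

variable {A R : Type} [Fintype A] [DecidableEq A] [Fintype R] [DecidableEq R]

open Classical in
/-- The operators that act as the identity off the set `S` of qubits. -/
def loc (S : Set R) : Submonoid (Op R) where
  carrier := {M | ∃ M' : Op S, M = lift Subtype.val M'}
  mul_mem' := by
    rintro _ _ ⟨M, rfl⟩ ⟨N, rfl⟩
    exact ⟨M * N, (lift_mul Subtype.val_injective M N).symm⟩
  one_mem' := ⟨1, (lift_one _).symm⟩

theorem lift_mem_loc {S : Set R} {e : A → R} (h : ∀ a, e a ∈ S) (M : Op A) :
    lift e M ∈ loc S := by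
  classical
  exact ⟨lift (fun a => (⟨e a, h a⟩ : S)) M,
    lift_comp (f := (Subtype.val : S → R)) Subtype.val_injective (fun a => (⟨e a, h a⟩ : S)) M⟩

theorem loc_mono {S T : Set R} (h : S ⊆ T) : loc S ≤ loc T := by
  classical
  rintro _ ⟨M, rfl⟩
  exact lift_mem_loc (fun a => h a.2) M

theorem conjTranspose_mem_loc {S : Set R} {M : Op R} (h : M ∈ loc S) : Mᴴ ∈ loc S := by
  classical
  obtain ⟨M, rfl⟩ := h
  exact ⟨Mᴴ, lift_conjTranspose _ _⟩

theorem loc_commute {S T : Set R} (h : Disjoint S T) {M N : Op R} (hM : M ∈ loc S)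
    (hN : N ∈ loc T) : Commute M N := by
  classical
  obtain ⟨M, rfl⟩ := hM
  obtain ⟨N, rfl⟩ := hN
  exact lift_commute Subtype.val_injective Subtype.val_injective
    (fun a b hab => Set.disjoint_left.1 h a.2 (hab ▸ b.2)) M N

/-- The qubits a gate acts on. -/
def Gate.qubits {Q : Type} : Gate Q → List Q
  | .H q => [q]
  | .P q => [q]
  | .Pdg q => [q]
  | .T q => [q]
  | .cnot c t => [c, t]
  | .cz a b => [a, b]
  | .cp a b => [a, b]

theorem Gate.qubits_map {Q Q' : Type} (f : Q → Q') (g : Gate Q) :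
    (g.map f).qubits = g.qubits.map f := by
  cases g <;> rfl

theorem Gate.op_mem_loc {S : Set R} {g : Gate R} (h : ∀ q ∈ g.qubits, q ∈ S) :
    g.op ∈ loc S := by
  classical
  have key : ∃ g' : Gate S, g = g'.map Subtype.val := by
    cases g with
    | H q => exact ⟨.H ⟨q, h q (by simp [qubits])⟩, rfl⟩
    | P q => exact ⟨.P ⟨q, h q (by simp [qubits])⟩, rfl⟩
    | Pdg q => exact ⟨.Pdg ⟨q, h q (by simp [qubits])⟩, rfl⟩
    | T q => exact ⟨.T ⟨q, h q (by simp [qubits])⟩, rfl⟩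
    | cnot a b => exact ⟨.cnot ⟨a, h a (by simp [qubits])⟩ ⟨b, h b (by simp [qubits])⟩, rfl⟩
    | cz a b => exact ⟨.cz ⟨a, h a (by simp [qubits])⟩ ⟨b, h b (by simp [qubits])⟩, rfl⟩
    | cp a b => exact ⟨.cp ⟨a, h a (by simp [qubits])⟩ ⟨b, h b (by simp [qubits])⟩, rfl⟩
  obtain ⟨g', rfl⟩ := key
  exact ⟨g'.op, Gate.op_map Subtype.val_injective g'⟩

theorem opOf_mem_loc {S : Set R} {l : List (Gate R)} (h : ∀ g ∈ l, ∀ q ∈ g.qubits, q ∈ S) :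
    opOf l ∈ loc S := by
  induction l with
  | nil => exact (loc S).one_mem
  | cons g l ih =>
    exact (loc S).mul_mem (ih fun g' hg' => h g' (List.mem_cons_of_mem _ hg'))
      (Gate.op_mem_loc (h g List.mem_cons_self))

/-- A diagonal operator acts on those qubits on which its entries depend. -/
theorem diagonal_mem_loc {S : Set R} {d : (R → ZMod 2) → ℂ}
    (h : ∀ x y, (∀ q ∈ S, x q = y q) → d x = d y) : Matrix.diagonal d ∈ loc S := by
  classical
  refine ⟨Matrix.diagonal fun u => d (Function.extend Subtype.val u 0), ?_⟩
  rw [lift_diagonal]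
  congr 1
  funext x
  refine h _ _ fun q hq => ?_
  exact ((Subtype.val_injective).extend_apply (x ∘ Subtype.val) 0 (⟨q, hq⟩ : S)).symm

end Loc

/-! ### Unitary gates -/

section Unitary

variable {A R : Type} [Fintype A] [DecidableEq A] [Fintype R] [DecidableEq R]

/-- A gate is well formed if its qubits are distinct in the case of a `CNOT`. -/
def Gate.Valid {Q : Type} : Gate Q → Prop
  | .cnot c t => c ≠ t
  | _ => True

theorem Gate.Valid.map {Q Q' : Type} {f : Q → Q'} (hf : f.Injective) {g : Gate Q}
    (h : g.Valid) : (g.map f).Valid := by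
  cases g <;> first | trivial | exact fun hh => h (hf hh)

theorem zmod_two_eq (a : ZMod 2) : a = 0 ∨ a = 1 := by
  revert a; decide

theorem zmod_two_sum {β : Type} [AddCommMonoid β] (f : ZMod 2 → β) :
    ∑ a : ZMod 2, f a = f 0 + f 1 := Fin.sum_univ_two f

theorem sqrt_two_mul_self : ((Real.sqrt 2 : ℝ) : ℂ) * ((Real.sqrt 2 : ℝ) : ℂ) = 2 := by
  rw [← Complex.ofReal_mul, Real.mul_self_sqrt (by norm_num)]; norm_num

theorem cnot_conjTranspose {c t : R} (h : c ≠ t) :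
    ((Gate.cnot c t).op)ᴴ = (Gate.cnot c t).op := by
  ext x y
  simp only [Gate.op, Matrix.conjTranspose_apply, Matrix.of_apply]
  rw [apply_ite star, star_one, star_zero]
  refine if_congr ?_ rfl rfl
  have key : ∀ x y : R → ZMod 2, x = Function.update y t (y t + y c) →
      y = Function.update x t (x t + x c) := by
    rintro _ y rfl
    funext r
    rcases eq_or_ne r t with rfl | hr
    · simp only [Function.update_self, Function.update_of_ne h, add_assoc, CharTwo.add_self_eq_zero,
        add_zero]
    · simp only [Function.update_of_ne hr]
  exact ⟨key y x, key x y⟩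

theorem cnot_mulVec_apply {c t : R} (h : c ≠ t) (v : (R → ZMod 2) → ℂ) (x : R → ZMod 2) :
    ((Gate.cnot c t).op *ᵥ v) x = v (Function.update x t (x t + x c)) := by
  rw [← cnot_conjTranspose h]
  simp only [Matrix.mulVec, dotProduct, Gate.op, Matrix.conjTranspose_apply, Matrix.of_apply]
  rw [Finset.sum_eq_single (Function.update x t (x t + x c))]
  · simp
  · intro y _ hy
    rw [if_neg hy, star_zero, zero_mul]
  · simp

theorem H_conjTranspose (q : R) : ((Gate.H q).op)ᴴ = (Gate.H q).op := by
  ext x y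
  simp only [Gate.op, Matrix.conjTranspose_apply, Matrix.of_apply]
  rw [apply_ite star, star_zero]
  refine if_congr (by simp only [eq_comm]) ?_ rfl
  simp only [star_div₀, apply_ite star, star_one, star_neg, Complex.star_def, Complex.conj_ofReal]
  congr 1
  exact if_congr and_comm rfl rfl

theorem H_mulVec_apply (q : R) (v : (R → ZMod 2) → ℂ) (x : R → ZMod 2) :
    ((Gate.H q).op *ᵥ v) x =
      ∑ b : ZMod 2, (if x q = 1 ∧ b = 1 then -1 else 1) / ((Real.sqrt 2 : ℝ) : ℂ) *
        v (Function.update x q b) := by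
  have he : Function.Injective (fun _ : Unit => q) := fun _ _ _ => rfl
  have h1 : (Gate.H q).op = lift (fun _ : Unit => q) (Gate.H ()).op :=
    Gate.op_map (g := Gate.H ()) he
  rw [h1, lift_mulVec_apply he, ← (Equiv.funUnique Unit (ZMod 2)).symm.sum_comp]
  refine Finset.sum_congr rfl fun b _ => ?_
  have h2 : Function.extend (fun _ : Unit => q) ((Equiv.funUnique Unit (ZMod 2)).symm b) x =
      Function.update x q b := by
    funext r
    rcases eq_or_ne r q with rfl | hr
    · rw [Function.update_self]
      exact he.extend_apply _ _ ()
    · rw [Function.update_of_ne hr, extend_off _ _ fun _ => hr.symm]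
  rw [h2]
  congr 1

theorem diagonal_mem_unitary {d : (R → ZMod 2) → ℂ} (h : ∀ x, star (d x) * d x = 1) :
    Matrix.diagonal d ∈ unitary (Op R) := by
  have h1 : star (Matrix.diagonal d : Op R) * Matrix.diagonal d = 1 := by
    rw [Matrix.star_eq_conjTranspose, Matrix.diagonal_conjTranspose, Matrix.diagonal_mul_diagonal,
      ← Matrix.diagonal_one]
    congr 1
    funext x
    exact h x
  exact Unitary.mem_iff.2 ⟨h1, mul_eq_one_comm.1 h1⟩

theorem mem_unitary_of_involutive {M : Op R} (h : Mᴴ = M)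
    (h2 : ∀ v x, (M *ᵥ (M *ᵥ v)) x = v x) : M ∈ unitary (Op R) := by
  have h1 : M * M = 1 := by
    refine Matrix.ext_of_mulVec_single fun y => ?_
    rw [← Matrix.mulVec_mulVec, Matrix.one_mulVec]
    exact funext fun x => h2 _ x
  rw [Unitary.mem_iff, Matrix.star_eq_conjTranspose, h]
  exact ⟨h1, h1⟩

theorem Gate.op_mem_unitary {g : Gate R} (h : g.Valid) : g.op ∈ unitary (Op R) := by
  have hd : ∀ (p : Prop) [Decidable p] (z : ℂ), star z * z = 1 →
      star (if p then z else 1) * (if p then z else 1) = 1 := by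
    intro p _ z hz
    split_ifs
    · exact hz
    · simp
  have hT : star (Complex.exp (Complex.I * (Real.pi / 4))) *
      Complex.exp (Complex.I * (Real.pi / 4)) = 1 := by
    rw [Complex.star_def, ← Complex.exp_conj, ← Complex.exp_add]
    simp [← Complex.ofReal_ofNat]
  cases g with
  | P q => exact diagonal_mem_unitary fun x => hd _ _ (by simp)
  | Pdg q => exact diagonal_mem_unitary fun x => hd _ _ (by simp)
  | T q => exact diagonal_mem_unitary fun x => hd _ _ hT
  | cz a b => exact diagonal_mem_unitary fun x => hd _ _ (by simp)
  | cp a b => exact diagonal_mem_unitary fun x => hd _ _ (by simp)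
  | H q =>
    refine mem_unitary_of_involutive (H_conjTranspose q) fun v x => ?_
    have h2 := sqrt_two_mul_self
    have h3 : ((Real.sqrt 2 : ℝ) : ℂ) ≠ 0 := by
      intro h0; rw [h0] at h2; norm_num at h2
    have h4 : Function.update x q (x q) = x := Function.update_eq_self q x
    simp only [H_mulVec_apply, zmod_two_sum, Function.update_self, Function.update_idem]
    rcases zmod_two_eq (x q) with h0 | h0 <;> rw [h0] at h4 ⊢ <;> rw [h4] <;> simp <;> field_simp <;>
      rw [pow_two, h2] <;> ring
  | cnot c t =>
    have h : c ≠ t := h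
    refine mem_unitary_of_involutive (cnot_conjTranspose h) fun v x => ?_
    rw [cnot_mulVec_apply h, cnot_mulVec_apply h]
    congr 1
    funext r
    rcases eq_or_ne r t with rfl | hr
    · simp only [Function.update_self, Function.update_of_ne h, add_assoc, CharTwo.add_self_eq_zero,
        add_zero]
    · simp only [Function.update_of_ne hr]

theorem opOf_mem_unitary {l : List (Gate R)} (h : ∀ g ∈ l, g.Valid) :
    opOf l ∈ unitary (Op R) := by
  induction l with
  | nil => exact (unitary (Op R)).one_mem
  | cons g l ih =>
    exact (unitary (Op R)).mul_mem (ih fun g' hg' => h g' (List.mem_cons_of_mem _ hg'))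
      (Gate.op_mem_unitary (h g List.mem_cons_self))

end Unitary

/-! ### Tensor products of operators on disjoint blocks -/

section Par

variable {ι A B R : Type} [Fintype ι] [DecidableEq ι] [Fintype A] [DecidableEq A]
  [Fintype B] [DecidableEq B] [Fintype R] [DecidableEq R]

/-- The blocks `e i` of qubits are injectively labelled and pairwise disjoint. -/
def Blocks (e : ι → A → R) : Prop := Function.Injective fun p : ι × A => e p.1 p.2

theorem Blocks.injective {e : ι → A → R} (he : Blocks e) (i : ι) : (e i).Injective :=
  fun a b h => (Prod.ext_iff.1 (he (a₁ := (i, a)) (a₂ := (i, b)) h)).2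

theorem Blocks.eq {e : ι → A → R} (he : Blocks e) {i j : ι} {a b : A} (h : e i a = e j b) :
    i = j ∧ a = b :=
  Prod.ext_iff.1 (he (a₁ := (i, a)) (a₂ := (j, b)) h)

theorem Blocks.ne {e : ι → A → R} (he : Blocks e) {i j : ι} (h : i ≠ j) (a b : A) :
    e i a ≠ e j b :=
  fun hh => h (Prod.ext_iff.1 (he (a₁ := (i, a)) (a₂ := (j, b)) hh)).1

/-- The tensor product of a family of operators. -/
def tensor (M : ι → Op A) : Op (ι × A) :=
  Matrix.of fun x y => ∏ i, M i (fun a => x (i, a)) (fun a => y (i, a))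

theorem tensor_mul (M N : ι → Op A) : tensor (M * N) = tensor M * tensor N := by
  ext x z
  simp only [tensor, Matrix.of_apply, Matrix.mul_apply, Pi.mul_apply]
  rw [Finset.prod_univ_sum, Fintype.piFinset_univ,
    ← (Equiv.curry ι A (ZMod 2)).sum_comp]
  refine Finset.sum_congr rfl fun y _ => ?_
  rw [Finset.prod_mul_distrib]
  rfl

/-- A tensor product with a single nontrivial factor. -/
theorem tensor_mulSingle (i : ι) (M : Op A) :
    tensor (Pi.mulSingle i M : ι → Op A) = lift (fun a => (i, a)) M := by
  ext x y
  simp only [tensor, lift, Matrix.of_apply]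
  rw [← Finset.mul_prod_erase _ _ (Finset.mem_univ i), Pi.mulSingle_eq_same]
  have h1 : ∀ j ∈ Finset.univ.erase i, (Pi.mulSingle i M : ι → Op A) j (fun a => x (j, a))
      (fun a => y (j, a)) = if ∀ a, x (j, a) = y (j, a) then 1 else 0 := by
    intro j hj
    rw [Pi.mulSingle_eq_of_ne (Finset.ne_of_mem_erase hj), Matrix.one_apply]
    exact if_congr funext_iff rfl rfl
  rw [Finset.prod_congr rfl h1, Finset.prod_ite_zero, Finset.prod_const_one, mul_ite, mul_one,
    mul_zero]
  have hc : (∀ j ∈ Finset.univ.erase i, ∀ a, x (j, a) = y (j, a)) ↔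
      ∀ r : ι × A, (∀ a, (i, a) ≠ r) → x r = y r := by
    refine ⟨fun h r hr => ?_, fun h j hj a => ?_⟩
    · exact h r.1 (Finset.mem_erase.2 ⟨fun hh => hr r.2 (Prod.ext hh.symm rfl),
        Finset.mem_univ _⟩) r.2
    · exact h (j, a) fun b hb => Finset.ne_of_mem_erase hj (Prod.ext_iff.1 hb).1.symm
  simp only [hc]
  rfl

/-- The operator acting as `M i` on the block `e i`, for all `i`, and as the identity elsewhere. -/
def par (e : ι → A → R) (M : ι → Op A) : Op R := lift (fun p : ι × A => e p.1 p.2) (tensor M)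

theorem par_congr (e : ι → A → R) {M N : ι → Op A} (h : ∀ i, M i = N i) : par e M = par e N :=
  congrArg (par e) (funext h)

theorem par_mul {e : ι → A → R} (he : Blocks e) (M N : ι → Op A) :
    par e (M * N) = par e M * par e N := by
  rw [par, tensor_mul, lift_mul he]; rfl

theorem par_mulSingle {e : ι → A → R} (he : Blocks e) (i : ι) (M : Op A) :
    par e (Pi.mulSingle i M) = lift (e i) M := by
  rw [par, tensor_mulSingle, ← lift_comp he]; rfl

theorem par_one (e : ι → A → R) : par e (1 : ι → Op A) = 1 := by
  have h : tensor (1 : ι → Op A) = 1 := by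
    ext x y
    simp only [tensor, Matrix.of_apply, Pi.one_apply, Matrix.one_apply, Finset.prod_ite_zero,
      Finset.prod_const_one]
    refine if_congr ⟨fun h => funext fun p => ?_, ?_⟩ rfl rfl
    · exact congrFun (h p.1 (Finset.mem_univ _)) p.2
    · rintro rfl _ _; rfl
  rw [par, h, lift_one]

theorem par_conjTranspose (e : ι → A → R) (M : ι → Op A) :
    (par e M)ᴴ = par e fun i => (M i)ᴴ := by
  rw [par, lift_conjTranspose, par]
  congr 1
  ext x y
  simp only [tensor, Matrix.conjTranspose_apply, Matrix.of_apply, star_prod]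

theorem par_apply {e : ι → A → R} (M : ι → Op A) (x y : R → ZMod 2) :
    par e M x y = if ∀ r, (∀ i a, e i a ≠ r) → x r = y r then
      ∏ i, M i (x ∘ e i) (y ∘ e i) else 0 := by
  simp only [par, lift, Matrix.of_apply, Prod.forall]
  rfl

theorem par_mem_unitary {e : ι → A → R} (he : Blocks e) {M : ι → Op A}
    (hM : ∀ i, M i ∈ unitary (Op A)) : par e M ∈ unitary (Op R) := by
  rw [Unitary.mem_iff, Matrix.star_eq_conjTranspose, par_conjTranspose, ← par_mul he, ← par_mul he]
  constructor
  · rw [← par_one e]; congr 1; funext i; exact (Unitary.mem_iff.1 (hM i)).1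
  · rw [← par_one e]; congr 1; funext i; exact (Unitary.mem_iff.1 (hM i)).2

theorem list_prod_mulSingle (M : ι → Op A) (l : List ι) (hl : l.Nodup) :
    (l.map fun i => (Pi.mulSingle i (M i) : ι → Op A)).prod =
      fun i => if i ∈ l then M i else 1 := by
  induction l with
  | nil => funext i; simp
  | cons j l ih =>
    rw [List.nodup_cons] at hl
    rw [List.map_cons, List.prod_cons, ih hl.2]
    funext i
    rw [Pi.mul_apply]
    rcases eq_or_ne i j with rfl | hij
    · rw [Pi.mulSingle_eq_same, if_neg hl.1, if_pos List.mem_cons_self, mul_one]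
    · rw [Pi.mulSingle_eq_of_ne hij, one_mul]
      exact if_congr (by simp [hij]) rfl rfl

theorem list_prod_lift {e : ι → A → R} (he : Blocks e) (M : ι → Op A) (l : List ι)
    (hl : l.Nodup) :
    (l.map fun i => lift (e i) (M i)).prod = par e fun i => if i ∈ l then M i else 1 := by
  rw [← list_prod_mulSingle M l hl]
  clear hl
  induction l with
  | nil => exact (par_one e).symm
  | cons j l ih =>
    rw [List.map_cons, List.prod_cons, List.map_cons, List.prod_cons, par_mul he, ih,
      par_mulSingle he]

/-- A sequence of operators on disjoint blocks, in the reverse order as in `opOf`. -/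
theorem list_reverse_prod_lift {e : ι → A → R} (he : Blocks e) (M : ι → Op A) (l : List ι)
    (hl : l.Nodup) :
    (l.map fun i => lift (e i) (M i)).reverse.prod = par e fun i => if i ∈ l then M i else 1 := by
  rw [← List.map_reverse, list_prod_lift he M _ (List.nodup_reverse.2 hl)]
  simp only [List.mem_reverse]

/-- One layer of the same gate on several blocks. -/
theorem opOf_layer {e : ι → A → R} (he : Blocks e) (g : Gate A) (l : List ι) (hl : l.Nodup) :
    opOf (l.map fun i => g.map (e i)) = par e fun i => if i ∈ l then g.op else 1 := by
  rw [opOf_eq_prod, List.map_map, ← list_reverse_prod_lift he (fun _ => g.op) l hl]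
  congr 3
  funext i
  exact Gate.op_map (he.injective i) g

/-- Layer by layer, the circuit `gs` is run on each block in `l`. -/
theorem layers_prod {e : ι → A → R} (he : Blocks e) (gs : List (Gate A)) (l : List ι)
    (hl : l.Nodup) :
    (gs.map fun g => opOf (l.map fun i => g.map (e i))).reverse.prod =
      par e fun i => if i ∈ l then opOf gs else 1 := by
  induction gs with
  | nil =>
    simp only [List.map_nil, List.reverse_nil, List.prod_nil, opOf, ite_self]
    exact (par_one e).symm
  | cons g gs ih =>
    rw [List.map_cons, List.reverse_cons, List.prod_append, ih, List.prod_singleton,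
      opOf_layer he g l hl, ← par_mul he]
    congr 1
    funext i
    rw [Pi.mul_apply, opOf]
    split_ifs <;> simp

/-- Block by block, the circuit `gs` is run on each block in `l`. -/
theorem opOf_flatMap_blocks {e : ι → A → R} (he : Blocks e) (gs : List (Gate A)) (l : List ι)
    (hl : l.Nodup) :
    opOf (l.flatMap fun i => gs.map (Gate.map (e i))) =
      par e fun i => if i ∈ l then opOf gs else 1 := by
  rw [List.flatMap, opOf_flatten, List.map_map, ← list_reverse_prod_lift he (fun _ => opOf gs) l hl]
  congr 3
  funext i
  exact opOf_map (he.injective i) gs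

/-- A parallel operator acts only on the qubits on which its factors act. -/
theorem par_mem_loc {e : ι → A → R} {S : Set R} (he : Blocks e) {M : ι → Op A} {T : ι → Set A}
    (hM : ∀ i, M i ∈ loc (T i)) (h : ∀ i, ∀ a ∈ T i, e i a ∈ S) : par e M ∈ loc S := by
  classical
  have h1 : M = fun i => if i ∈ (Finset.univ : Finset ι).toList then M i else 1 := by
    funext i
    rw [if_pos (by simp)]
  rw [h1, ← list_prod_lift he M _ (Finset.nodup_toList _)]
  refine (loc S).list_prod_mem fun N hN => ?_
  obtain ⟨i, _, rfl⟩ := List.mem_map.1 hN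
  obtain ⟨M', hM'⟩ := hM i
  rw [hM', ← lift_comp (he.injective i)]
  exact lift_mem_loc (fun a => h i _ a.2) M'

/-! ### Projections onto zeros -/

open Classical in
/-- The projection onto the zero state of the qubits in `S`. -/
def zeroProj (S : Set R) : Op R := Matrix.diagonal fun x => if ∀ q ∈ S, x q = 0 then 1 else 0

theorem zeroProj_mem_loc (S : Set R) : zeroProj S ∈ loc S := by
  classical
  refine diagonal_mem_loc fun x y h => if_congr (forall₂_congr fun q hq => ?_) rfl rfl
  rw [h q hq]

theorem zeroProj_conjTranspose (S : Set R) : (zeroProj S)ᴴ = zeroProj S := by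
  classical
  rw [zeroProj, Matrix.diagonal_conjTranspose]
  congr 1
  funext x
  simp only [Pi.star_apply]
  split_ifs <;> simp

theorem zeroProj_mul (S T : Set R) : zeroProj S * zeroProj T = zeroProj (S ∪ T) := by
  classical
  rw [zeroProj, zeroProj, Matrix.diagonal_mul_diagonal, zeroProj]
  congr 1
  funext x
  simp only [Set.mem_union, or_imp, forall_and, ite_and, mul_ite, mul_one, mul_zero]
  split_ifs <;> rfl

theorem zeroProj_mul_self (S : Set R) : zeroProj S * zeroProj S = zeroProj S := by
  rw [zeroProj_mul, Set.union_self]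

theorem zeroProj_commute (S T : Set R) : Commute (zeroProj S) (zeroProj T) := by
  rw [Commute, SemiconjBy, zeroProj_mul, zeroProj_mul, Set.union_comm]

theorem lift_zeroProj (e : A → R) (S : Set A) : lift e (zeroProj S) = zeroProj (e '' S) := by
  classical
  rw [zeroProj, lift_diagonal, zeroProj]
  congr 1
  funext x
  exact if_congr (by simp) rfl rfl

theorem par_zeroProj {e : ι → A → R} (S : ι → Set A) :
    par e (fun i => zeroProj (S i)) = zeroProj {r | ∃ i, ∃ a ∈ S i, e i a = r} := by
  classical
  have h : tensor (fun i => zeroProj (S i)) =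
      (Matrix.diagonal fun x => if ∀ i, ∀ a ∈ S i, x (i, a) = 0 then 1 else 0 : Op (ι × A)) := by
    ext x y
    simp only [tensor, zeroProj, Matrix.of_apply, Matrix.diagonal_apply]
    by_cases hxy : x = y
    · subst hxy
      simp only [if_true, Finset.prod_ite_zero, Finset.prod_const_one, Finset.mem_univ, true_imp_iff]
    · rw [if_neg hxy]
      have : ∃ i, (fun a => x (i, a)) ≠ fun a => y (i, a) := by
        by_contra! h
        exact hxy (funext fun p => congrFun (h p.1) p.2)
      obtain ⟨i, hi⟩ := this
      exact Finset.prod_eq_zero (Finset.mem_univ i) (if_neg hi)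
  rw [par, h, lift_diagonal, zeroProj]
  congr 1
  funext x
  have hc : (∀ i, ∀ a ∈ S i, x (e i a) = 0) ↔
      ∀ r ∈ {r | ∃ i, ∃ a ∈ S i, e i a = r}, x r = 0 := by
    simp only [Set.mem_ofPred_eq, forall_exists_index, and_imp]
    exact ⟨fun h q i a ha hq => hq ▸ h i a ha, fun h i a ha => h _ i a ha rfl⟩
  simp only [Function.comp_apply, hc]
  split_ifs <;> rfl

theorem zeroProj_empty : zeroProj (∅ : Set R) = 1 := by
  classical
  rw [zeroProj, ← Matrix.diagonal_one]
  congr 1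
  funext x
  simp

theorem zeroProj_mulVec {S : Set R} {v : (R → ZMod 2) → ℂ}
    (h : ∀ x, (∃ q ∈ S, x q ≠ 0) → v x = 0) : zeroProj S *ᵥ v = v := by
  classical
  funext x
  rw [zeroProj, Matrix.mulVec_diagonal]
  split_ifs with hx
  · rw [one_mul]
  · push Not at hx
    rw [h x hx, mul_zero]

theorem zeroProj_mulVec_apply (S : Set R) (v : (R → ZMod 2) → ℂ) {x : R → ZMod 2}
    (h : ∃ q ∈ S, x q ≠ 0) : (zeroProj S *ᵥ v) x = 0 := by
  classical
  rw [zeroProj, Matrix.mulVec_diagonal, if_neg, zero_mul]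
  push Not
  exact h

end Par

/-! ### The Steane code -/

/-- The word `s G + (b, …, b)` in the support of the logical basis state `|b⟩`, where `G` generates
the simplex code. -/
def steaneWord (b : ZMod 2) (s : Fin 3 → ZMod 2) : Fin 7 → ZMod 2 :=
  (s ᵥ* steaneGen) + fun _ => b

theorem steaneWord_apply (b : ZMod 2) (s : Fin 3 → ZMod 2) :
    steaneWord b s = ![s 1 + s 2 + b, s 1 + b, s 2 + b, s 0 + b, s 0 + s 2 + b, s 0 + s 1 + b,
      s 0 + s 1 + s 2 + b] := by
  funext i
  fin_cases i <;>
    simp [steaneWord, steaneGen, Matrix.vecHead, Matrix.vecTail, add_assoc]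

theorem steaneWord_injective (b : ZMod 2) : Function.Injective (steaneWord b) := by
  intro s t h
  rw [steaneWord_apply, steaneWord_apply] at h
  funext i
  fin_cases i
  · simpa using congrFun h 3
  · simpa using congrFun h 1
  · simpa using congrFun h 2

theorem steaneWord_add (b b' : ZMod 2) (s s' : Fin 3 → ZMod 2) :
    steaneWord b s + steaneWord b' s' = steaneWord (b + b') (s + s') := by
  funext i
  simp only [steaneWord, Matrix.add_vecMul, Pi.add_apply]
  ring

theorem steaneAmp_eq (b : ZMod 2) (c : Fin 7 → ZMod 2) :
    steaneAmp b c = if ∃ s, c = steaneWord b s then 1 / ((Real.sqrt 8 : ℝ) : ℂ) else 0 := rfl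

theorem steaneAmp_eq_sum (b : ZMod 2) (c : Fin 7 → ZMod 2) :
    steaneAmp b c = ∑ s, if c = steaneWord b s then 1 / ((Real.sqrt 8 : ℝ) : ℂ) else 0 := by
  rw [steaneAmp_eq]
  split_ifs with h
  · obtain ⟨s, rfl⟩ := h
    rw [Finset.sum_eq_single s (fun t _ ht => if_neg fun hh => ht (steaneWord_injective b hh).symm)
      (by simp), if_pos rfl]
  · exact (Finset.sum_eq_zero fun s _ => if_neg fun hs => h ⟨s, hs⟩).symm

theorem exists_word_of_steaneAmp_ne_zero {b : ZMod 2} {c : Fin 7 → ZMod 2}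
    (h : steaneAmp b c ≠ 0) : ∃ s, c = steaneWord b s := by
  rw [steaneAmp_eq] at h
  exact (ite_ne_right_iff.1 h).1

/-- A transversal `CNOT` on two Steane blocks is the logical `CNOT`. -/
theorem steaneAmp_mul_add (b b' : ZMod 2) (c c' : Fin 7 → ZMod 2) :
    steaneAmp b c * steaneAmp b' (c + c') = steaneAmp b c * steaneAmp (b + b') c' := by
  by_cases h : steaneAmp b c = 0
  · rw [h, zero_mul, zero_mul]
  obtain ⟨s, rfl⟩ := exists_word_of_steaneAmp_ne_zero h
  congr 1
  rw [steaneAmp_eq, steaneAmp_eq]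
  refine if_congr ⟨?_, ?_⟩ rfl rfl
  · rintro ⟨t, ht⟩
    refine ⟨s + t, ?_⟩
    rw [← steaneWord_add, ← ht, ← add_assoc, CharTwo.add_self_eq_zero, zero_add]
  · rintro ⟨t, rfl⟩
    refine ⟨s + t, ?_⟩
    rw [steaneWord_add, ← add_assoc, CharTwo.add_self_eq_zero, zero_add]

/-- Steane codewords of logical value `b` have weight `3 b` modulo `4`. -/
theorem steane_weight {b : ZMod 2} {c : Fin 7 → ZMod 2} (h : steaneAmp b c ≠ 0) :
    (∑ a, (c a).val) % 4 = (3 * b.val) % 4 := by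
  obtain ⟨s, rfl⟩ := exists_word_of_steaneAmp_ne_zero h
  rw [steaneWord_apply]
  simp only [Fin.sum_univ_seven]
  generalize s 0 = s0
  generalize s 1 = s1
  generalize s 2 = s2
  clear h
  revert b s0 s1 s2
  decide

/-- Inner products of words of the Steane code depend only on the logical values, which makes the
transversal `CZ` logical. -/
theorem steane_inner {b b' : ZMod 2} {c c' : Fin 7 → ZMod 2} (h : steaneAmp b c ≠ 0)
    (h' : steaneAmp b' c' ≠ 0) : ∑ a, c a * c' a = b * b' := by
  obtain ⟨s, rfl⟩ := exists_word_of_steaneAmp_ne_zero h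
  obtain ⟨t, rfl⟩ := exists_word_of_steaneAmp_ne_zero h'
  rw [steaneWord_apply, steaneWord_apply]
  simp only [Fin.sum_univ_seven]
  generalize s 0 = s0
  generalize s 1 = s1
  generalize s 2 = s2
  generalize t 0 = t0
  generalize t 1 = t1
  generalize t 2 = t2
  clear h h'
  revert b b' s0 s1 s2 t0 t1 t2
  decide

/-- The entries `(-1)^{ab} / √2` of the Hadamard gate. -/
def had (a b : ZMod 2) : ℂ := (if a = 1 ∧ b = 1 then -1 else 1) / ((Real.sqrt 2 : ℝ) : ℂ)

theorem had_comm (a b : ZMod 2) : had a b = had b a := by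
  rw [had, had]
  congr 1
  exact if_congr and_comm rfl rfl

theorem sqrt_eight : ((Real.sqrt 8 : ℝ) : ℂ) = 2 * ((Real.sqrt 2 : ℝ) : ℂ) := by
  rw [show (8 : ℝ) = 2 ^ 2 * 2 by norm_num, Real.sqrt_mul (by norm_num), Real.sqrt_sq (by norm_num)]
  norm_num

theorem sqrt_two_ne_zero : ((Real.sqrt 2 : ℝ) : ℂ) ≠ 0 := by
  intro h0
  have h2 := sqrt_two_mul_self
  rw [h0] at h2
  norm_num at h2

/-- The sign `(-1)^{ab}`. -/
def sgn (a b : ZMod 2) : ℤ := if a = 1 ∧ b = 1 then -1 else 1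

set_option maxRecDepth 100000 in
/-- The character sum over a coset of the simplex code. It is supported on the dual of the simplex
code, the Hamming code, which is the union of the two cosets of the simplex code used by the Steane
code. -/
theorem steane_character_sum (b d0 d1 d2 d3 d4 d5 d6 : ZMod 2) :
    (∑ s0 : ZMod 2, ∑ s1 : ZMod 2, ∑ s2 : ZMod 2,
      sgn d0 (s1 + s2 + b) * sgn d1 (s1 + b) * sgn d2 (s2 + b) * sgn d3 (s0 + b) *
        sgn d4 (s0 + s2 + b) * sgn d5 (s0 + s1 + b) * sgn d6 (s0 + s1 + s2 + b)) =
    ∑ b' : ZMod 2, sgn b b' *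
      if d0 = d1 + d2 + b' ∧ d4 = d3 + d2 + b' ∧ d5 = d3 + d1 + b' ∧ d6 = d3 + d1 + d2 then 8
      else 0 := by
  revert b d0 d1 d2 d3 d4 d5 d6
  decide +kernel

/-- Parity checks of the two cosets of the simplex code, with the qubits `1`, `2`, `3` as free
coordinates. -/
theorem eq_steaneWord_iff (b : ZMod 2) (u : Fin 7 → ZMod 2) : (∃ s, u = steaneWord b s) ↔
    (u 0 = u 1 + u 2 + b ∧ u 4 = u 3 + u 2 + b ∧ u 5 = u 3 + u 1 + b ∧ u 6 = u 3 + u 1 + u 2) := by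
  constructor
  · rintro ⟨s, rfl⟩
    rw [steaneWord_apply]
    simp only [Matrix.cons_val]
    generalize s 0 = s0
    generalize s 1 = s1
    generalize s 2 = s2
    revert b s0 s1 s2
    decide
  · rintro ⟨h0, h4, h5, h6⟩
    refine ⟨![u 3 + b, u 1 + b, u 2 + b], ?_⟩
    rw [steaneWord_apply]
    have key : ∀ b x1 x2 x3 : ZMod 2, x1 + x2 = x1 + b + (x2 + b) ∧ x1 = x1 + b + b ∧
        x3 + x1 + x2 = x3 + b + (x1 + b) + (x2 + b) + b := by decide
    funext i
    fin_cases i <;> simp [h0, h4, h5, h6]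
    · exact (key b _ _ 0).1
    · exact (key b _ 0 0).2.1
    · exact (key b _ 0 0).2.1
    · exact (key b _ 0 0).2.1
    · exact (key b _ _ 0).1
    · exact (key b _ _ 0).1
    · exact (key b _ _ _).2.2

theorem sum_fin_three {β : Type} [AddCommMonoid β] (f : (Fin 3 → ZMod 2) → β) :
    ∑ s, f s = ∑ s0, ∑ s1, ∑ s2, f ![s0, s1, s2] := by
  have h : ∀ s : Fin 3 → ZMod 2, ![s 0, s 1, s 2] = s := fun s => by
    funext i; fin_cases i <;> rfl
  let E : (Fin 3 → ZMod 2) ≃ ZMod 2 × ZMod 2 × ZMod 2 :=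
    ⟨fun s => (s 0, s 1, s 2), fun p => ![p.1, p.2.1, p.2.2], h, fun _ => rfl⟩
  rw [← E.symm.sum_comp, Fintype.sum_prod_type]
  exact Finset.sum_congr rfl fun _ _ => Fintype.sum_prod_type _

theorem had_eq_sgn (a b : ZMod 2) : had a b = ((sgn a b : ℤ) : ℂ) / ((Real.sqrt 2 : ℝ) : ℂ) := by
  rw [had, sgn]
  congr 1
  split_ifs <;> simp

/-- The transversal Hadamard gate is the logical Hadamard gate of the Steane code. -/
theorem steane_hadamard (b : ZMod 2) (d : Fin 7 → ZMod 2) :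
    ∑ c, (∏ a, had (d a) (c a)) * steaneAmp b c = ∑ b', had b' b * steaneAmp b' d := by
  have h1 : ∑ c, (∏ a, had (d a) (c a)) * steaneAmp b c =
      ∑ s, (∏ a, had (d a) (steaneWord b s a)) * (1 / ((Real.sqrt 8 : ℝ) : ℂ)) := by
    simp only [steaneAmp_eq_sum, Finset.mul_sum]
    rw [Finset.sum_comm]
    refine Finset.sum_congr rfl fun s _ => ?_
    rw [Finset.sum_eq_single (steaneWord b s) (fun c _ hc => by rw [if_neg hc, mul_zero]) (by simp),
      if_pos rfl]
  have h2 : ∀ s, (∏ a, had (d a) (steaneWord b s a)) =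
      ((sgn (d 0) (s 1 + s 2 + b) * sgn (d 1) (s 1 + b) * sgn (d 2) (s 2 + b) *
        sgn (d 3) (s 0 + b) * sgn (d 4) (s 0 + s 2 + b) * sgn (d 5) (s 0 + s 1 + b) *
        sgn (d 6) (s 0 + s 1 + s 2 + b) : ℤ) : ℂ) / ((Real.sqrt 2 : ℝ) : ℂ) ^ 7 := by
    intro s
    rw [steaneWord_apply]
    simp only [Fin.prod_univ_seven, had_eq_sgn, Matrix.cons_val]
    push_cast
    have := sqrt_two_ne_zero
    field_simp
  have h3 := congrArg (fun n : ℤ => (n : ℂ))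
    (steane_character_sum b (d 0) (d 1) (d 2) (d 3) (d 4) (d 5) (d 6))
  simp only [Int.cast_sum] at h3
  rw [h1]
  simp only [h2]
  rw [← Finset.sum_mul, ← Finset.sum_div, sum_fin_three]
  simp only [Matrix.cons_val]
  rw [h3, Finset.sum_div, Finset.sum_mul]
  refine Finset.sum_congr rfl fun b' _ => ?_
  rw [steaneAmp_eq, had_comm b' b, had_eq_sgn]
  simp only [eq_steaneWord_iff]
  have h7 : ((Real.sqrt 2 : ℝ) : ℂ) ^ 7 = 8 * ((Real.sqrt 2 : ℝ) : ℂ) := by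
    have := sqrt_two_mul_self
    linear_combination (((Real.sqrt 2 : ℝ) : ℂ) ^ 5 + 2 * ((Real.sqrt 2 : ℝ) : ℂ) ^ 3 +
      4 * ((Real.sqrt 2 : ℝ) : ℂ)) * this
  rw [h7, sqrt_eight]
  have := sqrt_two_ne_zero
  split_ifs
  · push_cast
    field_simp
  · simp

/-! ### The encoding circuit of the Steane code -/

section Update

variable {β : Type} (a0 a1 a2 a3 a4 a5 a6 x : β)

theorem update_vec0 : Function.update ![a0, a1, a2, a3, a4, a5, a6] 0 x =
    ![x, a1, a2, a3, a4, a5, a6] := by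
  funext i; fin_cases i <;> rfl

theorem update_vec1 : Function.update ![a0, a1, a2, a3, a4, a5, a6] 1 x =
    ![a0, x, a2, a3, a4, a5, a6] := by
  funext i; fin_cases i <;> rfl

theorem update_vec2 : Function.update ![a0, a1, a2, a3, a4, a5, a6] 2 x =
    ![a0, a1, x, a3, a4, a5, a6] := by
  funext i; fin_cases i <;> rfl

theorem update_vec3 : Function.update ![a0, a1, a2, a3, a4, a5, a6] 3 x =
    ![a0, a1, a2, x, a4, a5, a6] := by
  funext i; fin_cases i <;> rfl

theorem update_vec4 : Function.update ![a0, a1, a2, a3, a4, a5, a6] 4 x =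
    ![a0, a1, a2, a3, x, a5, a6] := by
  funext i; fin_cases i <;> rfl

theorem update_vec5 : Function.update ![a0, a1, a2, a3, a4, a5, a6] 5 x =
    ![a0, a1, a2, a3, a4, x, a6] := by
  funext i; fin_cases i <;> rfl

theorem update_vec6 : Function.update ![a0, a1, a2, a3, a4, a5, a6] 6 x =
    ![a0, a1, a2, a3, a4, a5, x] := by
  funext i; fin_cases i <;> rfl

end Update

theorem mul_entry_eq_mulVec {ι : Type} [Fintype ι] [DecidableEq ι] (M : Matrix ι ι ℂ) (x z : ι) :
    M x z = (M *ᵥ Pi.single z 1) x := by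
  rw [Matrix.mulVec_single_one]; rfl

/-- The encoding circuit maps `|b⟩|0⟩` to the logical basis state `|b⟩`. -/
theorem steaneEnc_apply (u z : Fin 7 → ZMod 2) (hz : ∀ q, q ≠ 0 → z q = 0) :
    opOf steaneEnc u z = steaneAmp (z 0) u := by
  have hz' : z = ![z 0, 0, 0, 0, 0, 0, 0] := by
    funext i
    by_cases h : i = 0
    · subst h; rfl
    · rw [hz i h]; fin_cases i <;> first | rfl | exact absurd rfl h
  have hu' : u = ![u 0, u 1, u 2, u 3, u 4, u 5, u 6] := by
    funext i; fin_cases i <;> rfl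
  -- Undoing the `CNOT` gates of the circuit turns `u` into a word whose qubit `0` must hold `b`
  -- and whose qubits `4`, `5`, `6` must be zero; the qubits `1`, `2`, `3` are in the state `|+⟩`.
  have key : ∀ b u0 u1 u2 u3 u4 u5 u6 : ZMod 2, (u0 + u2 + u1 = b ∧
      u4 + u2 + u3 + (u0 + u2 + u1) = 0 ∧ u5 + u1 + u3 + (u0 + u2 + u1) = 0 ∧
      u6 + u2 + u1 + u3 = 0) ↔
      (u0 = u1 + u2 + b ∧ u4 = u3 + u2 + b ∧ u5 = u3 + u1 + b ∧ u6 = u3 + u1 + u2) := by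
    decide +kernel
  have hr : ((Real.sqrt 2 : ℝ) : ℂ)⁻¹ * (((Real.sqrt 2 : ℝ) : ℂ)⁻¹ * ((Real.sqrt 2 : ℝ) : ℂ)⁻¹) =
      1 / ((Real.sqrt 8 : ℝ) : ℂ) := by
    have h3 := sqrt_two_ne_zero
    rw [sqrt_eight, ← sqrt_two_mul_self]
    field_simp
  have main : ∀ b u0 u1 u2 u3 u4 u5 u6 : ZMod 2, (opOf steaneEnc *ᵥ
      Pi.single ![b, 0, 0, 0, 0, 0, 0] 1) ![u0, u1, u2, u3, u4, u5, u6] =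
      if u0 = u1 + u2 + b ∧ u4 = u3 + u2 + b ∧ u5 = u3 + u1 + b ∧ u6 = u3 + u1 + u2 then
        1 / ((Real.sqrt 8 : ℝ) : ℂ) else 0 := by
    intro b u0 u1 u2 u3 u4 u5 u6
    simp only [steaneEnc, opOf, one_mul, ← Matrix.mulVec_mulVec, cnot_mulVec_apply, H_mulVec_apply,
      ne_eq, Fin.reduceEq, not_false_eq_true, zmod_two_sum, update_vec0, update_vec1, update_vec2,
      update_vec3, update_vec4, update_vec5, update_vec6, Matrix.cons_val, Pi.single_apply,
      Matrix.vecCons_inj, one_ne_zero, false_and, and_false, if_false, mul_zero, add_zero,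
      zero_ne_one, true_and, and_true]
    rw [if_congr (key b u0 u1 u2 u3 u4 u5 u6) rfl rfl]
    split_ifs
    · rw [mul_one, one_div, hr]
    · simp
  rw [mul_entry_eq_mulVec (opOf steaneEnc) u z, steaneAmp_eq,
    if_congr (eq_steaneWord_iff (z 0) u) rfl rfl, ← main, ← hz', ← hu']

/-! ### The concatenated code -/

/-- A configuration of a block as seven configurations of its sub-blocks. -/
def splitBlk (L : ℕ) :
    ((Fin (L + 1) → Fin 7) → ZMod 2) ≃ (Fin 7 → (Fin L → Fin 7) → ZMod 2) where
  toFun x a w := x (Fin.cons a w)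
  invFun y v := y (v 0) (Fin.tail v)
  left_inv x := by
    funext v
    simp only [Fin.cons_self_tail]
  right_inv y := by
    funext a w
    simp only [Fin.cons_zero, Fin.tail_cons]

theorem prod_splitBlk {β : Type} [CommMonoid β] {L : ℕ} (f : (Fin (L + 1) → Fin 7) → β) :
    ∏ v, f v = ∏ a : Fin 7, ∏ w : Fin L → Fin 7, f (Fin.cons a w) := by
  rw [← Fintype.prod_prod_type' (f := fun a (w : Fin L → Fin 7) => f (Fin.cons a w))]
  exact (Fintype.prod_equiv (Fin.consEquiv fun _ : Fin (L + 1) => Fin 7) _ _ fun _ => rfl).symm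

theorem sum_splitBlk {β : Type} [AddCommMonoid β] {L : ℕ} (f : (Fin (L + 1) → Fin 7) → β) :
    ∑ v, f v = ∑ a : Fin 7, ∑ w : Fin L → Fin 7, f (Fin.cons a w) := by
  rw [← Fintype.sum_prod_type' (f := fun a (w : Fin L → Fin 7) => f (Fin.cons a w))]
  exact (Fintype.sum_equiv (Fin.consEquiv fun _ : Fin (L + 1) => Fin 7) _ _ fun _ => rfl).symm

/-- A transversal `CNOT` is the logical `CNOT`. -/
theorem encAmp_mul_add (L : ℕ) (b b' : ZMod 2) (x y : (Fin L → Fin 7) → ZMod 2) :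
    encAmp L b x * encAmp L b' (x + y) = encAmp L b x * encAmp L (b + b') y := by
  induction L generalizing b b' with
  | zero =>
    simp only [encAmp, Pi.add_apply]
    have key : ∀ b b' x y : ZMod 2, x = b → (x + y = b' ↔ y = b + b') := by decide
    by_cases h : x ![] = b
    · simp only [key _ _ _ _ h]
    · simp only [h, if_false, zero_mul]
  | succ L ih =>
    simp only [encAmp, Finset.sum_mul_sum]
    refine Finset.sum_congr rfl fun c _ => ?_
    rw [← Equiv.sum_comp (Equiv.addLeft c)]
    refine Finset.sum_congr rfl fun c' _ => ?_
    have h1 : ∀ a, encAmp L (c a) (fun w => x (Fin.cons a w)) *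
        encAmp L ((c + c') a) (fun w => (x + y) (Fin.cons a w)) =
        encAmp L (c a) (fun w => x (Fin.cons a w)) * encAmp L (c' a) fun w => y (Fin.cons a w) := by
      intro a
      have h2 := ih (c a) ((c + c') a) (fun w => x (Fin.cons a w)) (fun w => y (Fin.cons a w))
      rw [Pi.add_apply, ← add_assoc, CharTwo.add_self_eq_zero, zero_add] at h2
      exact h2
    simp only [Equiv.coe_addLeft]
    rw [mul_mul_mul_comm, mul_mul_mul_comm _ _ (steaneAmp (b + b') c'), steaneAmp_mul_add,
      ← Finset.prod_mul_distrib, ← Finset.prod_mul_distrib]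
    congr 1
    exact Finset.prod_congr rfl fun a _ => h1 a

theorem exists_outer_of_encAmp_ne_zero {L : ℕ} {b : ZMod 2} {x : (Fin (L + 1) → Fin 7) → ZMod 2}
    (h : encAmp (L + 1) b x ≠ 0) :
    ∃ c, steaneAmp b c ≠ 0 ∧ ∀ a, encAmp L (c a) (fun w => x (Fin.cons a w)) ≠ 0 := by
  obtain ⟨c, _, hc⟩ := Finset.exists_ne_zero_of_sum_ne_zero h
  exact ⟨c, left_ne_zero_of_mul hc, fun a =>
    Finset.prod_ne_zero_iff.1 (right_ne_zero_of_mul hc) a (Finset.mem_univ a)⟩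

/-- The words in the support of `|b⟩` have weight `3^L b` modulo `4`. -/
theorem encAmp_weight {L : ℕ} {b : ZMod 2} {x : (Fin L → Fin 7) → ZMod 2} (h : encAmp L b x ≠ 0) :
    ∑ q, (x q).val ≡ 3 ^ L * b.val [MOD 4] := by
  induction L generalizing b with
  | zero =>
    simp only [encAmp, ne_eq, ite_eq_right_iff, one_ne_zero, imp_false, not_not] at h
    rw [← h, Fintype.sum_subsingleton _ ![], pow_zero, one_mul]
  | succ L ih =>
    obtain ⟨c, hc, hx⟩ := exists_outer_of_encAmp_ne_zero h
    rw [sum_splitBlk (fun v => (x v).val)]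
    have h1 : ∑ a, ∑ w : Fin L → Fin 7, (x (Fin.cons a w)).val ≡ ∑ a, 3 ^ L * (c a).val [MOD 4] :=
      Nat.ModEq.sum fun a _ => ih (hx a)
    refine h1.trans ?_
    rw [← Finset.mul_sum, pow_succ, mul_assoc]
    exact Nat.ModEq.mul_left _ (steane_weight hc)

/-- Inner products of words in the support of logical basis states depend only on the logical
values, which makes the transversal `CZ` logical. -/
theorem encAmp_inner {L : ℕ} {b b' : ZMod 2} {x y : (Fin L → Fin 7) → ZMod 2}
    (h : encAmp L b x ≠ 0) (h' : encAmp L b' y ≠ 0) : ∑ q, x q * y q = b * b' := by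
  induction L generalizing b b' with
  | zero =>
    simp only [encAmp, ne_eq, ite_eq_right_iff, one_ne_zero, imp_false, not_not] at h h'
    rw [← h, ← h', Fintype.sum_subsingleton _ ![]]
  | succ L ih =>
    obtain ⟨c, hc, hx⟩ := exists_outer_of_encAmp_ne_zero h
    obtain ⟨c', hc', hy⟩ := exists_outer_of_encAmp_ne_zero h'
    rw [sum_splitBlk (fun v => x v * y v), ← steane_inner hc hc']
    exact Finset.sum_congr rfl fun a _ => ih (hx a) (hy a)

theorem prod_sum_eq {ι κ : Type} [Fintype ι] [DecidableEq ι] [Fintype κ] (f : ι → κ → ℂ) :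
    ∏ i, ∑ j, f i j = ∑ g : ι → κ, ∏ i, f i (g i) := by
  rw [Finset.prod_univ_sum, Fintype.piFinset_univ]

/-- The transversal Hadamard gate is the logical Hadamard gate. -/
theorem encAmp_hadamard (L : ℕ) (b : ZMod 2) (x : (Fin L → Fin 7) → ZMod 2) :
    ∑ y, (∏ q, had (x q) (y q)) * encAmp L b y = ∑ b', had b' b * encAmp L b' x := by
  induction L generalizing b with
  | zero =>
    simp only [encAmp, mul_ite, mul_one, mul_zero]
    rw [Finset.sum_ite_eq, if_pos (Finset.mem_univ _), Finset.sum_eq_single (fun _ => b)]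
    · rw [if_pos rfl, Fintype.prod_subsingleton _ ![], had_comm]
    · intro y _ hy
      exact if_neg fun hh => hy (funext fun q => by rw [Subsingleton.elim q ![], hh])
    · simp
  | succ L ih =>
    have h1 : ∀ y, (∏ q, had (x q) (y q)) * encAmp (L + 1) b y = ∑ c, steaneAmp b c *
        ∏ a, (∏ w, had (x (Fin.cons a w)) (splitBlk L y a w)) *
          encAmp L (c a) (splitBlk L y a) := by
      intro y
      rw [prod_splitBlk (fun q => had (x q) (y q)), encAmp, Finset.mul_sum]
      refine Finset.sum_congr rfl fun c _ => ?_
      rw [Finset.prod_mul_distrib]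
      simp only [splitBlk, Equiv.coe_fn_mk]
      ring
    simp only [h1]
    rw [Finset.sum_comm]
    -- On each sub-block the induction hypothesis applies; the outer level is the Steane code.
    have h2 : ∀ c : Fin 7 → ZMod 2, (∑ y : (Fin (L + 1) → Fin 7) → ZMod 2, steaneAmp b c *
        ∏ a, (∏ w, had (x (Fin.cons a w)) (splitBlk L y a w)) *
          encAmp L (c a) (splitBlk L y a)) =
        ∑ d : Fin 7 → ZMod 2, steaneAmp b c *
          ∏ a, had (d a) (c a) * encAmp L (d a) (fun w => x (Fin.cons a w)) := by
      intro c
      rw [← Finset.mul_sum, ← Finset.mul_sum]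
      congr 1
      rw [(splitBlk L).sum_comp (fun y : Fin 7 → (Fin L → Fin 7) → ZMod 2 =>
        ∏ a, (∏ w, had (x (Fin.cons a w)) (y a w)) * encAmp L (c a) (y a))]
      rw [← prod_sum_eq (fun a (y : (Fin L → Fin 7) → ZMod 2) =>
        (∏ w, had (x (Fin.cons a w)) (y w)) * encAmp L (c a) y),
        ← prod_sum_eq (fun a d => had d (c a) * encAmp L d (fun w => x (Fin.cons a w)))]
      exact Finset.prod_congr rfl fun a _ => ih (c a) _
    simp only [h2]
    rw [Finset.sum_comm]
    simp only [encAmp, Finset.mul_sum]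
    rw [Finset.sum_comm (s := (Finset.univ : Finset (ZMod 2)))]
    refine Finset.sum_congr rfl fun d _ => ?_
    simp only [← mul_assoc]
    rw [← Finset.sum_mul, ← steane_hadamard, Finset.sum_mul]
    refine Finset.sum_congr rfl fun c _ => ?_
    rw [Finset.prod_mul_distrib]
    ring

theorem cons_zero_injective (L : ℕ) :
    Function.Injective fun a : Fin 7 => (Fin.cons a fun _ => 0 : Fin (L + 1) → Fin 7) :=
  fun a b h => by simpa using congrFun h 0

theorem blocks_cons (L : ℕ) :
    Blocks fun (a : Fin 7) (w : Fin L → Fin 7) => (Fin.cons a w : Fin (L + 1) → Fin 7) := by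
  rintro ⟨a, w⟩ ⟨b, v⟩ h
  obtain ⟨h1, h2⟩ := Fin.cons_inj.1 h
  exact Prod.ext h1 h2

/-- The encoding circuit maps `|b⟩|0⟩` to the logical basis state `|b⟩`. -/
theorem encGates_apply (L : ℕ) (x z : (Fin L → Fin 7) → ZMod 2) (hz : ∀ q, q ≠ 0 → z q = 0) :
    opOf (encGates L) x z = encAmp L (z 0) x := by
  induction L with
  | zero =>
    simp only [encGates, opOf, encAmp, Matrix.one_apply]
    refine if_congr ⟨fun h => ?_, fun h => funext fun q => ?_⟩ rfl rfl
    · rw [h, Subsingleton.elim 0 ![]]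
    · rw [Subsingleton.elim q ![], h, Subsingleton.elim 0 ![]]
  | succ L ih =>
    have he := cons_zero_injective L
    rw [encGates, opOf_append, opOf_map he,
      opOf_flatMap_blocks (blocks_cons L) _ _ (List.nodup_finRange 7), mul_lift_apply he, encAmp]
    refine Finset.sum_congr rfl fun c _ => ?_
    -- The outer encoder acts on the first qubits of the sub-blocks; these start at zero except for
    -- the first one, and all other qubits of the sub-blocks are untouched.
    have h0 : (Fin.cons (0 : Fin 7) fun _ => 0 : Fin (L + 1) → Fin 7) = 0 := by
      funext i; refine Fin.cases ?_ (fun _ => ?_) i <;> rfl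
    rw [steaneEnc_apply, mul_comm, par_apply, if_pos]
    · congr 1
      · exact congrArg (fun q => steaneAmp (z q) c) h0
      · refine Finset.prod_congr rfl fun a _ => ?_
        rw [if_pos (List.mem_finRange a), ih]
        · congr 1
          exact he.extend_apply _ _ a
        · intro w hw
          have hw' : ∀ b : Fin 7, (Fin.cons b fun _ => 0 : Fin (L + 1) → Fin 7) ≠ Fin.cons a w :=
            fun b hb => hw (Fin.cons_inj.1 hb).2.symm
          rw [Function.comp_apply, extend_off _ _ hw']
          refine hz _ fun hh => hw ?_
          rw [← h0] at hh
          exact (Fin.cons_inj.1 hh).2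
    · intro r hr
      exact absurd (Fin.cons_self_tail r) (hr (r 0) (Fin.tail r))
    · intro q hq
      refine hz _ fun hh => hq ?_
      rw [← h0] at hh
      exact (Fin.cons_inj.1 hh).1

/-- A property of gates that is stable under relabelling holds for all gates of the concatenated
encoder if it holds for those of the Steane encoder. -/
theorem encGates_induction {L : ℕ} {p : ∀ {Q : Type}, Gate Q → Prop}
    (hs : ∀ g ∈ steaneEnc, p g)
    (hm : ∀ {Q Q' : Type} (f : Q → Q') (_ : f.Injective) (g : Gate Q), p g → p (g.map f)) :
    ∀ g ∈ encGates L, p g := by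
  induction L with
  | zero => simp [encGates]
  | succ L ih =>
    intro g hg
    rw [encGates, List.mem_append, List.mem_map, List.mem_flatMap] at hg
    rcases hg with ⟨g', hg', rfl⟩ | ⟨a, _, ha⟩
    · exact hm _ (cons_zero_injective L) _ (hs _ hg')
    · obtain ⟨g', hg', rfl⟩ := List.mem_map.1 ha
      exact hm _ ((blocks_cons L).injective a) _ (ih _ hg')

/-- `H` and well-formed `CNOT` gates, which are their own inverses. -/
def Gate.SelfInv {Q : Type} : Gate Q → Prop
  | .H _ => True
  | .cnot c t => c ≠ t
  | _ => False

theorem Gate.SelfInv.valid {Q : Type} {g : Gate Q} (h : g.SelfInv) : g.Valid := by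
  cases g <;> first | exact h | trivial

theorem Gate.SelfInv.map {Q Q' : Type} {f : Q → Q'} (hf : f.Injective) {g : Gate Q}
    (h : g.SelfInv) : (g.map f).SelfInv := by
  cases g <;> first | exact h | exact fun hh => h (hf hh)

theorem Gate.SelfInv.conjTranspose {R : Type} [Fintype R] [DecidableEq R] {g : Gate R}
    (h : g.SelfInv) : g.opᴴ = g.op := by
  cases g with
  | H q => exact H_conjTranspose q
  | cnot c t => exact cnot_conjTranspose h
  | _ => exact h.elim

theorem opOf_reverse {R : Type} [Fintype R] [DecidableEq R] {l : List (Gate R)}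
    (h : ∀ g ∈ l, g.SelfInv) : opOf l.reverse = (opOf l)ᴴ := by
  induction l with
  | nil => simp [opOf]
  | cons g l ih =>
    rw [List.reverse_cons, opOf_append, ih fun g' hg' => h g' (List.mem_cons_of_mem _ hg'), opOf,
      opOf, opOf, one_mul, Matrix.conjTranspose_mul, (h g List.mem_cons_self).conjTranspose]

theorem uEnc_selfInv : ∀ g ∈ uEnc, g.SelfInv := by
  refine encGates_induction (p := fun {Q} (g : Gate Q) => g.SelfInv) ?_
    (fun f hf g hg => hg.map hf)
  simp [steaneEnc, Gate.SelfInv]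

/-! ### Transversal gates on code blocks -/

theorem mem_blkList (q : Blk) : q ∈ blkList :=
  (List.mem_ofFn' _ _).2 ⟨finFunctionFinEquiv q, Equiv.symm_apply_apply _ _⟩

theorem nodup_blkList : blkList.Nodup :=
  List.nodup_ofFn.2 finFunctionFinEquiv.symm.injective

section Ops

variable {R α : Type} [Fintype R] [DecidableEq R]

theorem opOf_map_diagonal {f : α → Gate R} {d : α → (R → ZMod 2) → ℂ}
    (h : ∀ a, (f a).op = Matrix.diagonal (d a)) (l : List α) :
    opOf (l.map f) = Matrix.diagonal fun x => (l.map fun a => d a x).prod := by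
  induction l with
  | nil => simp [opOf]
  | cons a l ih =>
    rw [List.map_cons, opOf, ih, h, Matrix.diagonal_mul_diagonal]
    congr 1
    funext x
    rw [List.map_cons, List.prod_cons, mul_comm]

theorem mul_cnot_apply (N : Op R) (c t : R) (x z : R → ZMod 2) :
    (N * (Gate.cnot c t).op) x z = N x (Function.update z t (z t + z c)) := by
  rw [Matrix.mul_apply, Finset.sum_eq_single (Function.update z t (z t + z c))]
  · simp [Gate.op]
  · intro y _ hy
    simp [Gate.op, hy]
  · simp

theorem H_unit_apply (x y : Unit → ZMod 2) : (Gate.H ()).op x y = had (x ()) (y ()) := by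
  simp only [Gate.op, Matrix.of_apply]
  rw [if_pos fun r hr => absurd (Subsingleton.elim r ()) hr]
  rfl

theorem mul_H_apply (N : Op R) (q : R) (x z : R → ZMod 2) :
    (N * (Gate.H q).op) x z = ∑ b, N x (Function.update z q b) * had b (z q) := by
  have he : Function.Injective (fun _ : Unit => q) := fun _ _ _ => rfl
  have h1 : (Gate.H q).op = lift (fun _ : Unit => q) (Gate.H ()).op :=
    Gate.op_map (g := Gate.H ()) he
  rw [h1, mul_lift_apply he, ← (Equiv.funUnique Unit (ZMod 2)).symm.sum_comp]
  refine Finset.sum_congr rfl fun b _ => ?_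
  have h2 : Function.extend (fun _ : Unit => q) ((Equiv.funUnique Unit (ZMod 2)).symm b) z =
      Function.update z q b := by
    funext r
    rcases eq_or_ne r q with rfl | hr
    · rw [Function.update_self]
      exact he.extend_apply _ _ ()
    · rw [Function.update_of_ne hr, extend_off _ _ fun _ => hr.symm]
  rw [h2, H_unit_apply]
  rfl

end Ops

/-- The encoding isometry of one block: `|b⟩|0⟩ ↦ |Enc(b)⟩`, extended by zero. -/
def encIso : Op Blk := opOf uEnc * zeroProj {q | q ≠ 0}

open Classical in
theorem encIso_apply (x z : Blk → ZMod 2) :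
    encIso x z = if ∀ q, q ≠ 0 → z q = 0 then encAmp 5 (z 0) x else 0 := by
  rw [encIso, zeroProj, Matrix.mul_diagonal]
  have hc : (∀ q ∈ {q : Blk | q ≠ 0}, z q = 0) ↔ ∀ q, q ≠ 0 → z q = 0 := Iff.rfl
  by_cases h : ∀ q, q ≠ 0 → z q = 0
  · rw [if_pos (hc.2 h), if_pos h, mul_one]
    exact encGates_apply 5 x z h
  · rw [if_neg (fun hh => h (hc.1 hh)), if_neg h, mul_zero]

theorem encIso_ne_zero {x z : Blk → ZMod 2} (h : encIso x z ≠ 0) : encAmp 5 (z 0) x ≠ 0 := by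
  classical
  rw [encIso_apply] at h
  split_ifs at h with h1
  · exact h
  · exact absurd rfl h

/-- The transversal `H` is the logical `H` on an encoded qubit. -/
theorem semiconj_H :
    SemiconjBy encIso (Gate.H (0 : Blk)).op (opOf (blkList.map Gate.H)) := by
  classical
  have he : Blocks fun (q : Blk) (_ : Unit) => q := fun p p' h => Prod.ext h rfl
  have h1 : opOf (blkList.map Gate.H) = par (fun (q : Blk) (_ : Unit) => q) fun _ =>
      (Gate.H ()).op := by
    have := opOf_layer he (Gate.H ()) blkList nodup_blkList
    simp only [mem_blkList, if_true] at this
    exact this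
  ext x z
  rw [mul_H_apply, Matrix.mul_apply, h1]
  have h2 : ∀ y, par (fun (q : Blk) (_ : Unit) => q) (fun _ => (Gate.H ()).op) x y =
      ∏ q, had (x q) (y q) := by
    intro y
    rw [par_apply, if_pos fun r hr => absurd rfl (hr r ())]
    exact Finset.prod_congr rfl fun q _ => H_unit_apply _ _
  simp only [h2, encIso_apply]
  have h3 : ∀ b, (∀ q : Blk, q ≠ 0 → Function.update z 0 b q = 0) ↔ ∀ q, q ≠ 0 → z q = 0 :=
    fun b => forall₂_congr fun q hq => by rw [Function.update_of_ne hq]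
  by_cases h : ∀ q, q ≠ 0 → z q = 0
  · simp only [h3, Function.update_self, if_pos h]
    rw [encAmp_hadamard]
    exact Finset.sum_congr rfl fun b _ => mul_comm _ _
  · simp only [h3, if_neg h, zero_mul, mul_zero, Finset.sum_const_zero]

/-- Diagonal operators are intertwined by `J` if their entries agree on the support of `J`. -/
theorem semiconj_diagonal {R : Type} [Fintype R] [DecidableEq R] {J : Op R}
    {d d' : (R → ZMod 2) → ℂ} (h : ∀ x z, J x z ≠ 0 → d x = d' z) :
    SemiconjBy J (Matrix.diagonal d') (Matrix.diagonal d) := by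
  ext x z
  rw [Matrix.mul_diagonal, Matrix.diagonal_mul]
  by_cases h0 : J x z = 0
  · rw [h0, zero_mul, mul_zero]
  · rw [h x z h0, mul_comm]

theorem prod_blkList_ite (c : ℂ) (x : Blk → ZMod 2) :
    (blkList.map fun q => if x q = 1 then c else 1).prod = c ^ ∑ q, (x q).val := by
  rw [← Finset.prod_pow_eq_pow_sum, ← List.prod_toFinset _ nodup_blkList]
  refine Finset.prod_congr (by ext q; simp [mem_blkList]) fun q _ => ?_
  rcases zmod_two_eq (x q) with h | h <;> rw [h]
  · simp
  · simp [ZMod.val_one]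

theorem pow_eq_of_modEq {c : ℂ} (h : c ^ 4 = 1) {m n : ℕ} (hmn : m ≡ n [MOD 4]) :
    c ^ m = c ^ n := by
  rw [pow_eq_pow_mod m h, pow_eq_pow_mod n h, hmn]

theorem weight_blk {b : ZMod 2} {x : Blk → ZMod 2} (h : encAmp 5 b x ≠ 0) :
    ∑ q, (x q).val ≡ 3 * b.val [MOD 4] :=
  (encAmp_weight h).trans (Nat.ModEq.mul_right _ (by decide))

/-- The transversal `P†` is the logical `P`, since words in the support of `|b⟩` have weight `3 b`
modulo `4` and `(-i)^3 = i`. -/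
theorem semiconj_P :
    SemiconjBy encIso (Gate.P (0 : Blk)).op (opOf (blkList.map Gate.Pdg)) := by
  rw [opOf_map_diagonal (d := fun q x => if x q = 1 then -Complex.I else 1) (fun q => rfl)]
  refine semiconj_diagonal fun x z h => ?_
  rw [prod_blkList_ite, pow_eq_of_modEq (by rw [neg_pow, Complex.I_pow_four]; norm_num)
    (weight_blk (encIso_ne_zero h))]
  rcases zmod_two_eq (z 0) with h0 | h0 <;> rw [h0]
  · simp
  · simp only [ZMod.val_one, mul_one, if_true]
    rw [neg_pow, Complex.I_pow_three]
    ring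

/-- The encoding isometry of two blocks. -/
def encIso₂ : Op (Blk ⊕ Blk) := lift Sum.inl encIso * lift Sum.inr encIso

theorem encIso₂_apply (x z : Blk ⊕ Blk → ZMod 2) :
    encIso₂ x z = encIso (x ∘ Sum.inl) (z ∘ Sum.inl) * encIso (x ∘ Sum.inr) (z ∘ Sum.inr) := by
  rw [encIso₂, lift_mul_lift_apply Sum.inl_injective (fun _ _ => Sum.inl_ne_inr), if_pos]
  rintro (r | r) h1 h2
  · exact absurd rfl (h1 r)
  · exact absurd rfl (h2 r)

theorem opOf_cnots_mulVec {A B : Type} [Fintype A] [DecidableEq A] [Fintype B] [DecidableEq B]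
    (f : B → A) {l : List B} (hl : l.Nodup) (v : (A ⊕ B → ZMod 2) → ℂ) (x : A ⊕ B → ZMod 2) :
    (opOf (l.map fun q => Gate.cnot (Sum.inl (f q)) (Sum.inr q)) *ᵥ v) x =
      v (Sum.elim (fun q => x (Sum.inl q))
        fun q => x (Sum.inr q) + if q ∈ l then x (Sum.inl (f q)) else 0) := by
  induction l generalizing v with
  | nil =>
    simp only [List.map_nil, opOf, Matrix.one_mulVec, List.not_mem_nil, if_false, add_zero]
    congr 1
    funext r
    cases r <;> rfl
  | cons q l ih =>
    rw [List.nodup_cons] at hl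
    rw [List.map_cons, opOf, ← Matrix.mulVec_mulVec, ih hl.2, cnot_mulVec_apply (by simp)]
    congr 1
    funext r
    rcases r with r | r
    · simp
    · rcases eq_or_ne r q with rfl | hr
      · simp [hl.1]
      · rw [Function.update_of_ne (by simpa using hr)]
        simp [hr]

/-- The transversal `CNOT` is the logical `CNOT`. -/
theorem semiconj_cnot : SemiconjBy encIso₂ (Gate.cnot (Sum.inl (0 : Blk)) (Sum.inr (0 : Blk))).op
    (opOf (blkList.map fun q => Gate.cnot (Sum.inl q) (Sum.inr q))) := by
  classical
  ext x z
  rw [mul_cnot_apply]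
  change _ = (opOf (blkList.map fun q => Gate.cnot (Sum.inl q) (Sum.inr q)) *ᵥ
    fun y => encIso₂ y z) x
  rw [opOf_cnots_mulVec (fun q => q) nodup_blkList, encIso₂_apply, encIso₂_apply]
  simp only [mem_blkList, if_true]
  have h1 : Function.update z (Sum.inr 0) (z (Sum.inr 0) + z (Sum.inl 0)) ∘ Sum.inl =
      z ∘ Sum.inl := by
    funext q; simp
  have h2 : Function.update z (Sum.inr 0) (z (Sum.inr 0) + z (Sum.inl 0)) ∘ Sum.inr =
      Function.update (z ∘ Sum.inr) 0 (z (Sum.inr 0) + z (Sum.inl 0)) :=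
    Function.update_comp_eq_of_injective _ Sum.inr_injective _ _
  rw [h1, h2]
  have h3 : (Sum.elim (fun q => x (Sum.inl q)) fun q => x (Sum.inr q) + x (Sum.inl q)) ∘ Sum.inl =
      x ∘ Sum.inl := rfl
  have h4 : (Sum.elim (fun q => x (Sum.inl q)) fun q => x (Sum.inr q) + x (Sum.inl q)) ∘ Sum.inr =
      x ∘ Sum.inl + x ∘ Sum.inr := by
    funext q; exact add_comm _ _
  rw [h3, h4]
  simp only [encIso_apply]
  have h5 : (∀ q : Blk, q ≠ 0 → Function.update (z ∘ Sum.inr) 0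
      (z (Sum.inr 0) + z (Sum.inl 0)) q = 0) ↔ ∀ q, q ≠ 0 → (z ∘ Sum.inr) q = 0 :=
    forall₂_congr fun q hq => by rw [Function.update_of_ne hq]
  simp only [h5, Function.update_self]
  split_ifs
  · rw [encAmp_mul_add, add_comm (z (Sum.inr 0))]
    rfl
  all_goals simp

theorem encIso₂_ne_zero {x z : Blk ⊕ Blk → ZMod 2} (h : encIso₂ x z ≠ 0) :
    encAmp 5 (z (Sum.inl 0)) (x ∘ Sum.inl) ≠ 0 ∧ encAmp 5 (z (Sum.inr 0)) (x ∘ Sum.inr) ≠ 0 := by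
  rw [encIso₂_apply] at h
  have h1 := encIso_ne_zero (left_ne_zero_of_mul h)
  have h2 := encIso_ne_zero (right_ne_zero_of_mul h)
  exact ⟨h1, h2⟩

/-- The transversal `CZ` is the logical `CZ`. -/
theorem semiconj_cz : SemiconjBy encIso₂ (Gate.cz (Sum.inl (0 : Blk)) (Sum.inr (0 : Blk))).op
    (opOf (blkList.map fun q => Gate.cz (Sum.inl q) (Sum.inr q))) := by
  rw [opOf_map_diagonal (d := fun q x => if x (Sum.inl q) = 1 ∧ x (Sum.inr q) = 1 then -1 else 1)
    (fun q => rfl)]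
  refine semiconj_diagonal fun x z h => ?_
  obtain ⟨h1, h2⟩ := encIso₂_ne_zero h
  have h3 := encAmp_inner h1 h2
  have hs : ∀ a b : ZMod 2, (if a = 1 ∧ b = 1 then (-1 : ℂ) else 1) =
      if a * b = 1 then -1 else 1 := by
    intro a b
    refine if_congr ?_ rfl rfl
    revert a b
    decide
  have hval : ∀ s : Finset Blk, ∀ f : Blk → ZMod 2,
      (-1 : ℂ) ^ ∑ q ∈ s, (f q).val = if ∑ q ∈ s, f q = 1 then -1 else 1 := by
    intro s f
    rw [← Nat.cast_id (∑ q ∈ s, (f q).val), Nat.cast_id]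
    rw [neg_one_pow_eq_pow_mod_two]
    have : (∑ q ∈ s, (f q).val) % 2 = (∑ q ∈ s, f q).val := by
      rw [← ZMod.val_natCast, Nat.cast_sum]
      simp only [ZMod.natCast_val, ZMod.cast_id', id]
    rw [this]
    rcases zmod_two_eq (∑ q ∈ s, f q) with h | h <;> rw [h] <;> simp [ZMod.val_one]
  simp only [hs]
  rw [prod_blkList_ite (-1) (fun q => x (Sum.inl q) * x (Sum.inr q)), hval, ← h3]
  rfl

/-- A controlled `P` for every pair of physical qubits is the logical controlled `P`: the phase is
`i` to the product of the weights, which is `9 b b' = b b'` modulo `4`. -/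
theorem semiconj_cp : SemiconjBy encIso₂ (Gate.cp (Sum.inr (0 : Blk)) (Sum.inl (0 : Blk))).op
    (opOf (blkList.flatMap fun q => blkList.map fun q' =>
      Gate.cp (Sum.inr q) (Sum.inl q'))) := by
  have h0 : ∀ q : Blk, opOf (blkList.map fun q' => Gate.cp (Sum.inr q) (Sum.inl q')) =
      Matrix.diagonal fun x : Blk ⊕ Blk → ZMod 2 =>
        if x (Sum.inr q) = 1 then Complex.I ^ ∑ q', (x (Sum.inl q')).val else 1 := by
    intro q
    rw [opOf_map_diagonal
      (d := fun q' x => if x (Sum.inr q) = 1 ∧ x (Sum.inl q') = 1 then Complex.I else 1)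
      (fun q => rfl)]
    refine congrArg Matrix.diagonal (funext fun x => ?_)
    split_ifs with h
    · simp only [h, true_and]
      exact prod_blkList_ite Complex.I fun q' => x (Sum.inl q')
    · simp [h]
  have h1 : ∀ l : List Blk, opOf (l.flatMap fun q => blkList.map fun q' =>
      Gate.cp (Sum.inr q) (Sum.inl q')) = Matrix.diagonal fun x : Blk ⊕ Blk → ZMod 2 =>
        (l.map fun q => if x (Sum.inr q) = 1 then
          Complex.I ^ ∑ q', (x (Sum.inl q')).val else 1).prod := by
    intro l
    induction l with
    | nil => simp [opOf]
    | cons q l ih =>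
      rw [List.flatMap_cons, opOf_append, ih, h0, Matrix.diagonal_mul_diagonal]
      congr 1
      funext x
      rw [List.map_cons, List.prod_cons, mul_comm]
  rw [h1]
  refine semiconj_diagonal fun x z h => ?_
  obtain ⟨h2, h3⟩ := encIso₂_ne_zero h
  have h4 := pow_eq_of_modEq Complex.I_pow_four ((weight_blk h2).mul (weight_blk h3))
  simp only [Function.comp_apply] at h4
  rw [prod_blkList_ite _ (fun q => x (Sum.inr q)), ← pow_mul, h4]
  clear h4
  rcases zmod_two_eq (z (Sum.inl 0)) with h4 | h4 <;>
    rcases zmod_two_eq (z (Sum.inr 0)) with h5 | h5 <;> rw [h4, h5] <;>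
    simp [ZMod.val_one]

/-- The logical operation performed by the `T` gadget, from the data block to the magic block. -/
theorem semiconj_gadget : SemiconjBy encIso₂
    ((Gate.cp (Sum.inr (0 : Blk)) (Sum.inl (0 : Blk))).op *
      (Gate.cnot (Sum.inl (0 : Blk)) (Sum.inr (0 : Blk))).op)
    (opOf ((blkList.map fun q => Gate.cnot (Sum.inl q) (Sum.inr q)) ++
      blkList.flatMap fun q => blkList.map fun q' => Gate.cp (Sum.inr q) (Sum.inl q'))) := by
  rw [opOf_append]
  exact semiconj_cp.mul_right semiconj_cnot

/-! ### Encoded registers -/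

section Register

variable {ι R : Type} [Fintype ι] [DecidableEq ι] [Fintype R] [DecidableEq R]

theorem mem_loc_univ (M : Op R) : M ∈ loc (Set.univ : Set R) := by
  rw [← lift_id M]
  exact lift_mem_loc (fun _ => Set.mem_univ _) M

theorem one_mem_loc (S : Set R) : (1 : Op R) ∈ loc S := (loc S).one_mem

/-- The encoding unitary on the blocks in `s`. -/
def encOn (e : ι → Blk → R) (s : Finset ι) : Op R :=
  par e fun i => if i ∈ s then opOf uEnc else 1

/-- The encoding isometry on the blocks in `s`. -/
def isoOn (e : ι → Blk → R) (s : Finset ι) : Op R :=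
  par e fun i => if i ∈ s then encIso else 1

/-- The qubits, other than the first ones, of the blocks in `s`. -/
def tailQ (e : ι → Blk → R) (s : Finset ι) : Set R := {r | ∃ i ∈ s, ∃ q, q ≠ 0 ∧ e i q = r}

/-- All qubits of the blocks in `s`. -/
def blockQ (e : ι → Blk → R) (s : Finset ι) : Set R := {r | ∃ i ∈ s, ∃ q, e i q = r}

theorem tailQ_subset (e : ι → Blk → R) (s : Finset ι) : tailQ e s ⊆ blockQ e s := by
  rintro r ⟨i, hi, q, _, h⟩
  exact ⟨i, hi, q, h⟩

theorem tailQ_union (e : ι → Blk → R) (s t : Finset ι) :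
    tailQ e (s ∪ t) = tailQ e s ∪ tailQ e t := by
  ext r
  simp only [tailQ, Finset.mem_union, Set.mem_union, Set.mem_ofPred_eq, or_and_right, exists_or]

theorem uEnc_unitary : opOf uEnc ∈ unitary (Op Blk) :=
  opOf_mem_unitary fun g hg => (uEnc_selfInv g hg).valid

theorem encOn_mem_unitary {e : ι → Blk → R} (he : Blocks e) (s : Finset ι) :
    encOn e s ∈ unitary (Op R) := by
  refine par_mem_unitary he fun i => ?_
  split_ifs
  · exact uEnc_unitary
  · exact (unitary (Op Blk)).one_mem

theorem encOn_mul_zeroProj {e : ι → Blk → R} (he : Blocks e) (s : Finset ι) :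
    encOn e s * zeroProj (tailQ e s) = isoOn e s := by
  have h : zeroProj (tailQ e s) =
      par e fun i => zeroProj (if i ∈ s then {q : Blk | q ≠ 0} else ∅) := by
    rw [par_zeroProj]
    congr 1
    ext r
    simp only [tailQ, Set.mem_ofPred_eq]
    constructor
    · rintro ⟨i, hi, q, hq, h⟩
      exact ⟨i, q, by rw [if_pos hi]; exact hq, h⟩
    · rintro ⟨i, q, hq, h⟩
      split_ifs at hq with hi
      · exact ⟨i, hi, q, hq, h⟩
      · exact hq.elim
  rw [h, encOn, ← par_mul he, isoOn]
  refine par_congr e fun i => ?_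
  rw [Pi.mul_apply]
  split_ifs
  · rfl
  · rw [zeroProj_empty, one_mul]

theorem encOn_union {e : ι → Blk → R} (he : Blocks e) {s t : Finset ι} (h : Disjoint s t) :
    encOn e (s ∪ t) = encOn e s * encOn e t := by
  rw [encOn, encOn, encOn, ← par_mul he]
  refine par_congr e fun i => ?_
  rw [Pi.mul_apply]
  by_cases h1 : i ∈ s
  · simp [h1, Finset.disjoint_left.1 h h1]
  · simp [h1]

theorem par_ite_mem_loc {e : ι → Blk → R} (he : Blocks e) (s : Finset ι) (M : Op Blk) :
    (par e fun i => if i ∈ s then M else 1) ∈ loc (blockQ e s) := by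
  refine par_mem_loc he (T := fun i => if i ∈ s then Set.univ else ∅) (fun i => ?_) ?_
  · by_cases h : i ∈ s
    · simp only [h, if_true]
      exact mem_loc_univ _
    · simp only [h, if_false]
      exact one_mem_loc _
  · intro i a ha
    split_ifs at ha with hi
    · exact ⟨i, hi, a, rfl⟩
    · exact ha.elim

theorem encOn_mem_loc {e : ι → Blk → R} (he : Blocks e) (s : Finset ι) :
    encOn e s ∈ loc (blockQ e s) := par_ite_mem_loc he s _

theorem isoOn_mem_loc {e : ι → Blk → R} (he : Blocks e) (s : Finset ι) :
    isoOn e s ∈ loc (blockQ e s) := par_ite_mem_loc he s _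

/-- A logical operation on one of the encoded blocks. -/
theorem isoOn_semiconj {e : ι → Blk → R} (he : Blocks e) {s : Finset ι} {i : ι} (hi : i ∈ s)
    {A B : Op Blk} (h : SemiconjBy encIso A B) :
    SemiconjBy (isoOn e s) (lift (e i) A) (lift (e i) B) := by
  rw [SemiconjBy, isoOn, ← par_mulSingle he, ← par_mulSingle he, ← par_mul he, ← par_mul he]
  refine par_congr e fun j => ?_
  rw [Pi.mul_apply, Pi.mul_apply]
  rcases eq_or_ne j i with rfl | hj
  · rw [Pi.mulSingle_eq_same, Pi.mulSingle_eq_same, if_pos hi]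
    exact h
  · rw [Pi.mulSingle_eq_of_ne hj, Pi.mulSingle_eq_of_ne hj, one_mul, mul_one]

theorem elim_injective {e : ι → Blk → R} (he : Blocks e) {i j : ι} (hij : i ≠ j) :
    (Sum.elim (e i) (e j)).Injective :=
  (he.injective i).sumElim (he.injective j) fun a b => he.ne hij a b

/-- A logical operation on two of the encoded blocks. -/
theorem isoOn_semiconj₂ {e : ι → Blk → R} (he : Blocks e) {s : Finset ι} {i j : ι} (hi : i ∈ s)
    (hj : j ∈ s) (hij : i ≠ j) {A B : Op (Blk ⊕ Blk)} (h : SemiconjBy encIso₂ A B) :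
    SemiconjBy (isoOn e s) (lift (Sum.elim (e i) (e j)) A) (lift (Sum.elim (e i) (e j)) B) := by
  have hinj := elim_injective he hij
  have h1 : isoOn e s = lift (Sum.elim (e i) (e j)) encIso₂ * isoOn e ((s.erase i).erase j) := by
    rw [encIso₂, lift_mul hinj, ← lift_comp hinj, ← lift_comp hinj, Sum.elim_comp_inl,
      Sum.elim_comp_inr, ← par_mulSingle he, ← par_mulSingle he, isoOn, isoOn, ← par_mul he,
      ← par_mul he]
    refine par_congr e fun k => ?_
    simp only [Pi.mul_apply, Finset.mem_erase]
    rcases eq_or_ne k i with rfl | hki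
    · simp [hi, hij]
    · rcases eq_or_ne k j with rfl | hkj
      · simp [hj, hki]
      · simp [hki, hkj]
  have h2 : ∀ A : Op (Blk ⊕ Blk),
      Commute (isoOn e ((s.erase i).erase j)) (lift (Sum.elim (e i) (e j)) A) := by
    intro A
    refine loc_commute (T := Set.range (Sum.elim (e i) (e j))) ?_ (isoOn_mem_loc he _)
      (lift_mem_loc (fun a => Set.mem_range_self a) A)
    rw [Set.disjoint_left]
    rintro _ ⟨k, hk, q, rfl⟩ ⟨a | a, ha⟩
    · exact he.ne (Finset.ne_of_mem_erase (Finset.mem_of_mem_erase hk)).symm a q ha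
    · exact he.ne (Finset.ne_of_mem_erase hk).symm a q ha
  rw [h1]
  refine SemiconjBy.mul_left ?_ (h2 A)
  rw [SemiconjBy, ← lift_mul hinj, h.eq, lift_mul hinj]

end Register

/-! ### Magic states -/

/-- The state `T|+⟩` of the qubit `μ` is a catalyst: the logical gadget acts as `T` on the data
qubit `a` and leaves the magic state unchanged. -/
theorem gadget_magic {R : Type} [Fintype R] [DecidableEq R] {a μ : R} (h : a ≠ μ) :
    (Gate.cp μ a).op * (Gate.cnot a μ).op * ((Gate.T μ).op * (Gate.H μ).op * zeroProj {μ}) =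
      (Gate.T a).op * ((Gate.T μ).op * (Gate.H μ).op * zeroProj {μ}) := by
  classical
  refine Matrix.ext_of_mulVec_single fun z => ?_
  generalize (Pi.single z 1 : (R → ZMod 2) → ℂ) = v
  have hM : ∀ y, (((Gate.T μ).op * (Gate.H μ).op * zeroProj {μ}) *ᵥ v) y =
      (if y μ = 1 then Complex.exp (Complex.I * (Real.pi / 4)) else 1) *
        (1 / ((Real.sqrt 2 : ℝ) : ℂ) * v (Function.update y μ 0)) := by
    intro y
    rw [← Matrix.mulVec_mulVec, ← Matrix.mulVec_mulVec]
    have h1 : ∀ w : (R → ZMod 2) → ℂ, ((Gate.T μ).op *ᵥ w) y =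
        (if y μ = 1 then Complex.exp (Complex.I * (Real.pi / 4)) else 1) * w y :=
      fun w => Matrix.mulVec_diagonal _ _ _
    have h2 : ∀ y, (zeroProj {μ} *ᵥ v) y = (if y μ = 0 then 1 else 0) * v y := by
      intro y
      rw [zeroProj, Matrix.mulVec_diagonal]
      simp
    rw [h1, H_mulVec_apply, zmod_two_sum, h2, h2]
    simp
  have hw : Complex.exp (Complex.I * (Real.pi / 4)) * Complex.exp (Complex.I * (Real.pi / 4)) =
      Complex.I := by
    rw [← Complex.exp_add, show Complex.I * ((Real.pi : ℂ) / 4) + Complex.I * (Real.pi / 4) =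
      Real.pi / 2 * Complex.I by ring, Complex.exp_pi_div_two_mul_I]
  funext x
  rw [← Matrix.mulVec_mulVec, ← Matrix.mulVec_mulVec, ← Matrix.mulVec_mulVec (M := (Gate.T a).op)]
  generalize ((Gate.T μ).op * (Gate.H μ).op * zeroProj {μ}) *ᵥ v = u at hM ⊢
  have h1 : ((Gate.cp μ a).op *ᵥ ((Gate.cnot a μ).op *ᵥ u)) x =
      (if x μ = 1 ∧ x a = 1 then Complex.I else 1) * ((Gate.cnot a μ).op *ᵥ u) x :=
    Matrix.mulVec_diagonal _ _ _
  have h2 : ((Gate.T a).op *ᵥ u) x =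
      (if x a = 1 then Complex.exp (Complex.I * (Real.pi / 4)) else 1) * u x :=
    Matrix.mulVec_diagonal _ _ _
  rw [h1, h2, cnot_mulVec_apply h, hM, hM, Function.update_self, Function.update_idem]
  generalize 1 / ((Real.sqrt 2 : ℝ) : ℂ) * v (Function.update x μ 0) = c
  generalize Complex.exp (Complex.I * (Real.pi / 4)) = ω at hw ⊢
  have key : (1 : ZMod 2) + 1 = 0 := by decide
  -- Besides trivial cases, the identity to check is `i ω⁰ = ω ω¹`, where `ω² = i`.
  rcases zmod_two_eq (x a) with h4 | h4 <;> rcases zmod_two_eq (x μ) with h5 | h5 <;>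
    rw [h4, h5] <;>
    simp only [key, zero_add, add_zero, zero_ne_one, and_false, false_and, and_self, if_true,
      if_false]
  all_goals first | ring1 | linear_combination (-c) * hw

/-! ### Norms and energies -/

section Energy

variable {ι κ : Type} [Fintype ι] [DecidableEq ι] [Fintype κ] [DecidableEq κ]

/-- The squared Euclidean norm. -/
def nsq (v : ι → ℂ) : ℝ := ∑ x, ‖v x‖ ^ 2

theorem star_dotProduct_self (v : ι → ℂ) : star v ⬝ᵥ v = (nsq v : ℂ) := by
  simp only [nsq, dotProduct, Pi.star_apply, Complex.star_def, Complex.conj_mul']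
  push_cast
  rfl

theorem isState_iff {v : ι → ℂ} : IsState v ↔ nsq v = 1 := by
  rw [IsState, star_dotProduct_self]
  exact_mod_cast Iff.rfl

theorem nsq_nonneg (v : ι → ℂ) : 0 ≤ nsq v := Finset.sum_nonneg fun _ _ => by positivity

theorem nsq_smul (c : ℂ) (v : ι → ℂ) : nsq (c • v) = ‖c‖ ^ 2 * nsq v := by
  simp only [nsq, Pi.smul_apply, smul_eq_mul, norm_mul, mul_pow, Finset.mul_sum]

theorem nsq_mulVec_of_unitary {U : Matrix ι ι ℂ} (h : U ∈ unitary (Matrix ι ι ℂ)) (v : ι → ℂ) :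
    nsq (U *ᵥ v) = nsq v := by
  have h1 : star (U *ᵥ v) ⬝ᵥ (U *ᵥ v) = star v ⬝ᵥ v := by
    rw [Matrix.star_mulVec, Matrix.dotProduct_mulVec, Matrix.vecMul_vecMul,
      ← Matrix.star_eq_conjTranspose, (Unitary.mem_iff.1 h).1, Matrix.vecMul_one]
  rw [star_dotProduct_self, star_dotProduct_self] at h1
  exact_mod_cast h1

/-- The Euclidean norm. -/
def nrm (v : ι → ℂ) : ℝ := Real.sqrt (nsq v)

theorem nrm_eq (v : ι → ℂ) : nrm v = ‖WithLp.toLp 2 v‖ := by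
  rw [EuclideanSpace.norm_eq]; rfl

theorem nrm_nonneg (v : ι → ℂ) : 0 ≤ nrm v := Real.sqrt_nonneg _

theorem nrm_sq (v : ι → ℂ) : nrm v ^ 2 = nsq v := Real.sq_sqrt (nsq_nonneg v)

theorem nrm_add_le (v w : ι → ℂ) : nrm (v + w) ≤ nrm v + nrm w := by
  simp only [nrm_eq, WithLp.toLp_add]
  exact norm_add_le _ _

theorem nrm_mulVec_of_unitary {U : Matrix ι ι ℂ} (h : U ∈ unitary (Matrix ι ι ℂ)) (v : ι → ℂ) :
    nrm (U *ᵥ v) = nrm v := by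
  rw [nrm, nrm, nsq_mulVec_of_unitary h]

theorem nrm_le_of_nsq_le {v : ι → ℂ} {s : ℝ} (hs : 0 ≤ s) (h : nsq v ≤ s ^ 2) : nrm v ≤ s := by
  rw [nrm, ← Real.sqrt_sq hs]
  exact Real.sqrt_le_sqrt h

theorem energy_add (A B : Matrix ι ι ℂ) (Φ : ι → ℂ) :
    energy (A + B) Φ = energy A Φ + energy B Φ := by
  simp only [energy, Matrix.add_mulVec, dotProduct_add, Complex.add_re]

theorem energy_zero (Φ : ι → ℂ) : energy 0 Φ = 0 := by
  simp [energy]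

theorem energy_sum {α : Type} (s : Finset α) (A : α → Matrix ι ι ℂ) (Φ : ι → ℂ) :
    energy (∑ i ∈ s, A i) Φ = ∑ i ∈ s, energy (A i) Φ := by
  classical
  induction s using Finset.induction_on with
  | empty => simp [energy_zero]
  | insert a s ha ih => rw [Finset.sum_insert ha, Finset.sum_insert ha, energy_add, ih]

theorem energy_half_smul_conjTranspose_mul (B : Matrix ι ι ℂ) (Φ : ι → ℂ) :
    energy ((1 / 2 : ℂ) • (Bᴴ * B)) Φ = 1 / 2 * nsq (B *ᵥ Φ) := by
  rw [energy, Matrix.smul_mulVec, dotProduct_smul, ← Matrix.mulVec_mulVec,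
    Matrix.dotProduct_mulVec, ← Matrix.star_mulVec, star_dotProduct_self,
    show (1 / 2 : ℂ) = ((1 / 2 : ℝ) : ℂ) by norm_num, smul_eq_mul, ← Complex.ofReal_mul,
    Complex.ofReal_re]

theorem energy_diagonal_kronecker (a : ι → Prop) [DecidablePred a] (p : κ → Prop)
    [DecidablePred p] (Φ : ι × κ → ℂ) :
    energy ((Matrix.diagonal fun c => if a c then (1 : ℂ) else 0) ⊗ₖ
      (Matrix.diagonal fun x => if p x then (1 : ℂ) else 0)) Φ =
      ∑ c, ∑ x, if a c ∧ p x then ‖Φ (c, x)‖ ^ 2 else 0 := by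
  rw [Matrix.diagonal_kronecker_diagonal, energy, dotProduct, Complex.re_sum,
    Fintype.sum_prod_type]
  refine Finset.sum_congr rfl fun c _ => Finset.sum_congr rfl fun x _ => ?_
  rw [Matrix.mulVec_diagonal, Pi.star_apply]
  by_cases h1 : a c <;> by_cases h2 : p x <;> simp only [h1, h2, if_true, if_false, and_self,
    and_false, false_and, mul_one, mul_zero, zero_mul, Complex.zero_re, one_mul]
  rw [Complex.star_def, Complex.conj_mul', ← Complex.ofReal_pow, Complex.ofReal_re]

theorem one_sub_diagonal (p : κ → Prop) [DecidablePred p] :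
    (1 - Matrix.diagonal fun x => if p x then (1 : ℂ) else 0) =
      Matrix.diagonal fun x => if ¬ p x then (1 : ℂ) else 0 := by
  rw [← Matrix.diagonal_one, Matrix.diagonal_sub]
  congr 1
  funext x
  by_cases h : p x <;> simp [h]

theorem one_eq_diagonal : (1 : Matrix κ κ ℂ) =
    Matrix.diagonal fun _ => if True then (1 : ℂ) else 0 := by
  simp

end Energy

/-! ### The clock -/

section Clock

variable {T : ℕ}

/-- The neighbours of the clock qubit `t` are in the states `1` (before) and `0` (after). -/
def Active (t : Fin T) (c : Fin T → ZMod 2) : Prop :=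
  (∀ s : Fin T, s.val + 1 = t.val → c s = 1) ∧ (∀ s : Fin T, s.val = t.val + 1 → c s = 0)

theorem active_update {t : Fin T} {c : Fin T → ZMod 2} (b : ZMod 2) :
    Active t (Function.update c t b) ↔ Active t c := by
  refine and_congr (forall₂_congr fun s hs => ?_) (forall₂_congr fun s hs => ?_) <;>
  · rw [Function.update_of_ne]
    rintro rfl
    omega

open Classical in
theorem clockStep_apply (t : Fin T) (a b : ZMod 2) (x y : Fin T → ZMod 2) :
    clockStep t a b x y =
      if y = Function.update x t b then (if x t = a ∧ Active t x then 1 else 0) else 0 := by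
  rw [clockStep, Matrix.of_apply, ← ite_and]
  refine if_congr ?_ rfl rfl
  constructor
  · rintro ⟨h1, h2, h3, h4, h5⟩
    refine ⟨funext fun s => ?_, h1, h4, h5⟩
    rcases eq_or_ne s t with rfl | hs
    · rw [Function.update_self, h2]
    · rw [Function.update_of_ne hs, h3 s hs]
  · rintro ⟨rfl, h1, h4, h5⟩
    exact ⟨h1, Function.update_self .., fun s hs => (Function.update_of_ne hs _ _).symm, h4, h5⟩

theorem clockStep_mul (t : Fin T) (a b d : ZMod 2) :
    clockStep t a b * clockStep t b d = clockStep t a d := by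
  classical
  ext x z
  rw [Matrix.mul_apply]
  simp only [clockStep_apply, ite_mul, zero_mul, one_mul]
  rw [Finset.sum_ite_eq' Finset.univ (Function.update x t b), if_pos (Finset.mem_univ _)]
  simp only [Function.update_self, Function.update_idem, active_update, true_and]
  split_ifs <;> first | rfl | tauto

theorem clockStep_conjTranspose (t : Fin T) (a b : ZMod 2) :
    (clockStep t a b)ᴴ = clockStep t b a := by
  ext x y
  simp only [Matrix.conjTranspose_apply, clockStep, Matrix.of_apply]
  rw [apply_ite star, star_one, star_zero]
  refine if_congr ?_ rfl rfl
  constructor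
  · rintro ⟨h1, h2, h3, h4, h5⟩
    refine ⟨h2, h1, fun s hs => (h3 s hs).symm, fun s hs => ?_, fun s hs => ?_⟩
    · rw [← h3 s (by rintro rfl; omega), h4 s hs]
    · rw [← h3 s (by rintro rfl; omega), h5 s hs]
  · rintro ⟨h1, h2, h3, h4, h5⟩
    refine ⟨h2, h1, fun s hs => (h3 s hs).symm, fun s hs => ?_, fun s hs => ?_⟩
    · rw [← h3 s (by rintro rfl; omega), h4 s hs]
    · rw [← h3 s (by rintro rfl; omega), h5 s hs]

theorem unary_active (t : Fin T) : Active t (unary T t) := by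
  refine ⟨fun s hs => if_pos (by omega), fun s hs => if_neg (by omega)⟩

theorem unary_self (t : Fin T) : unary T t t = 0 := if_neg (by omega)

theorem update_unary (t : Fin T) : Function.update (unary T t) t 1 = unary T (t + 1) := by
  funext s
  rcases eq_or_ne s t with rfl | hs
  · rw [Function.update_self, unary, if_pos (by omega)]
  · rw [Function.update_of_ne hs, unary, unary]
    refine if_congr ?_ rfl rfl
    have : s.val ≠ t.val := fun h => hs (Fin.ext h)
    omega

/-- The clock states `1^t 0^(T-t)` are distinct for `t ≤ T`. -/
theorem unary_injOn : Set.InjOn (unary T) (Finset.range (T + 1)) := by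
  intro a ha b hb h
  simp only [Finset.coe_range, Set.mem_Iio] at ha hb
  have key : ∀ a b, b < T + 1 → unary T a = unary T b → b ≤ a := by
    intro a b hb h
    by_contra! hlt
    have := congrFun h ⟨a, by omega⟩
    simp only [unary, lt_irrefl, if_false] at this
    rw [if_pos hlt] at this
    exact zero_ne_one this
  exact le_antisymm (key b a ha h.symm) (key a b hb h)

/-- A clock state without the pattern `01` on consecutive qubits is unary. -/
theorem exists_eq_unary {c : Fin T → ZMod 2}
    (h : ∀ s t : Fin T, s.val + 1 = t.val → ¬ (c s = 0 ∧ c t = 1)) :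
    ∃ t ∈ Finset.range (T + 1), unary T t = c := by
  have h0 : ∀ d : ℕ, ∀ s t : Fin T, s.val + d = t.val → c s = 0 → c t = 0 := by
    intro d
    induction d with
    | zero =>
      intro s t hst hs
      rwa [← Fin.ext (a := s) (b := t) hst]
    | succ d ih =>
      intro s t hst hs
      have h1 := ih s ⟨s.val + d, by omega⟩ rfl hs
      rcases zmod_two_eq (c t) with h2 | h2
      · exact h2
      · exact absurd ⟨h1, h2⟩ (h _ _ (by simp only; omega))
  by_cases hz : ∃ t : ℕ, ∃ ht : t < T, c ⟨t, ht⟩ = 0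
  · classical
    obtain ⟨ht, h1⟩ := Nat.find_spec hz
    refine ⟨Nat.find hz, by simp only [Finset.mem_range]; omega, funext fun s => ?_⟩
    rw [unary]
    split_ifs with hs
    · have := Nat.find_min hz hs
      rcases zmod_two_eq (c s) with h2 | h2
      · exact absurd ⟨s.2, h2⟩ this
      · exact h2.symm
    · exact (h0 (s.val - Nat.find hz) ⟨_, ht⟩ s (by simp only; omega) h1).symm
  · push Not at hz
    refine ⟨T, by simp, funext fun s => ?_⟩
    rw [unary, if_pos s.2]
    exact ((zmod_two_eq (c s)).resolve_left (hz s.val s.2)).symm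

/-- The unary clock state before the step `t` is the only unary state on which the step is active
and the clock qubit `t` is zero. -/
theorem eq_of_active_unary {t : Fin T} {c : Fin T → ZMod 2} (hc : Active t c) {s : ℕ}
    (h : c = unary T s) (h0 : c t = 0) : s = t.val := by
  subst h
  have h1 : ¬ t.val < s := by
    intro h
    rw [unary, if_pos h] at h0
    exact one_ne_zero h0
  by_contra hne
  have h2 := hc.1 ⟨t.val - 1, by omega⟩ (by simp only; omega)
  rw [unary, if_neg (by simp only; omega)] at h2
  exact zero_ne_one h2

end Clock

/-! ### History Hamiltonians -/

section History

variable {Q : Type} [Fintype Q] [DecidableEq Q]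

theorem clockStep_kronecker_mulVec {T : ℕ} (t : Fin T) (a b : ZMod 2) (M : Op Q)
    (Φ : HIdx T Q → ℂ) (c : Fin T → ZMod 2) (x : Q → ZMod 2) (hc : Active t c) (ha : c t = a) :
    ((clockStep t a b ⊗ₖ M) *ᵥ Φ) (c, x) =
      (M *ᵥ fun y => Φ (Function.update c t b, y)) x := by
  classical
  simp only [Matrix.mulVec, dotProduct, Fintype.sum_prod_type, Matrix.kronecker_apply,
    clockStep_apply, ha, hc, and_self, if_true, ite_mul, one_mul, zero_mul]
  rw [Finset.sum_eq_single (Function.update c t b)]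
  · simp
  · intro y _ hy
    simp [hy]
  · simp

theorem clockStep_kronecker_mulVec_eq_zero {T : ℕ} (t : Fin T) (a b : ZMod 2) (M : Op Q)
    (Φ : HIdx T Q → ℂ) (c : Fin T → ZMod 2) (x : Q → ZMod 2) (hc : ¬ (c t = a ∧ Active t c)) :
    ((clockStep t a b ⊗ₖ M) *ᵥ Φ) (c, x) = 0 := by
  classical
  simp only [Matrix.mulVec, dotProduct, Fintype.sum_prod_type, Matrix.kronecker_apply,
    clockStep_apply, hc, if_false, ite_self, zero_mul, Finset.sum_const_zero]

/-- The defect operator of a propagation term: it compares the state after the step `t` with the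
result of applying `V` to the state before. -/
def stepDefect {T : ℕ} (t : Fin T) (V : Op Q) : Matrix (HIdx T Q) (HIdx T Q) ℂ :=
  clockStep t 0 1 ⊗ₖ (1 : Op Q) - clockStep t 0 0 ⊗ₖ V

theorem stepDefect_mulVec {T : ℕ} (t : Fin T) (V : Op Q) (Φ : HIdx T Q → ℂ)
    {c : Fin T → ZMod 2} (hc : c t = 0 ∧ Active t c) (x : Q → ZMod 2) :
    (stepDefect t V *ᵥ Φ) (c, x) =
      Φ (Function.update c t 1, x) - (V *ᵥ fun y => Φ (c, y)) x := by
  rw [stepDefect, Matrix.sub_mulVec, Pi.sub_apply,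
    clockStep_kronecker_mulVec _ _ _ _ _ _ _ hc.2 hc.1,
    clockStep_kronecker_mulVec _ _ _ _ _ _ _ hc.2 hc.1, Matrix.one_mulVec]
  have h0 : Function.update c t 0 = c := by
    rw [← hc.1, Function.update_eq_self]
  rw [h0]

theorem stepDefect_mulVec_eq_zero {T : ℕ} (t : Fin T) (V : Op Q) (Φ : HIdx T Q → ℂ)
    {c : Fin T → ZMod 2} (hc : ¬ (c t = 0 ∧ Active t c)) (x : Q → ZMod 2) :
    (stepDefect t V *ᵥ Φ) (c, x) = 0 := by
  rw [stepDefect, Matrix.sub_mulVec, Pi.sub_apply,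
    clockStep_kronecker_mulVec_eq_zero _ _ _ _ _ _ _ hc,
    clockStep_kronecker_mulVec_eq_zero _ _ _ _ _ _ _ hc, sub_zero]

theorem stepDefect_conjTranspose_mul {T : ℕ} (t : Fin T) {V : Op Q} (hV : V ∈ unitary (Op Q)) :
    (stepDefect t V)ᴴ * stepDefect t V =
      clockStep t 0 0 ⊗ₖ (1 : Op Q) + clockStep t 1 1 ⊗ₖ (1 : Op Q)
        - clockStep t 1 0 ⊗ₖ V - clockStep t 0 1 ⊗ₖ Vᴴ := by
  have h1 : Vᴴ * V = 1 := (Unitary.mem_iff.1 hV).1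
  rw [stepDefect, Matrix.conjTranspose_sub, Matrix.conjTranspose_kronecker,
    Matrix.conjTranspose_kronecker, clockStep_conjTranspose, clockStep_conjTranspose,
    Matrix.conjTranspose_one, sub_mul, mul_sub, mul_sub, ← Matrix.mul_kronecker_mul,
    ← Matrix.mul_kronecker_mul, ← Matrix.mul_kronecker_mul, ← Matrix.mul_kronecker_mul,
    clockStep_mul, clockStep_mul, clockStep_mul, clockStep_mul, h1, one_mul, one_mul, mul_one]
  abel

/-- The propagation Hamiltonian is a sum of squares of defect operators. -/
theorem hProp_eq {U : List (Op Q)} (hU : ∀ V ∈ U, V ∈ unitary (Op Q)) :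
    hProp U = ∑ t : Fin U.length,
      (1 / 2 : ℂ) • ((stepDefect t (U.get t))ᴴ * stepDefect t (U.get t)) := by
  rw [hProp]
  refine Finset.sum_congr rfl fun t _ => ?_
  rw [stepDefect_conjTranspose_mul t (hU _ (List.get_mem U t))]

theorem energy_hProp {U : List (Op Q)} (hU : ∀ V ∈ U, V ∈ unitary (Op Q))
    (Φ : HIdx U.length Q → ℂ) :
    energy (hProp U) Φ =
      ∑ t : Fin U.length, 1 / 2 * nsq (stepDefect t (U.get t) *ᵥ Φ) := by
  rw [hProp_eq hU, energy_sum]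
  exact Finset.sum_congr rfl fun t _ => energy_half_smul_conjTranspose_mul _ _

/-- The output term that penalizes, at the last time step, the outcomes that are not accepted. -/
def outTerm (T : ℕ) (acc : (Q → ZMod 2) → Prop) [DecidablePred acc] :
    Matrix (HIdx T Q) (HIdx T Q) ℂ :=
  clockLast T ⊗ₖ (1 - Matrix.diagonal fun x => if acc x then (1 : ℂ) else 0)

theorem energy_outTerm (T : ℕ) (acc : (Q → ZMod 2) → Prop) [DecidablePred acc]
    (Φ : HIdx T Q → ℂ) :
    energy (outTerm T acc) Φ = ∑ c, ∑ x,
      if (∀ t : Fin T, t.val + 1 = T → c t = 1) ∧ ¬ acc x then ‖Φ (c, x)‖ ^ 2 else 0 := by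
  rw [outTerm, one_sub_diagonal, clockLast, energy_diagonal_kronecker]

theorem energy_hIn (T : ℕ) {B : ℕ} (part : Q → Option (Fin B)) (Φ : HIdx T Q → ℂ) :
    energy (hIn T part) Φ = ∑ i : Fin B, ∑ c, ∑ x,
      if (∀ t : Fin T, t.val = 0 → c t = 0) ∧ ¬ (∀ q, part q = some i → x q = 0) then
        ‖Φ (c, x)‖ ^ 2 else 0 := by
  rw [hIn, energy_sum]
  refine Finset.sum_congr rfl fun i _ => ?_
  rw [one_sub_diagonal, clockFirst, energy_diagonal_kronecker]

theorem energy_hStab (T : ℕ) (Φ : HIdx T Q → ℂ) :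
    energy (hStab T Q) Φ = ∑ s : Fin T, ∑ t : Fin T, if s.val + 1 = t.val then
      ∑ c : Fin T → ZMod 2, ∑ x : Q → ZMod 2,
        (if (c s = 0 ∧ c t = 1) ∧ True then ‖Φ (c, x)‖ ^ 2 else 0) else 0 := by
  rw [hStab, energy_sum]
  refine Finset.sum_congr rfl fun s _ => ?_
  rw [energy_sum]
  refine Finset.sum_congr rfl fun t _ => ?_
  split_ifs
  · rw [one_eq_diagonal, energy_diagonal_kronecker]
  · exact energy_zero _

theorem ite_sq_nonneg (p : Prop) [Decidable p] (z : ℂ) : 0 ≤ if p then ‖z‖ ^ 2 else 0 := by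
  split_ifs <;> positivity

theorem energy_outTerm_nonneg (T : ℕ) (acc : (Q → ZMod 2) → Prop) [DecidablePred acc]
    (Φ : HIdx T Q → ℂ) : 0 ≤ energy (outTerm T acc) Φ := by
  rw [energy_outTerm]
  exact Finset.sum_nonneg fun _ _ => Finset.sum_nonneg fun _ _ => ite_sq_nonneg _ _

theorem energy_hIn_nonneg (T : ℕ) {B : ℕ} (part : Q → Option (Fin B)) (Φ : HIdx T Q → ℂ) :
    0 ≤ energy (hIn T part) Φ := by
  rw [energy_hIn]
  exact Finset.sum_nonneg fun _ _ => Finset.sum_nonneg fun _ _ => Finset.sum_nonneg fun _ _ =>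
    ite_sq_nonneg _ _

theorem energy_hStab_nonneg (T : ℕ) (Φ : HIdx T Q → ℂ) : 0 ≤ energy (hStab T Q) Φ := by
  rw [energy_hStab]
  refine Finset.sum_nonneg fun _ _ => Finset.sum_nonneg fun _ _ => ?_
  split_ifs
  · exact Finset.sum_nonneg fun _ _ => Finset.sum_nonneg fun _ _ => ite_sq_nonneg _ _
  · exact le_rfl

theorem energy_hProp_nonneg {U : List (Op Q)} (hU : ∀ V ∈ U, V ∈ unitary (Op Q))
    (Φ : HIdx U.length Q → ℂ) : 0 ≤ energy (hProp U) Φ := by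
  rw [energy_hProp hU]
  exact Finset.sum_nonneg fun _ _ => mul_nonneg (by norm_num) (nsq_nonneg _)

theorem energy_hamiltonian (U : List (Op Q)) {B : ℕ} (part : Q → Option (Fin B))
    (acc : (Q → ZMod 2) → Prop) [DecidablePred acc] (Φ : HIdx U.length Q → ℂ) :
    energy (historyHam U part + outTerm U.length acc) Φ =
      energy (hProp U) Φ + energy (hIn U.length part) Φ + energy (hStab U.length Q) Φ +
        energy (outTerm U.length acc) Φ := by
  rw [historyHam, energy_add, energy_add, energy_add]

theorem prefixOp_zero (U : List (Op Q)) : prefixOp U 0 = 1 := rfl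

theorem prefixOp_succ (U : List (Op Q)) (t : Fin U.length) :
    prefixOp U (t + 1) = U.get t * prefixOp U t := by
  rw [prefixOp, List.take_succ_eq_append_getElem t.2, List.foldl_append]
  rfl

theorem prefixOp_length (U : List (Op Q)) : prefixOp U U.length = U.reverse.prod := by
  rw [prefixOp, List.take_length]
  have : ∀ (U : List (Op Q)) (A : Op Q), U.foldl (fun A V => V * A) A = U.reverse.prod * A := by
    intro U
    induction U with
    | nil => intro A; simp
    | cons V U ih => intro A; rw [List.foldl_cons, ih]; simp [mul_assoc]
  rw [this, mul_one]

theorem prefixOp_mem_unitary {U : List (Op Q)} (hU : ∀ V ∈ U, V ∈ unitary (Op Q)) (t : ℕ)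
    (ht : t ≤ U.length) : prefixOp U t ∈ unitary (Op Q) := by
  induction t with
  | zero => exact (unitary (Op Q)).one_mem
  | succ t ih =>
    rw [prefixOp_succ U ⟨t, ht⟩]
    exact (unitary (Op Q)).mul_mem (hU _ (List.get_mem U _)) (ih (by omega))

theorem historyHam_isHermitian {U : List (Op Q)} (hU : ∀ V ∈ U, V ∈ unitary (Op Q)) {B : ℕ}
    (part : Q → Option (Fin B)) (acc : (Q → ZMod 2) → Prop) [DecidablePred acc] :
    (historyHam U part + outTerm U.length acc).IsHermitian := by
  have hd : ∀ {ι : Type} [Fintype ι] [DecidableEq ι] (p : ι → Prop) [DecidablePred p],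
      (Matrix.diagonal fun x => if p x then (1 : ℂ) else 0).IsHermitian := by
    intro ι _ _ p _
    rw [Matrix.IsHermitian, Matrix.diagonal_conjTranspose]
    congr 1
    funext x
    rw [Pi.star_apply, apply_ite star, star_one, star_zero]
  have hk : ∀ {A : Op (Fin U.length)} {M : Op Q}, A.IsHermitian → M.IsHermitian →
      (A ⊗ₖ M).IsHermitian := by
    intro A M hA hM
    rw [Matrix.IsHermitian, Matrix.conjTranspose_kronecker, hA.eq, hM.eq]
  have hs : ∀ {α : Type} (s : Finset α) (A : α → Matrix (HIdx U.length Q) (HIdx U.length Q) ℂ),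
      (∀ i ∈ s, (A i).IsHermitian) → (∑ i ∈ s, A i).IsHermitian := by
    intro α s A hA
    rw [Matrix.IsHermitian, Matrix.conjTranspose_sum]
    exact Finset.sum_congr rfl fun i hi => (hA i hi).eq
  refine ((Matrix.IsHermitian.add ?_ ?_).add ?_).add ?_
  · rw [hProp_eq hU]
    refine hs _ _ fun t _ => ?_
    rw [Matrix.IsHermitian, Matrix.conjTranspose_smul, Matrix.conjTranspose_mul,
      Matrix.conjTranspose_conjTranspose]
    congr 1
    simp
  · exact hs _ _ fun i _ => hk (hd _) (Matrix.isHermitian_one.sub (hd _))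
  · refine hs _ _ fun s _ => hs _ _ fun t _ => ?_
    split_ifs
    · exact hk (hd _) Matrix.isHermitian_one
    · exact Matrix.isHermitian_zero
  · exact hk (hd _) (Matrix.isHermitian_one.sub (hd _))

end History

/-! ### Ground energies of history Hamiltonians -/

section Bounds

variable {Q : Type} [Fintype Q] [DecidableEq Q]

/-- The component of a vector at the clock state `1^t 0^(T-t)`. -/
def slice {T : ℕ} (Φ : HIdx T Q → ℂ) (t : ℕ) : (Q → ZMod 2) → ℂ := fun x => Φ (unary T t, x)

/-- The part of a vector outside a set of basis states. -/
def outside (p : (Q → ZMod 2) → Prop) [DecidablePred p] (v : (Q → ZMod 2) → ℂ) :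
    (Q → ZMod 2) → ℂ := fun x => if p x then 0 else v x

theorem nsq_outside (p : (Q → ZMod 2) → Prop) [DecidablePred p] (v : (Q → ZMod 2) → ℂ) :
    nsq (outside p v) = ∑ x, if ¬ p x then ‖v x‖ ^ 2 else 0 := by
  refine Finset.sum_congr rfl fun x _ => ?_
  rw [outside]
  by_cases h : p x <;> simp [h]

theorem nrm_outside_le (p : (Q → ZMod 2) → Prop) [DecidablePred p] (v : (Q → ZMod 2) → ℂ) :
    nrm (outside p v) ≤ nrm v := by
  have h : nsq (outside p v) ≤ nsq v := by
    rw [nsq_outside]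
    refine Finset.sum_le_sum fun x _ => ?_
    split_ifs
    · exact sq_nonneg _
    · exact le_rfl
  exact Real.sqrt_le_sqrt h

theorem nsq_eq_add_outside (p : (Q → ZMod 2) → Prop) [DecidablePred p] (v : (Q → ZMod 2) → ℂ) :
    nsq v = (∑ x, if p x then ‖v x‖ ^ 2 else 0) + nsq (outside p v) := by
  rw [nsq_outside, ← Finset.sum_add_distrib]
  refine Finset.sum_congr rfl fun x _ => ?_
  by_cases h : p x <;> simp [h]

/-- The output term bounds the rejected part of the final state. -/
theorem nsq_outside_slice_last_le {T : ℕ} (acc : (Q → ZMod 2) → Prop) [DecidablePred acc]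
    (Φ : HIdx T Q → ℂ) : nsq (outside acc (slice Φ T)) ≤ energy (outTerm T acc) Φ := by
  rw [nsq_outside, energy_outTerm]
  refine le_trans (le_of_eq ?_) (Finset.single_le_sum (f := fun c : Fin T → ZMod 2 => ∑ x,
      if (∀ t : Fin T, t.val + 1 = T → c t = 1) ∧ ¬ acc x then ‖Φ (c, x)‖ ^ 2 else 0)
    (fun _ _ => Finset.sum_nonneg fun _ _ => ite_sq_nonneg _ _) (Finset.mem_univ (unary T T)))
  refine Finset.sum_congr rfl fun x _ => if_congr ?_ rfl rfl
  exact ⟨fun h => ⟨fun t _ => if_pos t.2, h⟩, fun h => h.2⟩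

/-- The input terms bound the part of the initial state that is not zero on the ancilla qubits. -/
theorem nsq_outside_slice_zero_le {T : ℕ} {B : ℕ} (part : Q → Option (Fin B))
    (p : (Q → ZMod 2) → Prop) [DecidablePred p] (hp : ∀ x, ¬ p x → ∃ q, part q ≠ none ∧ x q ≠ 0)
    (Φ : HIdx T Q → ℂ) : nsq (outside p (slice Φ 0)) ≤ energy (hIn T part) Φ := by
  have h1 : ∀ i : Fin B, (∑ x, if ¬ (∀ q, part q = some i → x q = 0) then
      ‖slice Φ 0 x‖ ^ 2 else 0) ≤ ∑ c, ∑ x,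
      if (∀ t : Fin T, t.val = 0 → c t = 0) ∧ ¬ (∀ q, part q = some i → x q = 0) then
        ‖Φ (c, x)‖ ^ 2 else 0 := by
    intro i
    refine le_trans (le_of_eq ?_) (Finset.single_le_sum (f := fun c : Fin T → ZMod 2 => ∑ x,
        if (∀ t : Fin T, t.val = 0 → c t = 0) ∧ ¬ (∀ q, part q = some i → x q = 0) then
          ‖Φ (c, x)‖ ^ 2 else 0)
      (fun _ _ => Finset.sum_nonneg fun _ _ => ite_sq_nonneg _ _) (Finset.mem_univ (unary T 0)))
    refine Finset.sum_congr rfl fun x _ => if_congr ?_ rfl rfl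
    exact ⟨fun h => ⟨fun t _ => if_neg (by omega), h⟩, fun h => h.2⟩
  rw [energy_hIn]
  refine le_trans ?_ (Finset.sum_le_sum fun i _ => h1 i)
  rw [Finset.sum_comm, nsq_outside]
  refine Finset.sum_le_sum fun x _ => ?_
  by_cases h : p x
  · rw [if_neg (not_not.2 h)]
    exact Finset.sum_nonneg fun _ _ => ite_sq_nonneg _ _
  · rw [if_pos h]
    obtain ⟨q, hq, hx⟩ := hp x h
    obtain ⟨i, hi⟩ := Option.ne_none_iff_exists'.1 hq
    refine le_trans (le_of_eq ?_) (Finset.single_le_sum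
      (fun _ _ => ite_sq_nonneg _ _) (Finset.mem_univ i))
    rw [if_pos fun hh => hx (hh q hi)]

/-- The clock term bounds the weight outside the unary clock states. -/
theorem sum_nsq_slice_ge {T : ℕ} (Φ : HIdx T Q → ℂ) :
    nsq Φ ≤ (∑ t ∈ Finset.range (T + 1), nsq (slice Φ t)) + energy (hStab T Q) Φ := by
  classical
  have h1 : nsq Φ = ∑ c, ∑ x, ‖Φ (c, x)‖ ^ 2 := Fintype.sum_prod_type _
  have h2 : ∑ t ∈ Finset.range (T + 1), nsq (slice Φ t) =
      ∑ c ∈ (Finset.range (T + 1)).image (unary T), ∑ x, ‖Φ (c, x)‖ ^ 2 := by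
    rw [Finset.sum_image unary_injOn]
    rfl
  have h3 : ∑ c ∈ ((Finset.range (T + 1)).image (unary T))ᶜ, ∑ x, ‖Φ (c, x)‖ ^ 2 ≤
      energy (hStab T Q) Φ := by
    have h4 : energy (hStab T Q) Φ = ∑ c : Fin T → ZMod 2, ∑ s : Fin T, ∑ t : Fin T,
        if s.val + 1 = t.val then
          ∑ x : Q → ZMod 2, (if (c s = 0 ∧ c t = 1) ∧ True then ‖Φ (c, x)‖ ^ 2 else 0) else 0 := by
      rw [energy_hStab, Finset.sum_comm]
      rw [Finset.sum_comm (s := (Finset.univ : Finset (Fin T → ZMod 2)))]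
      rw [Finset.sum_comm]
      refine Finset.sum_congr rfl fun s _ => ?_
      rw [Finset.sum_comm]
      refine Finset.sum_congr rfl fun t _ => ?_
      split_ifs
      · rfl
      · rw [Finset.sum_const_zero]
    have hnn : ∀ (c : Fin T → ZMod 2) (s t : Fin T), 0 ≤ if s.val + 1 = t.val then
        ∑ x : Q → ZMod 2, (if (c s = 0 ∧ c t = 1) ∧ True then ‖Φ (c, x)‖ ^ 2 else 0) else 0 := by
      intro c s t
      by_cases h : s.val + 1 = t.val
      · rw [if_pos h]
        exact Finset.sum_nonneg fun _ _ => ite_sq_nonneg _ _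
      · rw [if_neg h]
    rw [h4]
    refine le_trans (Finset.sum_le_sum fun c hc => ?_) (Finset.sum_le_sum_of_subset_of_nonneg
      (Finset.subset_univ (((Finset.range (T + 1)).image (unary T))ᶜ))
      fun c _ _ => Finset.sum_nonneg fun s _ => Finset.sum_nonneg fun t _ => hnn c s t)
    have hbad : ∃ s t : Fin T, s.val + 1 = t.val ∧ (c s = 0 ∧ c t = 1) := by
      by_contra! h
      obtain ⟨t, ht, h5⟩ := exists_eq_unary fun s t hst hh => h s t hst hh.1 hh.2
      exact (Finset.mem_compl.1 hc) (Finset.mem_image.2 ⟨t, ht, h5⟩)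
    obtain ⟨s, t, hst, hct⟩ := hbad
    refine le_trans ?_ (Finset.single_le_sum (fun s _ => Finset.sum_nonneg fun t _ => hnn c s t)
      (Finset.mem_univ s))
    refine le_trans ?_ (Finset.single_le_sum (fun t _ => hnn c s t) (Finset.mem_univ t))
    simp [hst, hct]
  rw [h1, h2, ← Finset.sum_add_sum_compl ((Finset.range (T + 1)).image (unary T))]
  gcongr

/-- The propagation terms bound the error of a single step. -/
theorem nsq_slice_sub_le {U : List (Op Q)} (hU : ∀ V ∈ U, V ∈ unitary (Op Q))
    (Φ : HIdx U.length Q → ℂ) (t : Fin U.length) :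
    nsq (slice Φ (t + 1) - U.get t *ᵥ slice Φ t) ≤ 2 * energy (hProp U) Φ := by
  rw [energy_hProp hU]
  have h1 := Finset.single_le_sum (f := fun t : Fin U.length =>
    1 / 2 * nsq (stepDefect t (U.get t) *ᵥ Φ))
    (fun t _ => mul_nonneg (by norm_num) (nsq_nonneg _)) (Finset.mem_univ t)
  have h2 : nsq (slice Φ (t + 1) - U.get t *ᵥ slice Φ t) ≤
      nsq (stepDefect t (U.get t) *ᵥ Φ) := by
    have h3 : nsq (stepDefect t (U.get t) *ᵥ Φ) =
        ∑ c, ∑ x, ‖(stepDefect t (U.get t) *ᵥ Φ) (c, x)‖ ^ 2 := Fintype.sum_prod_type _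
    rw [h3]
    refine le_trans (le_of_eq ?_) (Finset.single_le_sum (f := fun c : Fin U.length → ZMod 2 => ∑ x,
      ‖(stepDefect t (U.get t) *ᵥ Φ) (c, x)‖ ^ 2)
      (fun _ _ => Finset.sum_nonneg fun _ _ => by positivity)
      (Finset.mem_univ (unary U.length t)))
    refine Finset.sum_congr rfl fun x _ => ?_
    rw [stepDefect_mulVec t _ _ ⟨unary_self t, unary_active t⟩, update_unary]
    rfl
  linarith

/-- The states at all times of a low-energy vector are close to the evolution of its initial
state. -/
theorem nrm_slice_sub_prefix_le {U : List (Op Q)} (hU : ∀ V ∈ U, V ∈ unitary (Op Q))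
    (Φ : HIdx U.length Q → ℂ) {s : ℝ} (hs : 0 ≤ s) (h : energy (hProp U) Φ ≤ s ^ 2) (t : ℕ)
    (ht : t ≤ U.length) :
    nrm (slice Φ t - prefixOp U t *ᵥ slice Φ 0) ≤ t * (2 * s) := by
  induction t with
  | zero =>
    rw [prefixOp_zero, Matrix.one_mulVec, sub_self]
    simp [nrm, nsq]
  | succ t ih =>
    have h1 := ih (by omega)
    have h2 : nrm (slice Φ (t + 1) - U.get ⟨t, ht⟩ *ᵥ slice Φ t) ≤ 2 * s := by
      refine nrm_le_of_nsq_le (by positivity) ?_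
      have := nsq_slice_sub_le hU Φ ⟨t, ht⟩
      simp only at this
      nlinarith [sq_nonneg s]
    have h3 : slice Φ (t + 1) - prefixOp U (t + 1) *ᵥ slice Φ 0 =
        (slice Φ (t + 1) - U.get ⟨t, ht⟩ *ᵥ slice Φ t) +
          U.get ⟨t, ht⟩ *ᵥ (slice Φ t - prefixOp U t *ᵥ slice Φ 0) := by
      rw [prefixOp_succ U ⟨t, ht⟩, Matrix.mulVec_sub, Matrix.mulVec_mulVec]
      abel
    rw [h3]
    refine (nrm_add_le _ _).trans ?_
    rw [nrm_mulVec_of_unitary (hU _ (List.get_mem U _))]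
    push_cast
    linarith

/-- If no initial state with zeros on the ancilla qubits is accepted with probability more than
`v`, then a state of energy `δ` forces `1 - v` to be at most a polynomial times `√δ`. -/
theorem history_soundness {U : List (Op Q)} (hU : ∀ V ∈ U, V ∈ unitary (Op Q)) {B : ℕ}
    (part : Q → Option (Fin B)) (acc : (Q → ZMod 2) → Prop) [DecidablePred acc] {v : ℝ}
    (hv0 : 0 ≤ v) (hv1 : v ≤ 1)
    (hacc : ∀ ψ : (Q → ZMod 2) → ℂ, (∀ x, (∃ q, part q ≠ none ∧ x q ≠ 0) → ψ x = 0) →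
      (∑ x, if acc x then ‖(prefixOp U U.length *ᵥ ψ) x‖ ^ 2 else 0) ≤ v * nsq ψ)
    {Φ : HIdx U.length Q → ℂ} (hΦ : IsState Φ) {δ : ℝ}
    (hδ : energy (historyHam U part + outTerm U.length acc) Φ ≤ δ) :
    1 - v ≤ (1 + 16 * (U.length + 1 : ℝ) ^ 3) * Real.sqrt δ := by
  classical
  rw [energy_hamiltonian] at hδ
  have e1 := energy_hProp_nonneg hU Φ
  have e2 := energy_hIn_nonneg U.length part Φ
  have e3 := energy_hStab_nonneg U.length Φ
  have e4 := energy_outTerm_nonneg U.length acc Φ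
  have hδ0 : 0 ≤ δ := by linarith
  set s := Real.sqrt δ with hs
  have hs0 : 0 ≤ s := Real.sqrt_nonneg δ
  have hss : s ^ 2 = δ := Real.sq_sqrt hδ0
  -- The projection of the initial state onto well-formed inputs. Its evolution stays within `D` of
  -- `Φ` at all times.
  set ψ := slice Φ 0 - outside (fun x => ¬ ∃ q, part q ≠ none ∧ x q ≠ 0) (slice Φ 0) with hψ
  set D : ℝ := 2 * (U.length + 1) * s with hD
  have hT0 : (0 : ℝ) ≤ (U.length : ℝ) := Nat.cast_nonneg U.length
  have hD0 : 0 ≤ D := by positivity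
  have hψ0 : nrm (slice Φ 0 - ψ) ≤ s := by
    rw [hψ, sub_sub_cancel]
    refine nrm_le_of_nsq_le hs0 ((nsq_outside_slice_zero_le part _ (fun x hx => ?_) Φ).trans ?_)
    · exact not_not.1 hx
    · linarith
  have hψ1 : ∀ x, (∃ q, part q ≠ none ∧ x q ≠ 0) → ψ x = 0 := by
    intro x hx
    rw [hψ, Pi.sub_apply, outside, if_neg (not_not.2 hx), sub_self]
  have hslice : ∀ t ≤ U.length, nrm (slice Φ t - prefixOp U t *ᵥ ψ) ≤ s + t * (2 * s) := by
    intro t ht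
    have h1 : slice Φ t - prefixOp U t *ᵥ ψ =
        prefixOp U t *ᵥ (slice Φ 0 - ψ) + (slice Φ t - prefixOp U t *ᵥ slice Φ 0) := by
      rw [Matrix.mulVec_sub _ (slice Φ 0) ψ]; abel
    rw [h1]
    refine (nrm_add_le _ _).trans (add_le_add ?_ ?_)
    · rwa [nrm_mulVec_of_unitary (prefixOp_mem_unitary hU t ht)]
    · exact nrm_slice_sub_prefix_le hU Φ hs0 (by linarith) t ht
  have hTt : ∀ t ≤ U.length, (t : ℝ) * (2 * s) ≤ U.length * (2 * s) := fun t ht =>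
    mul_le_mul_of_nonneg_right (by exact_mod_cast ht) (by positivity)
  -- All slices are within `D` of the evolution of `ψ`, which bounds the norm of `ψ` from below.
  have hnorm : 1 ≤ δ + 2 * (U.length + 1) * (nsq ψ + D ^ 2) := by
    have h1 := sum_nsq_slice_ge Φ
    rw [isState_iff.1 hΦ] at h1
    have h2 : ∀ t ∈ Finset.range (U.length + 1), nsq (slice Φ t) ≤ 2 * (nsq ψ + D ^ 2) := by
      intro t ht
      have ht' : t ≤ U.length := Nat.lt_succ_iff.1 (Finset.mem_range.1 ht)
      have h3 : nrm (slice Φ t) ≤ nrm ψ + D := by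
        have h4 : slice Φ t = prefixOp U t *ᵥ ψ + (slice Φ t - prefixOp U t *ᵥ ψ) := by abel
        rw [h4]
        refine (nrm_add_le _ _).trans ?_
        rw [nrm_mulVec_of_unitary (prefixOp_mem_unitary hU t ht')]
        have := hslice t ht'
        have := hTt t ht'
        rw [hD]
        linarith
      rw [← nrm_sq, ← nrm_sq ψ]
      nlinarith [nrm_nonneg (slice Φ t), nrm_nonneg ψ, sq_nonneg (nrm ψ - D)]
    have h3 := Finset.sum_le_sum h2
    rw [Finset.sum_const, Finset.card_range, nsmul_eq_mul] at h3
    push_cast at h3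
    linarith
  -- The evolution of `ψ` is rejected with probability at least `1 - v`, but it is close to the last
  -- slice, which has little weight on rejected outcomes.
  have hrej : (1 - v) * nsq ψ ≤ D ^ 2 := by
    have h1 := hacc ψ hψ1
    have h2 := nsq_eq_add_outside acc (prefixOp U U.length *ᵥ ψ)
    rw [nsq_mulVec_of_unitary (prefixOp_mem_unitary hU U.length le_rfl)] at h2
    have h3 : nrm (outside acc (prefixOp U U.length *ᵥ ψ)) ≤ D := by
      have h4 : outside acc (prefixOp U U.length *ᵥ ψ) = outside acc (slice Φ U.length) +
          outside acc (prefixOp U U.length *ᵥ ψ - slice Φ U.length) := by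
        funext x
        simp only [outside, Pi.add_apply, Pi.sub_apply]
        split_ifs <;> ring
      have h5 : nrm (prefixOp U U.length *ᵥ ψ - slice Φ U.length) =
          nrm (slice Φ U.length - prefixOp U U.length *ᵥ ψ) := by
        rw [← neg_sub, nrm_eq, nrm_eq, WithLp.toLp_neg, norm_neg]
      rw [h4]
      refine (nrm_add_le _ _).trans ?_
      have h6 : nrm (outside acc (slice Φ U.length)) ≤ s :=
        nrm_le_of_nsq_le hs0 ((nsq_outside_slice_last_le acc Φ).trans (by linarith))
      have h7 := nrm_outside_le acc (prefixOp U U.length *ᵥ ψ - slice Φ U.length)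
      have h8 := hslice U.length le_rfl
      rw [hD]
      linarith
    have h4 : nsq (outside acc (prefixOp U U.length *ᵥ ψ)) ≤ D ^ 2 := by
      rw [← nrm_sq]
      exact pow_le_pow_left₀ (nrm_nonneg _) h3 2
    linarith
  have hfin : 1 - v ≤ (1 + 16 * (U.length + 1 : ℝ) ^ 3) * δ := by
    have hw0 : 0 ≤ 1 - v := by linarith
    have h1 : (1 - v) * 1 ≤ (1 - v) * (δ + 2 * (U.length + 1) * (nsq ψ + D ^ 2)) :=
      mul_le_mul_of_nonneg_left hnorm hw0
    have h2 : (1 - v) * δ ≤ δ := by nlinarith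
    have h3 : (1 - v) * D ^ 2 ≤ D ^ 2 := by nlinarith [sq_nonneg D]
    have h4 : 2 * (U.length + 1 : ℝ) * ((1 - v) * nsq ψ + (1 - v) * D ^ 2) ≤
        2 * (U.length + 1 : ℝ) * (D ^ 2 + D ^ 2) :=
      mul_le_mul_of_nonneg_left (add_le_add hrej h3) (by positivity)
    have h5 : D ^ 2 = 4 * (U.length + 1) ^ 2 * δ := by rw [hD, ← hss]; ring
    rw [h5] at h4
    nlinarith
  -- The bound is linear in `δ`, which is stronger than the claim for `δ ≤ 1`; for `δ ≥ 1` the claim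
  -- follows from `v ≥ 0`.
  have hC : (1 : ℝ) ≤ 1 + 16 * (U.length + 1 : ℝ) ^ 3 := by
    have : (0 : ℝ) ≤ 16 * (U.length + 1 : ℝ) ^ 3 := by positivity
    linarith
  rcases le_total s 1 with h1 | h1
  · refine hfin.trans (mul_le_mul_of_nonneg_left ?_ (by linarith))
    rw [← hss]
    nlinarith
  · nlinarith

/-- The history state of the computation that starts at `ψ`. -/
def historyState (U : List (Op Q)) (ψ : (Q → ZMod 2) → ℂ) : HIdx U.length Q → ℂ := fun p =>
  (1 / (Real.sqrt (U.length + 1) : ℝ) : ℂ) * ∑ t ∈ Finset.range (U.length + 1),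
    (if p.1 = unary U.length t then (1 : ℂ) else 0) * (prefixOp U t *ᵥ ψ) p.2

theorem historyState_unary (U : List (Op Q)) (ψ : (Q → ZMod 2) → ℂ) {t : ℕ}
    (ht : t ∈ Finset.range (U.length + 1)) (x : Q → ZMod 2) :
    historyState U ψ (unary U.length t, x) =
      (1 / (Real.sqrt (U.length + 1) : ℝ) : ℂ) * (prefixOp U t *ᵥ ψ) x := by
  rw [historyState, Finset.sum_eq_single t]
  · simp
  · intro s hs hst
    rw [if_neg (fun h => hst (unary_injOn hs ht h.symm)), zero_mul]
  · exact fun h => absurd ht h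

theorem historyState_eq_zero (U : List (Op Q)) (ψ : (Q → ZMod 2) → ℂ) {c : Fin U.length → ZMod 2}
    (hc : ∀ t ∈ Finset.range (U.length + 1), c ≠ unary U.length t) (x : Q → ZMod 2) :
    historyState U ψ (c, x) = 0 := by
  rw [historyState, Finset.sum_eq_zero, mul_zero]
  intro t ht
  rw [if_neg (hc t ht), zero_mul]

/-- The only contribution to the energy of a history state with a well-formed initial state is the
probability of rejection. -/
theorem energy_historyState {U : List (Op Q)} (hU : ∀ V ∈ U, V ∈ unitary (Op Q)) {B : ℕ}
    (hT : 0 < U.length)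
    (part : Q → Option (Fin B)) (acc : (Q → ZMod 2) → Prop) [DecidablePred acc]
    {ψ : (Q → ZMod 2) → ℂ} (hψ : ∀ x, (∃ q, part q ≠ none ∧ x q ≠ 0) → ψ x = 0) :
    energy (historyHam U part + outTerm U.length acc) (historyState U ψ) =
      1 / (U.length + 1) * nsq (outside acc (prefixOp U U.length *ᵥ ψ)) := by
  have hnorm : ∀ z : ℂ, ‖(1 / (Real.sqrt (U.length + 1) : ℝ) : ℂ) * z‖ ^ 2 =
      1 / (U.length + 1) * ‖z‖ ^ 2 := by
    intro z
    rw [norm_mul, mul_pow, norm_div, norm_one, Complex.norm_real, Real.norm_eq_abs, div_pow, sq_abs,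
      Real.sq_sqrt (by positivity), one_pow]
  have h1 : energy (hProp U) (historyState U ψ) = 0 := by
    rw [energy_hProp hU]
    refine Finset.sum_eq_zero fun t _ => ?_
    have h2 : stepDefect t (U.get t) *ᵥ historyState U ψ = 0 := by
      funext p
      obtain ⟨c, x⟩ := p
      by_cases hc : c t = 0 ∧ Active t c
      · rw [stepDefect_mulVec t _ _ hc]
        by_cases hct : c = unary U.length t
        · subst hct
          have h3 : (fun y => historyState U ψ (unary U.length t, y)) =
              (1 / (Real.sqrt (U.length + 1) : ℝ) : ℂ) • (prefixOp U t *ᵥ ψ) := by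
            funext y
            rw [historyState_unary U ψ (by simp only [Finset.mem_range]; omega)]
            rfl
          rw [update_unary, historyState_unary U ψ (by simp only [Finset.mem_range]; omega), h3,
            Matrix.mulVec_smul, Matrix.mulVec_mulVec, prefixOp_succ]
          exact sub_self _
          -- At a clock state that is not unary both sides of the defect vanish.
        · have h3 : ∀ s ∈ Finset.range (U.length + 1), c ≠ unary U.length s := by
            intro s _ hcs
            have := eq_of_active_unary hc.2 hcs hc.1
            exact hct (this ▸ hcs)
          have h4 : ∀ s ∈ Finset.range (U.length + 1),
              Function.update c t 1 ≠ unary U.length s := by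
            intro s hs hcs
            have hs' : s ≤ U.length := by simp only [Finset.mem_range] at hs; omega
            have h5 : t.val < s := by
              by_contra hlt
              have := congrFun hcs t
              rw [Function.update_self, unary, if_neg hlt] at this
              exact one_ne_zero this
            have h6 : s = t.val + 1 := by
              by_contra hne
              have h7 := hc.2.2 ⟨t.val + 1, by omega⟩ rfl
              have h8 := congrFun hcs ⟨t.val + 1, by omega⟩
              rw [Function.update_of_ne (by simp [Fin.ext_iff]), h7, unary,
                if_pos (by simp only; omega)] at h8
              exact zero_ne_one h8
            refine hct ?_
            rw [h6, ← update_unary] at hcs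
            have h9 := congrArg (fun c => Function.update c t 0) hcs
            simp only [Function.update_idem] at h9
            rwa [← hc.1, Function.update_eq_self, hc.1, ← unary_self t,
              Function.update_eq_self] at h9
          have h5 : (fun y => historyState U ψ (c, y)) = 0 :=
            funext fun y => historyState_eq_zero U ψ h3 y
          rw [historyState_eq_zero U ψ h4, h5, Matrix.mulVec_zero]
          simp
      · exact stepDefect_mulVec_eq_zero t _ _ hc x
    rw [h2]
    simp [nsq]
  have h2 : energy (hIn U.length part) (historyState U ψ) = 0 := by
    rw [energy_hIn]
    refine Finset.sum_eq_zero fun i _ => Finset.sum_eq_zero fun c _ =>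
      Finset.sum_eq_zero fun x _ => ?_
    split_ifs with h
    · suffices historyState U ψ (c, x) = 0 by rw [this]; simp
      by_cases hc : ∃ t ∈ Finset.range (U.length + 1), c = unary U.length t
      · obtain ⟨t, ht, rfl⟩ := hc
        rw [historyState_unary U ψ ht]
        have h3 : t = 0 := by
          have h4 := h.1 ⟨0, hT⟩ rfl
          by_contra h5
          rw [unary, if_pos (Nat.pos_of_ne_zero h5)] at h4
          exact one_ne_zero h4
        subst h3
        obtain ⟨q, hq, hx⟩ : ∃ q, part q = some i ∧ x q ≠ 0 := by
          simpa using h.2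
        rw [prefixOp_zero, Matrix.one_mulVec, hψ x ⟨q, by simp [hq], hx⟩, mul_zero]
      · push Not at hc
        exact historyState_eq_zero U ψ hc x
    · rfl
  have h3 : energy (hStab U.length Q) (historyState U ψ) = 0 := by
    rw [energy_hStab]
    refine Finset.sum_eq_zero fun s _ => Finset.sum_eq_zero fun t _ => ?_
    split_ifs with hst
    · refine Finset.sum_eq_zero fun c _ => Finset.sum_eq_zero fun x _ => ?_
      split_ifs with hc
      · rw [historyState_eq_zero U ψ]
        · simp
        · rintro r _ rfl
          obtain ⟨⟨h4, h5⟩, -⟩ := hc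
          have h6 : t.val < r := by
            by_contra h6
            rw [unary, if_neg h6] at h5
            exact zero_ne_one h5
          rw [unary, if_pos (by omega)] at h4
          exact one_ne_zero h4
      · rfl
    · rfl
  rw [energy_hamiltonian, h1, h2, h3, energy_outTerm, nsq_outside, Finset.mul_sum, zero_add,
    zero_add, zero_add, Finset.sum_eq_single (unary U.length U.length)]
  · refine Finset.sum_congr rfl fun x _ => ?_
    rw [historyState_unary U ψ (by simp), hnorm, mul_ite, mul_zero]
    refine if_congr ?_ rfl rfl
    exact ⟨fun h => h.2, fun h => ⟨fun t _ => if_pos t.2, h⟩⟩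
  · intro c _ hc
    refine Finset.sum_eq_zero fun x _ => ?_
    split_ifs with h
    · rw [historyState_eq_zero U ψ]
      · simp
      · rintro t ht rfl
        refine hc ?_
        have h4 := h.1 ⟨U.length - 1, by omega⟩ (by simp only; omega)
        have h5 : U.length - 1 < t := by
          by_contra h5
          rw [unary, if_neg h5] at h4
          exact zero_ne_one h4
        congr 1
        simp only [Finset.mem_range] at ht
        omega
    · rfl
  · simp

theorem isState_historyState {U : List (Op Q)} (hU : ∀ V ∈ U, V ∈ unitary (Op Q))
    {ψ : (Q → ZMod 2) → ℂ} (hψ : IsState ψ) : IsState (historyState U ψ) := by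
  classical
  rw [isState_iff] at hψ ⊢
  have h1 : nsq (historyState U ψ) = ∑ c, ∑ x, ‖historyState U ψ (c, x)‖ ^ 2 :=
    Fintype.sum_prod_type _
  rw [h1, ← Finset.sum_subset (Finset.subset_univ ((Finset.range (U.length + 1)).image
    (unary U.length))), Finset.sum_image unary_injOn]
  · have h2 : ∀ t ∈ Finset.range (U.length + 1),
        ∑ x, ‖historyState U ψ (unary U.length t, x)‖ ^ 2 = 1 / (U.length + 1) := by
      intro t ht
      have h3 : nsq ((1 / (Real.sqrt (U.length + 1) : ℝ) : ℂ) • (prefixOp U t *ᵥ ψ)) =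
          1 / (U.length + 1) := by
        rw [nsq_smul, nsq_mulVec_of_unitary (prefixOp_mem_unitary hU t
          (by simp only [Finset.mem_range] at ht; omega)), hψ, norm_div, norm_one,
          Complex.norm_real, Real.norm_eq_abs, div_pow, sq_abs, Real.sq_sqrt (by positivity),
          one_pow, mul_one]
      rw [← h3]
      exact Finset.sum_congr rfl fun x _ => by rw [historyState_unary U ψ ht]; rfl
    rw [Finset.sum_congr rfl h2, Finset.sum_const, Finset.card_range, nsmul_eq_mul]
    push_cast
    field_simp
  · intro c _ hc
    refine Finset.sum_eq_zero fun x _ => ?_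
    rw [historyState_eq_zero U ψ]
    · simp
    · intro t ht hct
      exact hc (Finset.mem_image.2 ⟨t, ht, hct.symm⟩)

theorem isHistoryState_historyState {U : List (Op Q)} {B : ℕ} {part : Q → Option (Fin B)}
    {ψ : (Q → ZMod 2) → ℂ} (hψ : IsState ψ)
    (hz : ∀ x, (∃ q, part q ≠ none ∧ x q ≠ 0) → ψ x = 0) :
    IsHistoryState U part (historyState U ψ) :=
  ⟨ψ, hψ, hz, fun _ _ => rfl⟩

end Bounds

/-! ### Minimum eigenvalues -/

section LambdaMin

variable {ι : Type} [Fintype ι] [DecidableEq ι]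

theorem energy_diagonal_ofReal (d : ι → ℝ) (Φ : ι → ℂ) :
    energy (Matrix.diagonal fun i => (d i : ℂ)) Φ = ∑ i, d i * ‖Φ i‖ ^ 2 := by
  rw [energy, dotProduct, Complex.re_sum]
  refine Finset.sum_congr rfl fun i _ => ?_
  rw [Matrix.mulVec_diagonal, Pi.star_apply, mul_left_comm, Complex.star_def, Complex.conj_mul',
    ← Complex.ofReal_pow, ← Complex.ofReal_mul, Complex.ofReal_re]

theorem energy_conj (V D : Matrix ι ι ℂ) (Φ : ι → ℂ) :
    energy (V * D * Vᴴ) Φ = energy D (Vᴴ *ᵥ Φ) := by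
  rw [energy, energy, ← Matrix.mulVec_mulVec, ← Matrix.mulVec_mulVec, Matrix.dotProduct_mulVec,
    Matrix.star_mulVec, Matrix.conjTranspose_conjTranspose]

/-- The minimum eigenvalue of a Hermitian matrix is attained and is the minimum of the quadratic
form on unit vectors. -/
theorem exists_state_energy_eq_lambdaMin [Nonempty ι] {H : Matrix ι ι ℂ} (hH : H.IsHermitian) :
    (∃ Φ, IsState Φ ∧ energy H Φ = lambdaMin H) ∧
      ∀ Ψ, lambdaMin H * nsq Ψ ≤ energy H Ψ := by
  obtain ⟨i, hi⟩ := Finite.exists_min hH.eigenvalues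
  have hV : (hH.eigenvectorUnitary : Matrix ι ι ℂ) ∈ unitary (Matrix ι ι ℂ) :=
    hH.eigenvectorUnitary.2
  have hspec : H = (hH.eigenvectorUnitary : Matrix ι ι ℂ) *
      (Matrix.diagonal fun j => (hH.eigenvalues j : ℂ)) *
        (hH.eigenvectorUnitary : Matrix ι ι ℂ)ᴴ := by
    conv_lhs => rw [hH.spectral_theorem, Unitary.conjStarAlgAut_apply]
    rfl
  have hlow : ∀ Ψ, hH.eigenvalues i * nsq Ψ ≤ energy H Ψ := by
    intro Ψ
    rw [congrArg (fun A => energy A Ψ) hspec, energy_conj, energy_diagonal_ofReal,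
      ← nsq_mulVec_of_unitary (Unitary.star_mem hV) Ψ, nsq, Finset.mul_sum]
    exact Finset.sum_le_sum fun j _ => mul_le_mul_of_nonneg_right (hi j) (sq_nonneg _)
  have heig : ∀ (w : ι → ℂ) (r : ℝ), H *ᵥ w = (r : ℂ) • w → energy H w = r * nsq w := by
    intro w r h
    rw [energy, h, dotProduct_smul, star_dotProduct_self, smul_eq_mul, ← Complex.ofReal_mul,
      Complex.ofReal_re]
  have hst : IsState (hH.eigenvectorUnitary *ᵥ Pi.single i 1 : ι → ℂ) := by
    rw [isState_iff, nsq_mulVec_of_unitary hV, nsq, Finset.sum_eq_single i]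
    · simp
    · intro j _ hj
      simp [Pi.single_eq_of_ne hj]
    · simp
  have hev : H *ᵥ (hH.eigenvectorUnitary *ᵥ Pi.single i 1 : ι → ℂ) =
      (hH.eigenvalues i : ℂ) • (hH.eigenvectorUnitary *ᵥ Pi.single i 1 : ι → ℂ) := by
    rw [hH.eigenvectorUnitary_mulVec, hH.mulVec_eigenvectorBasis]
    rfl
  have hleast : IsLeast {r : ℝ | Module.End.HasEigenvalue (Matrix.toLin' H) (r : ℂ)}
      (hH.eigenvalues i) := by
    constructor
    · refine Module.End.hasEigenvalue_of_hasEigenvector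
        (x := (hH.eigenvectorUnitary *ᵥ Pi.single i 1 : ι → ℂ)) ⟨?_, ?_⟩
      · rw [Module.End.mem_eigenspace_iff, Matrix.toLin'_apply]
        exact hev
      · intro h0
        rw [h0, isState_iff] at hst
        simp [nsq] at hst
    · intro r hr
      obtain ⟨w, hw⟩ := Module.End.HasEigenvalue.exists_hasEigenvector hr
      have h1 := hw.apply_eq_smul
      rw [Matrix.toLin'_apply] at h1
      have h2 := hlow w
      rw [heig w r h1] at h2
      refine le_of_mul_le_mul_right h2 ?_
      obtain ⟨j, hj⟩ := Function.ne_iff.1 hw.2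
      refine lt_of_lt_of_le ?_ (Finset.single_le_sum (f := fun x => ‖w x‖ ^ 2)
        (fun _ _ => sq_nonneg _) (Finset.mem_univ j))
      have : 0 < ‖w j‖ := norm_pos_iff.2 hj
      positivity
  have hmin : lambdaMin H = hH.eigenvalues i := hleast.csInf_eq
  refine ⟨⟨_, hst, ?_⟩, fun Ψ => hmin ▸ hlow Ψ⟩
  rw [heig _ _ hev, isState_iff.1 hst, mul_one, hmin]

end LambdaMin

/-! ### Reduced states -/

section Reduced

variable {A B R : Type} [Fintype A] [DecidableEq A] [Fintype B] [DecidableEq B]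
  [Fintype R] [DecidableEq R]

/-- The density matrix of a pure state. -/
def pureOp {ι : Type} (v : ι → ℂ) : Matrix ι ι ℂ := Matrix.vecMulVec v (star v)

theorem trace_mul_pureOp {ι : Type} [Fintype ι] (M : Matrix ι ι ℂ) (v : ι → ℂ) :
    (M * pureOp v).trace = star v ⬝ᵥ (M *ᵥ v) := by
  rw [pureOp, Matrix.mul_vecMulVec, Matrix.trace_vecMulVec, dotProduct_comm]

/-- Taking the reduced state is adjoint to acting on part of the register. -/
theorem trace_mul_reduced (e : A → R) (M : Op A) (σ : Op R) :
    (M * reduced e σ).trace = (lift e M * σ).trace := by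
  simp only [Matrix.trace, Matrix.diag, Matrix.mul_apply, reduced, lift, Matrix.of_apply,
    Finset.mul_sum]
  have h1 : ∀ a : A → ZMod 2, (∑ b : A → ZMod 2, ∑ x : R → ZMod 2, ∑ y : R → ZMod 2, M a b *
      if x ∘ e = b ∧ y ∘ e = a ∧ ∀ q, (∀ c, e c ≠ q) → x q = y q then σ x y else 0) =
      ∑ x : R → ZMod 2, ∑ y : R → ZMod 2, if y ∘ e = a then M a (x ∘ e) *
        (if ∀ q, (∀ c, e c ≠ q) → x q = y q then σ x y else 0) else 0 := by
    intro a
    rw [Finset.sum_comm]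
    refine Finset.sum_congr rfl fun x _ => ?_
    rw [Finset.sum_comm]
    refine Finset.sum_congr rfl fun y _ => ?_
    rw [Finset.sum_eq_single (x ∘ e)]
    · by_cases h : y ∘ e = a <;> simp [h]
    · intro b _ hb
      rw [if_neg (fun h => hb h.1.symm), mul_zero]
    · simp
  rw [Finset.sum_congr rfl fun a _ => h1 a, Finset.sum_comm]
  conv_rhs => rw [Finset.sum_comm]
  refine Finset.sum_congr rfl fun x _ => ?_
  rw [Finset.sum_comm]
  refine Finset.sum_congr rfl fun y _ => ?_
  rw [Finset.sum_ite_eq, if_pos (Finset.mem_univ _), mul_ite, mul_zero, ite_mul, zero_mul]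
  refine if_congr ?_ rfl rfl
  simp only [eq_comm]

theorem reduced_reduced {f : B → R} (hf : f.Injective) (e : A → B) (σ : Op R) :
    reduced e (reduced f σ) = reduced (f ∘ e) σ := by
  refine Matrix.ext_iff_trace_mul_left.2 fun M => ?_
  rw [trace_mul_reduced, trace_mul_reduced, trace_mul_reduced, lift_comp hf]

theorem trace_reduced (e : A → R) (σ : Op R) : (reduced e σ).trace = σ.trace := by
  have := trace_mul_reduced e 1 σ
  rwa [one_mul, lift_one, one_mul] at this

theorem isDensity_reduced_pureOp {e : A → R} (he : e.Injective) {v : (R → ZMod 2) → ℂ}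
    (hv : IsState v) : IsDensity (reduced e (pureOp v)) := by
  refine ⟨?_, ?_⟩
  · refine Matrix.PosSemidef.of_dotProduct_mulVec_nonneg ?_ fun x => ?_
    · ext a b
      simp only [Matrix.conjTranspose_apply, reduced, Matrix.of_apply, star_sum]
      rw [Finset.sum_comm]
      refine Finset.sum_congr rfl fun x _ => Finset.sum_congr rfl fun y _ => ?_
      rw [apply_ite star, star_zero]
      refine if_congr ?_ ?_ rfl
      · simp only [eq_comm]
        tauto
      · simp [pureOp, Matrix.vecMulVec_apply, mul_comm]
    · rw [← trace_mul_pureOp, Matrix.trace_mul_comm, trace_mul_reduced, trace_mul_pureOp]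
      have h1 : pureOp x = Matrix.vecMulVec x (Pi.single (0 : A → ZMod 2) 1) *
          (Matrix.vecMulVec x (Pi.single (0 : A → ZMod 2) 1))ᴴ := by
        rw [Matrix.conjTranspose_vecMulVec, Matrix.vecMulVec_mul_vecMulVec]
        simp [pureOp]
      rw [h1, lift_mul he, ← lift_conjTranspose]
      exact (Matrix.posSemidef_self_mul_conjTranspose _).dotProduct_mulVec_nonneg v
  · rw [trace_reduced, ← one_mul (pureOp v), trace_mul_pureOp, Matrix.one_mulVec]
    exact hv

theorem reduced_pureOp_eq_withZeros {C : Type} [Fintype C] [DecidableEq C] {f : A ⊕ C → R}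
    (v : (R → ZMod 2) → ℂ) (hv : ∀ x, (∃ c, x (f (Sum.inr c)) ≠ 0) → v x = 0) :
    reduced f (pureOp v) = withZeros (reduced (f ∘ Sum.inl) (pureOp v)) := by
  ext a b
  simp only [reduced, withZeros, Matrix.of_apply, pureOp, Matrix.vecMulVec_apply, Pi.star_apply]
  have hv' : ∀ {a : A ⊕ C → ZMod 2} {x : R → ZMod 2}, x ∘ f = a → v x ≠ 0 →
      ∀ c, a (Sum.inr c) = 0 := by
    rintro _ x rfl hx c
    by_contra h
    exact hx (hv x ⟨c, h⟩)
  split_ifs with h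
  · refine Finset.sum_congr rfl fun x _ => Finset.sum_congr rfl fun y _ => ?_
    by_cases hx : v x = 0
    · simp [hx]
    by_cases hy : v y = 0
    · simp [hy]
    have hx' : ∀ c, x (f (Sum.inr c)) = 0 := fun c => by
      by_contra h; exact hx (hv x ⟨c, h⟩)
    have hy' : ∀ c, y (f (Sum.inr c)) = 0 := fun c => by
      by_contra h; exact hy (hv y ⟨c, h⟩)
    refine if_congr ?_ rfl rfl
    constructor
    · rintro ⟨rfl, rfl, h3⟩
      refine ⟨rfl, rfl, fun q hq => ?_⟩
      by_cases hqc : ∃ c, f (Sum.inr c) = q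
      · obtain ⟨c, rfl⟩ := hqc
        rw [hx', hy']
      · push Not at hqc
        refine h3 q ?_
        rintro (c | c)
        · exact hq c
        · exact hqc c
    · rintro ⟨h1, h2, h3⟩
      refine ⟨funext ?_, funext ?_, fun q hq => h3 q fun c => hq (Sum.inl c)⟩
      · rintro (c | c)
        · exact congrFun h1 c
        · rw [h.1 c]; exact hx' c
      · rintro (c | c)
        · exact congrFun h2 c
        · rw [h.2 c]; exact hy' c
  · refine Finset.sum_eq_zero fun x _ => Finset.sum_eq_zero fun y _ => ?_
    split_ifs with h'
    · by_contra hne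
      exact h ⟨hv' h'.1 (left_ne_zero_of_mul hne),
        hv' h'.2.1 (star_ne_zero.1 (right_ne_zero_of_mul hne))⟩
    · rfl

/-- The projection onto the value `1` of a qubit. -/
def oneProj (q : R) : Op R := Matrix.diagonal fun x => if x q = 1 then 1 else 0

theorem oneProj_mul_self (q : R) : oneProj q * oneProj q = oneProj q := by
  rw [oneProj, Matrix.diagonal_mul_diagonal]
  congr 1
  funext x
  split_ifs <;> simp

theorem oneProj_conjTranspose (q : R) : (oneProj q)ᴴ = oneProj q := by
  rw [oneProj, Matrix.diagonal_conjTranspose]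
  congr 1
  funext x
  rw [Pi.star_apply, apply_ite star, star_one, star_zero]

theorem lift_oneProj (e : A → R) (a : A) : lift e (oneProj a) = oneProj (e a) :=
  lift_diagonal _ _

/-- The measurement statistics of a circuit on a reduced state can be computed on the whole
register. -/
theorem prOne_reduced {k γ : ℕ} [NeZero γ] (C : Circuit k γ) {f : Fin k ⊕ Fin γ → R}
    (hf : f.Injective) (v : (R → ZMod 2) → ℂ)
    (hv : ∀ x, (∃ c, x (f (Sum.inr c)) ≠ 0) → v x = 0) :
    C.prOne (reduced (f ∘ Sum.inl) (pureOp v)) =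
      nsq (oneProj (f (Sum.inr 0)) *ᵥ (lift f C.op *ᵥ v)) := by
  rw [Circuit.prOne, ← reduced_pureOp_eq_withZeros v hv]
  change ((oneProj (Sum.inr 0 : Fin k ⊕ Fin γ)) * _).trace.re = _
  rw [← mul_assoc, ← mul_assoc, Matrix.trace_mul_comm, ← mul_assoc, ← mul_assoc, trace_mul_reduced,
    trace_mul_pureOp, ← oneProj_mul_self, lift_mul hf, lift_mul hf, lift_mul hf,
    ← lift_conjTranspose, lift_oneProj]
  have h1 : star v ⬝ᵥ (((lift f C.op)ᴴ * (oneProj (f (Sum.inr 0)) * oneProj (f (Sum.inr 0))) *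
      lift f C.op) *ᵥ v) = (nsq (oneProj (f (Sum.inr 0)) *ᵥ (lift f C.op *ᵥ v)) : ℂ) := by
    rw [← star_dotProduct_self, Matrix.star_mulVec, Matrix.star_mulVec, oneProj_conjTranspose,
      Matrix.dotProduct_mulVec, Matrix.dotProduct_mulVec]
    simp only [Matrix.vecMul_vecMul, Matrix.dotProduct_mulVec, mul_assoc]
  rw [h1, Complex.ofReal_re]

end Reduced

/-! ### The value is attained at a pure state -/

/-- The observable on the input register whose expectation is the acceptance probability of a
circuit. -/
def Circuit.effect {k γ : ℕ} [NeZero γ] (C : Circuit k γ) : Op (Fin k) :=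
  (C.opᴴ * oneProj (Sum.inr 0) * C.op).submatrix (fun x => Sum.elim x 0) fun x => Sum.elim x 0

theorem trace_mul_withZeros {A B : Type} [Fintype A] [DecidableEq A] [Fintype B] [DecidableEq B]
    (M : Op (A ⊕ B)) (ρ : Op A) :
    (M * withZeros ρ).trace =
      (M.submatrix (fun x => Sum.elim x 0) (fun x => Sum.elim x 0) * ρ).trace := by
  have hsum : ∀ F : (A ⊕ B → ZMod 2) → ℂ, (∀ x, (∃ b, x (Sum.inr b) ≠ 0) → F x = 0) →
      ∑ x, F x = ∑ x : A → ZMod 2, F (Sum.elim x 0) := by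
    intro F hF
    rw [← Equiv.sum_comp (Equiv.sumArrowEquivProdArrow A B (ZMod 2)).symm,
      Fintype.sum_prod_type]
    refine Finset.sum_congr rfl fun x _ => ?_
    rw [Finset.sum_eq_single 0]
    · rfl
    · intro b _ hb
      obtain ⟨c, hc⟩ := Function.ne_iff.1 hb
      exact hF _ ⟨c, hc⟩
    · simp
  simp only [Matrix.trace, Matrix.diag, Matrix.mul_apply]
  rw [hsum]
  · refine Finset.sum_congr rfl fun x _ => ?_
    rw [hsum]
    · refine Finset.sum_congr rfl fun y _ => ?_
      simp only [withZeros, Matrix.of_apply, Matrix.submatrix_apply, Sum.elim_inr, Pi.zero_apply,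
        implies_true, and_self, if_true, Sum.elim_comp_inl]
    · rintro y ⟨b, hb⟩
      simp only [withZeros, Matrix.of_apply]
      rw [if_neg fun h => hb (h.1 b), mul_zero]
  · rintro y ⟨b, hb⟩
    refine Finset.sum_eq_zero fun x _ => ?_
    simp only [withZeros, Matrix.of_apply]
    rw [if_neg fun h => hb (h.2 b), mul_zero]

theorem Circuit.effect_isHermitian {k γ : ℕ} [NeZero γ] (C : Circuit k γ) :
    C.effect.IsHermitian := by
  refine Matrix.IsHermitian.submatrix ?_ _
  exact Matrix.isHermitian_conjTranspose_mul_mul _ (oneProj_conjTranspose _)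

theorem Circuit.prOne_eq {k γ : ℕ} [NeZero γ] (C : Circuit k γ) (ρ : Op (Fin k)) :
    C.prOne ρ = (C.effect * ρ).trace.re := by
  rw [Circuit.effect, ← trace_mul_withZeros, Circuit.prOne]
  change ((oneProj (Sum.inr 0 : Fin k ⊕ Fin γ)) * _).trace.re = _
  rw [← mul_assoc, ← mul_assoc, Matrix.trace_mul_comm, ← mul_assoc, ← mul_assoc]

theorem trace_mul_re_nonneg {ι : Type} [Fintype ι] [DecidableEq ι] {A σ : Matrix ι ι ℂ}
    (hA : A.PosSemidef) (hσ : σ.PosSemidef) : 0 ≤ (A * σ).trace.re := by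
  obtain ⟨B, rfl⟩ : ∃ B : Matrix ι ι ℂ, σ = Bᴴ * B := by
    open scoped MatrixOrder in
    exact CStarAlgebra.nonneg_iff_eq_star_mul_self.1 hσ.nonneg
  rw [← mul_assoc, Matrix.trace_mul_comm, ← mul_assoc]
  exact (Complex.nonneg_iff.1 (hA.mul_mul_conjTranspose_same B).trace_nonneg).1

/-- The expectation of an observable is maximized by a pure state. -/
theorem exists_state_trace_mul_le {ι : Type} [Fintype ι] [DecidableEq ι] [Nonempty ι]
    {A : Matrix ι ι ℂ} (hA : A.IsHermitian) : ∃ v, IsState v ∧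
      ∀ σ : Matrix ι ι ℂ, σ.PosSemidef → σ.trace = 1 →
        (A * σ).trace.re ≤ (A * pureOp v).trace.re := by
  obtain ⟨⟨v, hv, he⟩, hmin⟩ := exists_state_energy_eq_lambdaMin hA.neg
  refine ⟨v, hv, fun σ hσ h1 => ?_⟩
  rw [trace_mul_pureOp]
  rw [energy, Matrix.neg_mulVec, dotProduct_neg, Complex.neg_re] at he
  -- A ground state of `-A` works, since `-A - λ_min(-A)` is positive semidefinite.
  have hps : (-A - (lambdaMin (-A) : ℂ) • (1 : Matrix ι ι ℂ)).PosSemidef := by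
    have hh : (-A - (lambdaMin (-A) : ℂ) • (1 : Matrix ι ι ℂ)).IsHermitian := by
      refine hA.neg.sub ?_
      rw [Matrix.IsHermitian, Matrix.conjTranspose_smul, Matrix.conjTranspose_one,
        Complex.star_def, Complex.conj_ofReal]
    refine Matrix.PosSemidef.of_dotProduct_mulVec_nonneg hh fun x => ?_
    rw [Complex.nonneg_iff]
    refine ⟨?_, (hh.im_star_dotProduct_mulVec_self x).symm⟩
    rw [Matrix.sub_mulVec, dotProduct_sub, Complex.sub_re, Matrix.smul_mulVec, Matrix.one_mulVec,
      dotProduct_smul, star_dotProduct_self, smul_eq_mul, ← Complex.ofReal_mul,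
      Complex.ofReal_re]
    exact sub_nonneg.2 (hmin x)
  have h := trace_mul_re_nonneg hps hσ
  rw [sub_mul, Matrix.trace_sub, Matrix.smul_mul, one_mul, Matrix.trace_smul, h1, neg_mul,
    Matrix.trace_neg, Complex.sub_re, Complex.neg_re, smul_eq_mul, mul_one,
    Complex.ofReal_re] at h
  linarith

theorem isDensity_pureOp {Q : Type} [Fintype Q] [DecidableEq Q] {v : (Q → ZMod 2) → ℂ}
    (hv : IsState v) : IsDensity (pureOp v) := by
  refine ⟨Matrix.posSemidef_vecMulVec_self_star v, ?_⟩
  rw [pureOp, Matrix.trace_vecMulVec, dotProduct_comm]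
  exact hv

namespace QSAT

variable {k γ : ℕ} [NeZero γ] (I : QSAT k γ)

/-- The observable whose expectation in a state is the value of the instance at that state. -/
def valOp : Op (Fin I.n) :=
  (I.m : ℝ)⁻¹ • ∑ i, lift (I.elt i) (I.C i).effect

theorem valOp_isHermitian : I.valOp.IsHermitian := by
  rw [Matrix.IsHermitian, valOp, Matrix.conjTranspose_smul, Matrix.conjTranspose_sum, star_trivial]
  congr 1
  refine Finset.sum_congr rfl fun i _ => ?_
  rw [lift_conjTranspose, (I.C i).effect_isHermitian.eq]

theorem valAt_eq (σ : Op (Fin I.n)) : I.valAt σ = (I.valOp * σ).trace.re := by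
  rw [valOp, Matrix.smul_mul, Matrix.trace_smul, Complex.real_smul, Complex.re_ofReal_mul,
    Finset.sum_mul, Matrix.trace_sum, Complex.re_sum, valAt, div_eq_inv_mul]
  congr 1
  refine Finset.sum_congr rfl fun i _ => ?_
  rw [Circuit.prOne_eq, trace_mul_reduced]

/-- The supremum defining the value is a maximum, attained at a pure state. -/
theorem exists_val_eq : ∃ v₀ : (Fin I.n → ZMod 2) → ℂ, IsState v₀ ∧
    I.valAt (pureOp v₀) = I.val ∧ ∀ σ, IsDensity σ → I.valAt σ ≤ I.val := by
  obtain ⟨v₀, hv₀, hmax⟩ := exists_state_trace_mul_le I.valOp_isHermitian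
  have hle : ∀ σ, IsDensity σ → I.valAt σ ≤ I.valAt (pureOp v₀) := by
    intro σ hσ
    rw [valAt_eq, valAt_eq]
    exact hmax σ hσ.1 hσ.2
  have hval : I.val = I.valAt (pureOp v₀) := by
    refine IsGreatest.csSup_eq ⟨⟨_, isDensity_pureOp hv₀, rfl⟩, ?_⟩
    rintro _ ⟨σ, hσ, rfl⟩
    exact hle σ hσ
  refine ⟨v₀, hv₀, hval.symm, fun σ hσ => ?_⟩
  rw [hval]
  exact hle σ hσ

end QSAT

/-! ### Blocks of the state register -/

section Parallel

variable {ι κ A R : Type} [Fintype ι] [DecidableEq ι] [Fintype κ] [DecidableEq κ]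
  [Fintype A] [DecidableEq A] [Fintype R] [DecidableEq R]

theorem Blocks.comp {e : ι → A → R} (he : Blocks e) {f : κ → ι} (hf : f.Injective) :
    Blocks fun j => e (f j) := by
  intro p q h
  have := he (a₁ := (f p.1, p.2)) (a₂ := (f q.1, q.2)) h
  exact Prod.ext (hf (Prod.ext_iff.1 this).1) (Prod.ext_iff.1 this).2

/-- A parallel operator on some of the blocks is a parallel operator on all blocks. -/
theorem par_comp {e : ι → A → R} (he : Blocks e) {f : κ → ι} (hf : f.Injective) (M : ι → Op A)
    (h1 : ∀ i, (∀ j, f j ≠ i) → M i = 1) : par (fun j => e (f j)) (fun j => M (f j)) = par e M := by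
  have hef := he.comp hf
  have h2 := list_prod_lift hef (fun j => M (f j)) Finset.univ.toList (Finset.nodup_toList _)
  have h3 := list_prod_lift he M (Finset.univ.toList.map f)
    ((Finset.nodup_toList _).map hf)
  rw [List.map_map] at h3
  have h4 : (par e fun i => if i ∈ Finset.univ.toList.map f then M i else 1) = par e M := by
    refine par_congr e fun i => ?_
    split_ifs with h
    · rfl
    · refine (h1 i fun j hj => h ?_).symm
      exact List.mem_map.2 ⟨j, Finset.mem_toList.2 (Finset.mem_univ _), hj⟩
  have h5 : (par (fun j => e (f j)) fun j => if j ∈ Finset.univ.toList then M (f j) else 1) =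
      par (fun j => e (f j)) fun j => M (f j) :=
    par_congr _ fun j => if_pos (Finset.mem_toList.2 (Finset.mem_univ _))
  rw [← h4, ← h3, ← h5, ← h2]
  rfl

theorem par_eq_zero {e : ι → A → R} {M : ι → Op A} {i : ι} (h : M i = 0) : par e M = 0 := by
  ext x y
  rw [par_apply, Finset.prod_eq_zero (Finset.mem_univ i), ite_self]
  · rfl
  · rw [h]; rfl

theorem par_smul (e : ι → A → R) (c : ι → ℂ) (M : ι → Op A) :
    par e (fun i => c i • M i) = (∏ i, c i) • par e M := by
  ext x y
  rw [Matrix.smul_apply, par_apply, par_apply, smul_eq_mul, mul_ite, mul_zero,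
    ← Finset.prod_mul_distrib]
  rfl

theorem par_diagonal (e : ι → A → R) (d : ι → (A → ZMod 2) → ℂ) :
    par e (fun i => Matrix.diagonal (d i)) = Matrix.diagonal fun x => ∏ i, d i (x ∘ e i) := by
  have h : tensor (fun i => Matrix.diagonal (d i)) =
      (Matrix.diagonal fun x => ∏ i, d i fun a => x (i, a) : Op (ι × A)) := by
    ext x y
    simp only [tensor, Matrix.of_apply, Matrix.diagonal_apply]
    by_cases hxy : x = y
    · subst hxy
      simp only [if_true]
    · rw [if_neg hxy]
      have : ∃ i, (fun a => x (i, a)) ≠ fun a => y (i, a) := by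
        by_contra! h
        exact hxy (funext fun p => congrFun (h p.1) p.2)
      obtain ⟨i, hi⟩ := this
      exact Finset.prod_eq_zero (Finset.mem_univ i) (if_neg hi)
  rw [par, h, lift_diagonal]
  rfl

theorem par_eq_list_prod {e : ι → A → R} (he : Blocks e) (M : ι → Op A) :
    par e M = ((Finset.univ.toList).map fun i => lift (e i) (M i)).reverse.prod := by
  rw [list_reverse_prod_lift he M _ (Finset.nodup_toList _)]
  exact par_congr e fun i => (if_pos (Finset.mem_toList.2 (Finset.mem_univ _))).symm

theorem semiconj_list_prod {M : Type} [Monoid M] {α : Type} {J : M} {f g : α → M} {l : List α}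
    (h : ∀ a ∈ l, SemiconjBy J (f a) (g a)) :
    SemiconjBy J (l.map f).reverse.prod (l.map g).reverse.prod := by
  induction l with
  | nil => simp
  | cons a l ih =>
    simp only [List.map_cons, List.reverse_cons, List.prod_append, List.prod_singleton]
    exact (ih fun b hb => h b (List.mem_cons_of_mem _ hb)).mul_right (h a List.mem_cons_self)

/-- Layers of gates which do not share a block act in parallel. -/
theorem layers_prod_univ {e : ι → A → R} (he : Blocks e) (gs : List (Gate A)) {l : List ι}
    (hl : l.Nodup) (hmem : ∀ i, i ∈ l) :
    (gs.map fun g => opOf (l.map fun i => g.map (e i))).reverse.prod =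
      par e fun _ => opOf gs := by
  rw [layers_prod he gs l hl]
  exact par_congr e fun i => if_pos (hmem i)

theorem opOf_layer_univ {e : ι → A → R} (he : Blocks e) (g : Gate A) {l : List ι}
    (hl : l.Nodup) (hmem : ∀ i, i ∈ l) :
    opOf (l.map fun i => g.map (e i)) = par e fun _ => g.op := by
  rw [opOf_layer he g l hl]
  exact par_congr e fun i => if_pos (hmem i)

end Parallel

/-- The labels of the `N`-qubit blocks of the state register. -/
inductive Lbl (n γ l : ℕ) : Type
  | data (u : Fin n)
  | otpX (u : Fin n)
  | otpZ (u : Fin n)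
  | idx (j : Fin l)
  | midx (j : Fin l)
  | magic (r : Fin γ)
  | anc (r : Fin γ)
  deriving DecidableEq, Fintype

/-- The qubits of a block. -/
def blk {n k γ l : ℕ} : Lbl n γ l → Blk → StQ n k γ l
  | .data u => .data u
  | .otpX u => .otpX u
  | .otpZ u => .otpZ u
  | .idx j => .idx j
  | .midx j => .midx j
  | .magic r => .magic r
  | .anc r => .anc r

theorem blocks_blk {n k γ l : ℕ} : Blocks (blk : Lbl n γ l → Blk → StQ n k γ l) := by
  rintro ⟨i, a⟩ ⟨j, b⟩ h
  cases i <;> cases j <;> simp_all [blk]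

/-- The first qubits of the blocks in `s`. -/
def firstQ {n k γ l : ℕ} (s : Finset (Lbl n γ l)) : Set (StQ n k γ l) := {q | ∃ i ∈ s, blk i 0 = q}

/-- The syndrome qubits. -/
def chkQ {n k γ l : ℕ} : Set (StQ n k γ l) := {q | ∃ s τ w, .chk s τ w = q}

section Regions

variable {n k γ l : ℕ} {s t : Finset (Lbl n γ l)}

theorem firstQ_subset : (firstQ s : Set (StQ n k γ l)) ⊆ blockQ blk s := by
  rintro _ ⟨i, hi, rfl⟩
  exact ⟨i, hi, 0, rfl⟩

theorem disjoint_blockQ (h : Disjoint s t) :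
    Disjoint (blockQ blk s : Set (StQ n k γ l)) (blockQ blk t) := by
  rw [Set.disjoint_left]
  rintro _ ⟨i, hi, q, rfl⟩ ⟨j, hj, q', h'⟩
  rcases eq_or_ne j i with rfl | hij
  · exact (Finset.disjoint_left.1 h hi) hj
  · exact blocks_blk.ne hij _ _ h'

theorem disjoint_firstQ_tailQ : Disjoint (firstQ s : Set (StQ n k γ l)) (tailQ blk t) := by
  rw [Set.disjoint_left]
  rintro _ ⟨i, hi, rfl⟩ ⟨j, hj, q', h0, h'⟩
  rcases eq_or_ne j i with rfl | hij
  · exact h0 (blocks_blk.injective _ h')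
  · exact blocks_blk.ne hij _ _ h'

theorem disjoint_chkQ : Disjoint (blockQ blk s : Set (StQ n k γ l)) chkQ := by
  rw [Set.disjoint_left]
  rintro _ ⟨i, hi, q, rfl⟩ ⟨a, b, c, h⟩
  cases i <;> cases h

theorem blockQ_mono (h : s ⊆ t) : (blockQ blk s : Set (StQ n k γ l)) ⊆ blockQ blk t := by
  rintro _ ⟨i, hi, q, rfl⟩
  exact ⟨i, h hi, q, rfl⟩

theorem isoOn_union (h : Disjoint s t) :
    (isoOn blk (s ∪ t) : Op (StQ n k γ l)) = isoOn blk s * isoOn blk t := by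
  rw [isoOn, isoOn, isoOn, ← par_mul blocks_blk]
  refine par_congr _ fun i => ?_
  simp only [Pi.mul_apply, Finset.mem_union]
  by_cases h1 : i ∈ s
  · rw [if_pos (Or.inl h1), if_pos h1, if_neg (Finset.disjoint_left.1 h h1), mul_one]
  · by_cases h2 : i ∈ t
    · rw [if_pos (Or.inr h2), if_neg h1, if_pos h2, one_mul]
    · rw [if_neg (by tauto), if_neg h1, if_neg h2, one_mul]

end Regions

/-! ### Projections onto the indices -/

/-- The projection onto the logical basis state `b`. -/
def codeProj (b : ZMod 2) : Op Blk :=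
  Matrix.of fun x y => encAmp 5 b x * star (encAmp 5 b y)

/-- The projection onto the value `b` of the qubit `q`. -/
def valProj {R : Type} [Fintype R] [DecidableEq R] (q : R) (b : ZMod 2) : Op R :=
  Matrix.diagonal fun x => if x q = b then 1 else 0

theorem encIso_conjTranspose_mul_self : encIsoᴴ * encIso = zeroProj {q : Blk | q ≠ 0} := by
  rw [encIso, Matrix.conjTranspose_mul, zeroProj_conjTranspose, mul_assoc, ← mul_assoc _ (opOf uEnc),
    ← Matrix.star_eq_conjTranspose, (Unitary.mem_iff.1 uEnc_unitary).1, one_mul, zeroProj_mul_self]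

theorem encIso_mul_zeroProj : encIso * zeroProj {q : Blk | q ≠ 0} = encIso := by
  rw [encIso, mul_assoc, zeroProj_mul_self]

theorem valProj_commute_zeroProj {R : Type} [Fintype R] [DecidableEq R] (q : R) (b : ZMod 2)
    (S : Set R) : Commute (valProj q b) (zeroProj S) := by
  rw [Commute, SemiconjBy, valProj, zeroProj, Matrix.diagonal_mul_diagonal,
    Matrix.diagonal_mul_diagonal]
  simp only [mul_comm]

/-- The operator `|F b⟩⟨F b|` in terms of an operator `J` which maps `|b⟩|0⟩` to `F b` and vanishes
on all other basis states. -/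
theorem isometry_mul_valProj_mul {J : Op Blk} {F : ZMod 2 → (Blk → ZMod 2) → ℂ}
    (h0 : ∀ x z, (∃ q, q ≠ 0 ∧ z q ≠ 0) → J x z = 0)
    (h1 : ∀ x z, (∀ q, q ≠ 0 → z q = 0) → J x z = F (z 0) x) (b : ZMod 2) :
    (Matrix.of fun x y => F b x * star (F b y)) = J * valProj 0 b * Jᴴ := by
  classical
  ext x y
  rw [Matrix.mul_apply, Matrix.of_apply,
    Finset.sum_eq_single (Function.update (0 : Blk → ZMod 2) 0 b)]
  · have hz : ∀ q : Blk, q ≠ 0 → Function.update (0 : Blk → ZMod 2) 0 b q = 0 :=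
      fun q hq => Function.update_of_ne hq _ _
    rw [valProj, Matrix.mul_diagonal, Matrix.conjTranspose_apply, h1 x _ hz, h1 y _ hz,
      Function.update_self, if_pos rfl, mul_one]
  · intro z _ hz
    rw [valProj, Matrix.mul_diagonal]
    split_ifs with h2
    · rw [h0 x z, zero_mul, zero_mul]
      by_contra! h3
      refine absurd (funext fun q => ?_) hz
      rcases eq_or_ne q 0 with rfl | hq
      · rw [Function.update_self, h2]
      · rw [Function.update_of_ne hq, h3 q hq]; rfl
    · rw [mul_zero, zero_mul]
  · exact fun h => absurd (Finset.mem_univ _) h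

theorem codeProj_eq (b : ZMod 2) : codeProj b = encIso * valProj 0 b * encIsoᴴ := by
  refine isometry_mul_valProj_mul (J := encIso) (F := encAmp 5) ?_ ?_ b
  · rintro x z ⟨q, hq, hz⟩
    rw [encIso_apply x z, if_neg fun h => hz (h q hq)]
  · intro x z h
    rw [encIso_apply x z, if_pos h]

theorem codeProj_mul_encIso (b : ZMod 2) : codeProj b * encIso = encIso * valProj 0 b := by
  rw [codeProj_eq, mul_assoc, encIso_conjTranspose_mul_self, mul_assoc,
    (valProj_commute_zeroProj _ _ _).eq, ← mul_assoc, encIso_mul_zeroProj]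

theorem valProj_mul {R : Type} [Fintype R] [DecidableEq R] (q : R) (b b' : ZMod 2) :
    valProj q b * valProj q b' = if b = b' then valProj q b else 0 := by
  rw [valProj, valProj, Matrix.diagonal_mul_diagonal]
  split_ifs with h
  · subst h
    refine congrArg _ (funext fun x => ?_)
    split_ifs <;> simp
  · rw [← Matrix.diagonal_zero]
    refine congrArg _ (funext fun x => ?_)
    split_ifs with h1 h2
    · exact absurd (h1.symm.trans h2) h
    all_goals simp

theorem codeProj_mul (b b' : ZMod 2) :
    codeProj b * codeProj b' = if b = b' then codeProj b else 0 := by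
  rw [codeProj_eq b', ← mul_assoc, ← mul_assoc, codeProj_mul_encIso, mul_assoc encIso, valProj_mul]
  split_ifs
  · rw [codeProj_eq]
  · rw [mul_zero, zero_mul]

theorem codeProj_conjTranspose (b : ZMod 2) : (codeProj b)ᴴ = codeProj b := by
  ext x y
  rw [Matrix.conjTranspose_apply, codeProj, Matrix.of_apply, Matrix.of_apply, star_mul', star_star,
    mul_comm]

/-- The blocks of the index register. -/
def idxS (n γ l : ℕ) : Finset (Lbl n γ l) := Finset.univ.image .idx

/-- The blocks of the copy of the index register. -/
def midxS (n γ l : ℕ) : Finset (Lbl n γ l) := Finset.univ.image .midx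

/-- The blocks used by the encoded circuits as workspace. -/
def workS (n γ l : ℕ) : Finset (Lbl n γ l) := Finset.univ.image .magic ∪ Finset.univ.image .anc

/-- The blocks of the witness. -/
def witS (n γ l : ℕ) : Finset (Lbl n γ l) :=
  Finset.univ.image .data ∪ Finset.univ.image .otpX ∪ Finset.univ.image .otpZ

namespace QSAT

variable {k γ : ℕ} (I : QSAT k γ)

/-- The family of one-block operators which is `M j` on the `j`-th index block. -/
def onIdx {A : Type} [Fintype A] [DecidableEq A] (M : Fin I.logm → Op A) :
    Lbl I.n γ I.logm → Op A
  | .idx j => M j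
  | _ => 1

/-- The projection onto `|Enc(i)⟩` is the tensor product of projections onto the encoded bits of
`i`. -/
theorem idxProj_eq (i : Fin I.m) :
    I.idxProj i = par blk (I.onIdx fun j => codeProj (I.idxBit i j)) := by
  rw [← par_comp blocks_blk (f := Lbl.idx) (fun _ _ h => Lbl.idx.inj h)]
  · ext x y
    rw [par_apply]
    simp only [idxProj, Matrix.of_apply, onIdx, codeProj, Finset.prod_mul_distrib, star_prod]
    have hp : (∀ q : I.St, (∀ j w, q ≠ .idx j w) → x q = y q) ↔
        ∀ q : I.St, (∀ j w, blk (.idx j) w ≠ q) → x q = y q :=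
      forall_congr' fun q => imp_congr_left (forall₂_congr fun j w => ne_comm)
    by_cases h : ∀ q : I.St, (∀ j w, q ≠ .idx j w) → x q = y q
    · rw [if_pos h, if_pos (hp.1 h)]
      rfl
    · rw [if_neg h, if_neg fun h' => h (hp.2 h')]
  · rintro (u | u | u | j | j | r | r) h
    all_goals first | rfl | exact absurd rfl (h _)

theorem idxProj_mem_loc (i : Fin I.m) : I.idxProj i ∈ loc (blockQ blk (idxS I.n γ I.logm)) := by
  rw [idxProj_eq]
  refine par_mem_loc blocks_blk (T := fun l => {q | l ∈ idxS I.n γ I.logm}) ?_ ?_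
  · rintro (u | u | u | j | j | r | r)
    all_goals first
      | exact one_mem_loc _
      | skip
    have : {q : Blk | Lbl.idx j ∈ idxS I.n γ I.logm} = Set.univ := by
      simp [idxS]
    rw [this]
    exact mem_loc_univ _
  · exact fun i a ha => ⟨i, ha, a, rfl⟩

theorem idxProj_conjTranspose (i : Fin I.m) : (I.idxProj i)ᴴ = I.idxProj i := by
  rw [idxProj_eq, par_conjTranspose]
  refine par_congr _ ?_
  rintro (u | u | u | j | j | r | r)
  all_goals first
    | exact Matrix.conjTranspose_one
    | exact codeProj_conjTranspose _

/-- As `m` is a power of two, indices correspond to the strings of `log m` bits. -/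
theorem idxBit_bijective (hm : ∃ l, I.m = 2 ^ l) :
    Function.Bijective fun i : Fin I.m => fun j => I.idxBit i j := by
  obtain ⟨l, hl⟩ := hm
  have hlog : I.logm = l := by rw [logm, hl, Nat.log_pow (by norm_num)]
  rw [Fintype.bijective_iff_injective_and_card]
  constructor
  · intro a b h
    refine Fin.ext (Nat.eq_of_testBit_eq fun j => ?_)
    by_cases hj : j < I.logm
    · have := congrFun h ⟨j, hj⟩
      simp only [idxBit] at this
      by_cases h1 : a.val.testBit j <;> by_cases h2 : b.val.testBit j <;> simp_all
    · rw [Nat.testBit_lt_two_pow, Nat.testBit_lt_two_pow]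
      · exact lt_of_lt_of_le b.2 (hl ▸ Nat.pow_le_pow_right (by norm_num) (by omega))
      · exact lt_of_lt_of_le a.2 (hl ▸ Nat.pow_le_pow_right (by norm_num) (by omega))
  · rw [Fintype.card_fin, Fintype.card_fun, Fintype.card_fin, ZMod.card, hlog, hl]

/-- The `|Enc(i)⟩` are orthonormal. -/
theorem idxProj_mul (hm : ∃ l, I.m = 2 ^ l) (i j : Fin I.m) :
    I.idxProj i * I.idxProj j = if i = j then I.idxProj i else 0 := by
  rw [idxProj_eq, idxProj_eq, ← par_mul blocks_blk]
  split_ifs with h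
  · subst h
    refine par_congr _ fun a => ?_
    simp only [Pi.mul_apply]
    cases a with
    | idx j => exact (codeProj_mul _ _).trans (if_pos rfl)
    | _ => exact one_mul _
  · obtain ⟨a, ha⟩ : ∃ a, I.idxBit i a ≠ I.idxBit j a := by
      by_contra! hab
      exact h ((I.idxBit_bijective hm).1 (funext hab))
    refine par_eq_zero (i := .idx a) ?_
    exact (codeProj_mul _ _).trans (if_neg ha)

/-- On encoded index blocks the projection onto `|Enc(i)⟩` tests the first qubits before
encoding. -/
theorem idxProj_mul_isoOn (i : Fin I.m) {s : Finset (Lbl I.n γ I.logm)}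
    (hs : idxS I.n γ I.logm ⊆ s) :
    I.idxProj i * isoOn blk s =
      isoOn blk s * par blk (I.onIdx fun j => valProj 0 (I.idxBit i j)) := by
  rw [idxProj_eq, isoOn, ← par_mul blocks_blk, ← par_mul blocks_blk]
  refine par_congr _ fun a => ?_
  simp only [Pi.mul_apply]
  cases a with
  | idx j =>
    rw [if_pos (hs (by simp [idxS]))]
    exact codeProj_mul_encIso _
  | _ => exact (one_mul _).trans (mul_one _).symm

theorem onIdx_valProj_eq_diagonal (b : Fin I.logm → ZMod 2) :
    (par blk (I.onIdx fun j => valProj 0 (b j)) : Op I.St) =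
      Matrix.diagonal fun x => ∏ j, if x (.idx j 0) = b j then 1 else 0 := by
  rw [← par_comp blocks_blk (f := Lbl.idx) (fun _ _ h => Lbl.idx.inj h)]
  · exact par_diagonal _ _
  · intro a h
    cases a with
    | idx j => exact absurd rfl (h j)
    | _ => rfl

/-- The projections onto the bit strings of the indices form a complete family. -/
theorem sum_onIdx_valProj (hm : ∃ l, I.m = 2 ^ l) :
    ∑ i, (par blk (I.onIdx fun j => valProj 0 (I.idxBit i j)) : Op I.St) = 1 := by
  simp only [onIdx_valProj_eq_diagonal]
  ext x y
  rw [Matrix.sum_apply]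
  by_cases h : x = y
  · subst h
    simp only [Matrix.diagonal_apply_eq, Matrix.one_apply_eq]
    obtain ⟨i, hi⟩ := (I.idxBit_bijective hm).2 fun j => x (.idx j 0)
    rw [Finset.sum_eq_single i]
    · exact Finset.prod_eq_one fun j _ => if_pos (congrFun hi j).symm
    · intro i' _ hne
      obtain ⟨j, hj⟩ : ∃ j, x (.idx j 0) ≠ I.idxBit i' j := by
        by_contra! hab
        exact hne ((I.idxBit_bijective hm).1 ((funext fun j => (hab j).symm).trans hi.symm))
      exact Finset.prod_eq_zero (Finset.mem_univ j) (if_neg hj)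
    · exact fun h => absurd (Finset.mem_univ _) h
  · rw [Matrix.one_apply_ne h]
    exact Finset.sum_eq_zero fun i _ => Matrix.diagonal_apply_ne _ h

end QSAT

/-! ### Controlled operators -/

section Select

variable {M α : Type} [Ring M] [Fintype α] [DecidableEq α] {p A B : α → M}

/-- The operator which acts as `A i` on the range of the projection `p i` and trivially on the
common kernel of the projections. -/
def controlled (p A : α → M) : M := ∑ i, A i * p i + (1 - ∑ i, p i)

theorem mul_sum_orthogonal (hp : ∀ i j, p i * p j = if i = j then p i else 0) (i : α) :
    p i * ∑ j, p j = p i := by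
  simp only [Finset.mul_sum, hp]
  rw [Finset.sum_ite_eq, if_pos (Finset.mem_univ i)]

theorem sum_orthogonal_mul (hp : ∀ i j, p i * p j = if i = j then p i else 0) (j : α) :
    (∑ i, p i) * p j = p j := by
  simp only [Finset.sum_mul, hp]
  rw [Finset.sum_ite_eq', if_pos (Finset.mem_univ j)]

/-- On the range of `p i` a controlled operator is `A i`. -/
theorem proj_mul_controlled (hp : ∀ i j, p i * p j = if i = j then p i else 0)
    (hA : ∀ i j, Commute (A i) (p j)) (i : α) : p i * controlled p A = A i * p i := by
  rw [controlled, mul_add, mul_sub, mul_one, mul_sum_orthogonal hp, sub_self, add_zero,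
    Finset.mul_sum]
  have : ∀ j, p i * (A j * p j) = if i = j then A j * p j else 0 := fun j => by
    rw [← mul_assoc, ← (hA j i).eq, mul_assoc, hp]
    split_ifs with h
    · rw [h]
    · rw [mul_zero]
  simp only [this]
  rw [Finset.sum_ite_eq, if_pos (Finset.mem_univ i)]

/-- Controlled operators multiply componentwise if they commute with the control. -/
theorem controlled_mul (hp : ∀ i j, p i * p j = if i = j then p i else 0)
    (hB : ∀ i j, Commute (B i) (p j)) :
    controlled p A * controlled p B = controlled p (A * B) := by
  have h1 : ∀ i, A i * p i * controlled p B = A i * B i * p i := fun i => by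
    rw [mul_assoc, proj_mul_controlled hp hB, mul_assoc]
  have h2 : (1 - ∑ i, p i) * controlled p B = 1 - ∑ i, p i := by
    rw [sub_mul, one_mul, Finset.sum_mul]
    simp only [proj_mul_controlled hp hB]
    rw [controlled, add_sub_cancel_left]
  rw [controlled, add_mul, Finset.sum_mul, h2]
  simp only [h1]
  rfl

theorem controlled_one : controlled p 1 = 1 := by
  simp [controlled]

end Select

section Operators

variable {R α : Type} [Fintype R] [DecidableEq R] [Fintype α] [DecidableEq α]

theorem controlled_mem_unitary {p A : α → Op R}
    (hp : ∀ i j, p i * p j = if i = j then p i else 0) (hs : ∀ i, (p i)ᴴ = p i)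
    (hA : ∀ i j, Commute (A i) (p j)) (hu : ∀ i, A i ∈ unitary (Op R)) :
    controlled p A ∈ unitary (Op R) := by
  have hA' : ∀ i j, Commute (A i)ᴴ (p j) := fun i j => by
    have := congrArg Matrix.conjTranspose (hA i j).eq
    rw [Matrix.conjTranspose_mul, Matrix.conjTranspose_mul, hs] at this
    exact this.symm
  have hstar : star (controlled p A) = controlled p fun i => (A i)ᴴ := by
    rw [Matrix.star_eq_conjTranspose, controlled, controlled, Matrix.conjTranspose_add,
      Matrix.conjTranspose_sub, Matrix.conjTranspose_one, Matrix.conjTranspose_sum,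
      Matrix.conjTranspose_sum]
    simp only [Matrix.conjTranspose_mul, hs, fun i => (hA' i i).eq]
  rw [Unitary.mem_iff, hstar, controlled_mul hp hA, controlled_mul hp hA']
  constructor
  · rw [← controlled_one (p := p)]
    exact congrArg _ (funext fun i => (Unitary.mem_iff.1 (hu i)).1)
  · rw [← controlled_one (p := p)]
    exact congrArg _ (funext fun i => (Unitary.mem_iff.1 (hu i)).2)

/-- On the range of `p i` a sequence of controlled circuits runs the `i`-th circuits. -/
theorem proj_mul_controlled_prod {p : α → Op R}
    (hp : ∀ i j, p i * p j = if i = j then p i else 0) {L : List (α → List (Gate R))}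
    (hL : ∀ W ∈ L, ∀ i j, Commute (opOf (W i)) (p j)) (i : α) :
    p i * (L.map fun W => controlled p fun j => opOf (W j)).reverse.prod =
      opOf (L.flatMap fun W => W i) * p i := by
  induction L with
  | nil => simp [opOf]
  | cons W L ih =>
    simp only [List.map_cons, List.reverse_cons, List.prod_append, List.prod_singleton,
      List.flatMap_cons, opOf_append]
    rw [← mul_assoc, ih fun W' h => hL W' (List.mem_cons_of_mem _ h), mul_assoc,
      proj_mul_controlled hp (hL W List.mem_cons_self), mul_assoc]

/-- Pythagoras' theorem for a complete family of orthogonal projections. -/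
theorem nsq_eq_sum_proj {p : α → Op R} (hp : ∀ i, p i * p i = p i) (hs : ∀ i, (p i)ᴴ = p i)
    {y : (R → ZMod 2) → ℂ} (hy : (∑ i, p i) *ᵥ y = y) : nsq y = ∑ i, nsq (p i *ᵥ y) := by
  have h : ((nsq y : ℝ) : ℂ) = ((∑ i, nsq (p i *ᵥ y) : ℝ) : ℂ) := by
    have h1 : star y ⬝ᵥ y = star y ⬝ᵥ ((∑ i, p i) *ᵥ y) := by rw [hy]
    rw [← star_dotProduct_self, h1, Matrix.sum_mulVec, dotProduct_sum, Complex.ofReal_sum]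
    refine Finset.sum_congr rfl fun i _ => ?_
    rw [← star_dotProduct_self, Matrix.star_mulVec, hs, ← Matrix.dotProduct_mulVec,
      Matrix.mulVec_mulVec, hp]
  exact_mod_cast h

theorem nsq_zeroProj_le (S : Set R) (v : (R → ZMod 2) → ℂ) : nsq (zeroProj S *ᵥ v) ≤ nsq v := by
  refine Finset.sum_le_sum fun x _ => ?_
  rw [zeroProj, Matrix.mulVec_diagonal]
  split_ifs
  · rw [one_mul]
  · rw [zero_mul, norm_zero, zero_pow two_ne_zero]
    positivity

theorem zeroProj_mul_of_subset {S T : Set R} (h : S ⊆ T) :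
    zeroProj S * zeroProj T = zeroProj T := by
  rw [zeroProj_mul, Set.union_eq_self_of_subset_left h]

end Operators

section ParallelSemiconj

variable {ι A B R : Type} [Fintype ι] [DecidableEq ι] [Fintype A] [DecidableEq A] [Fintype B]
  [DecidableEq B] [Fintype R] [DecidableEq R]

theorem par_eq_par {e : ι → A → R} {e' : ι → B → R} (he : Blocks e) (he' : Blocks e')
    {M : ι → Op A} {M' : ι → Op B} (h : ∀ i, lift (e i) (M i) = lift (e' i) (M' i)) :
    par e M = par e' M' := by
  rw [par_eq_list_prod he, par_eq_list_prod he', funext h]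

/-- Parallel operators are intertwined if their factors are. -/
theorem par_semiconj {e : ι → A → R} {e' : ι → B → R} (he : Blocks e) (he' : Blocks e') {J : Op R}
    {M : ι → Op A} {M' : ι → Op B} (h : ∀ i, SemiconjBy J (lift (e i) (M i)) (lift (e' i) (M' i))) :
    SemiconjBy J (par e M) (par e' M') := by
  rw [par_eq_list_prod he, par_eq_list_prod he']
  exact semiconj_list_prod fun i _ => h i

end ParallelSemiconj

/-! ### Preparing the index register -/

/-- The translation of two qubits by `(b, b)`. -/
def shiftOp (b : ZMod 2) : Op (Unit ⊕ Unit) :=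
  Matrix.of fun x y => if y = fun a => x a + b then 1 else 0

theorem shiftOp_mulVec (b : ZMod 2) (v : (Unit ⊕ Unit → ZMod 2) → ℂ) (x : Unit ⊕ Unit → ZMod 2) :
    (shiftOp b *ᵥ v) x = v fun a => x a + b := by
  simp [shiftOp, Matrix.mulVec, dotProduct]

theorem shiftOp_mem_unitary (b : ZMod 2) : shiftOp b ∈ unitary (Op (Unit ⊕ Unit)) := by
  have hb : b + b = 0 := CharTwo.add_self_eq_zero b
  refine mem_unitary_of_involutive ?_ fun v x => ?_
  · ext x y
    rw [Matrix.conjTranspose_apply, shiftOp, Matrix.of_apply, Matrix.of_apply,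
      apply_ite star, star_one, star_zero]
    refine if_congr ?_ rfl rfl
    constructor <;>
    · rintro rfl
      funext a
      rw [add_assoc, hb, add_zero]
  · rw [shiftOp_mulVec, shiftOp_mulVec]
    congr 1
    funext a
    rw [add_assoc, hb, add_zero]

/-- Measuring `b` on one half of a Bell pair. -/
theorem valProj_mul_bell (b : ZMod 2) :
    valProj (Sum.inl ()) b * ((Gate.cnot (Sum.inl ()) (Sum.inr ())).op *
      ((Gate.H (Sum.inl () : Unit ⊕ Unit)).op * zeroProj Set.univ)) =
      had 0 0 • (shiftOp b * zeroProj Set.univ) := by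
  classical
  rw [← mul_assoc, ← mul_assoc, ← Matrix.smul_mul]
  ext x z
  rw [zeroProj, Matrix.mul_diagonal, Matrix.mul_diagonal]
  by_cases hz : ∀ q ∈ (Set.univ : Set (Unit ⊕ Unit)), z q = 0
  swap
  · rw [if_neg hz, mul_zero, mul_zero]
  have hz' : z = 0 := funext fun q => hz q (Set.mem_univ q)
  subst hz'
  rw [mul_H_apply _ (Sum.inl ()) x 0, Matrix.smul_apply]
  have hfun : ∀ u w : Unit ⊕ Unit → ZMod 2,
      u = w ↔ u (Sum.inl ()) = w (Sum.inl ()) ∧ u (Sum.inr ()) = w (Sum.inr ()) := fun u w =>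
    ⟨fun h => by rw [h]; exact ⟨rfl, rfl⟩, fun h => funext fun a => by
      rcases a with ⟨⟩ | ⟨⟩
      exacts [h.1, h.2]⟩
  simp only [mul_cnot_apply (valProj (Sum.inl ()) b), zmod_two_sum]
  simp only [valProj, shiftOp, Matrix.of_apply, Matrix.diagonal_apply, hfun, had]
  rcases zmod_two_eq (x (Sum.inl ())) with h1 | h1 <;>
    rcases zmod_two_eq (x (Sum.inr ())) with h2 | h2 <;>
    rcases zmod_two_eq b with h3 | h3 <;>
    simp [h1, h2, h3, CharTwo.add_self_eq_zero (1 : ZMod 2)]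

namespace QSAT

variable {k γ : ℕ} (I : QSAT k γ)

theorem blocks : Blocks (blk : Lbl I.n γ I.logm → Blk → I.St) := blocks_blk

/-- The preparation of the magic states. -/
def magicPrep : Op I.St :=
  par (fun r (_ : Unit) => (.magic r 0 : I.St)) fun _ => (Gate.T ()).op * (Gate.H ()).op

/-- The first qubits of the `j`-th blocks of the two index registers. -/
def idxPair (j : Fin I.logm) : Unit ⊕ Unit → I.St :=
  Sum.elim (fun _ => .idx j 0) fun _ => .midx j 0

/-- The blocks of both index registers. -/
def idxRegS : Finset (Lbl I.n γ I.logm) := idxS I.n γ I.logm ∪ midxS I.n γ I.logm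

theorem blocks_magic : Blocks fun r (_ : Unit) => (.magic r 0 : I.St) := by
  rintro ⟨r, _⟩ ⟨r', _⟩ h
  simp_all

theorem blocks_idx : Blocks fun j => (blk (.idx j) : Blk → I.St) := by
  rintro ⟨j, w⟩ ⟨j', w'⟩ h
  have h' : (StQ.idx j w : I.St) = .idx j' w' := h
  injection h' with h1 h2
  rw [h1, h2]

theorem blocks_idxPair : Blocks I.idxPair := by
  rintro ⟨j, a⟩ ⟨j', a'⟩ h
  rcases a with a | a <;> rcases a' with a' | a' <;> simp_all [idxPair]

theorem blocks_idxBlk :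
    Blocks fun j => (Sum.elim (blk (.idx j)) (blk (.midx j)) : Blk ⊕ Blk → I.St) := by
  rintro ⟨j, a⟩ ⟨j', a'⟩ h
  rcases a with a | a <;> rcases a' with a' | a' <;> simp_all [blk]

theorem stage1_prod : I.stage1.reverse.prod = I.magicPrep := by
  have h := fun g : Gate Unit =>
    opOf_layer_univ I.blocks_magic g (List.nodup_finRange γ) List.mem_finRange
  rw [magicPrep]
  have h2 := par_mul I.blocks_magic (fun _ => (Gate.T ()).op) (fun _ => (Gate.H ()).op)
  refine Eq.trans ?_ h2.symm
  rw [← h, ← h, stage1]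
  simp [Gate.map]

/-- The encoding stage applies the encoder to every block of the four registers. -/
theorem stage2_prod : I.stage2.reverse.prod =
    encOn blk (I.idxRegS ∪ workS I.n γ I.logm) := by
  have h := layers_prod I.blocks uEnc
    ((List.finRange γ).map Lbl.anc ++ (List.finRange γ).map Lbl.magic ++
      (List.finRange I.logm).map Lbl.idx ++ (List.finRange I.logm).map Lbl.midx) (by
    simp only [List.nodup_append, List.mem_append, List.mem_map, List.mem_finRange, true_and]
    refine ⟨⟨⟨?_, ?_, ?_⟩, ?_, ?_⟩, ?_, ?_⟩
    all_goals first
      | (refine List.Nodup.map ?_ (List.nodup_finRange _)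
         intro a b h
         injection h)
      | (rintro a ha b hb rfl
         aesop))
  have h3 : I.stage2 = uEnc.map fun g => opOf
      (((List.finRange γ).map Lbl.anc ++ (List.finRange γ).map Lbl.magic ++
      (List.finRange I.logm).map Lbl.idx ++ (List.finRange I.logm).map Lbl.midx).map
        fun i => g.map (blk i)) := by
    rw [stage2]
    simp only [List.map_append, List.map_map]
    rfl
  rw [h3, h, encOn]
  refine par_congr _ fun i => ?_
  refine if_congr ?_ rfl rfl
  cases i <;> simp [idxRegS, idxS, midxS, workS]

/-- The Hadamard gates on the index qubits before encoding. -/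
theorem stage3_semiconj {s : Finset (Lbl I.n γ I.logm)} (hs : idxS I.n γ I.logm ⊆ s) :
    SemiconjBy (isoOn blk s)
      (par I.idxPair fun _ => (Gate.H (Sum.inl ())).op) I.stage3.reverse.prod := by
  have h := layers_prod_univ I.blocks_idx (blkList.map Gate.H)
    (List.nodup_finRange I.logm) List.mem_finRange
  have h3 : I.stage3.reverse.prod = par (fun j => blk (.idx j)) fun _ =>
      opOf (blkList.map Gate.H) := by
    rw [← h, stage3, List.map_map]
    rfl
  rw [h3]
  refine par_semiconj I.blocks_idxPair I.blocks_idx fun j => ?_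
  rw [← Gate.op_map (I.blocks_idxPair.injective j)]
  have h4 := isoOn_semiconj I.blocks (hs (Finset.mem_image_of_mem _ (Finset.mem_univ j)))
    semiconj_H
  rw [← Gate.op_map (I.blocks.injective _)] at h4
  exact h4

/-- The `CNOT` gates between the index qubits before encoding. -/
theorem stage4_semiconj {s : Finset (Lbl I.n γ I.logm)} (hs : I.idxRegS ⊆ s) :
    SemiconjBy (isoOn blk s)
      (par I.idxPair fun _ => (Gate.cnot (Sum.inl ()) (Sum.inr ())).op) I.stage4.reverse.prod := by
  have h := layers_prod_univ I.blocks_idxBlk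
    (blkList.map fun q => Gate.cnot (Sum.inl q) (Sum.inr q))
    (List.nodup_finRange I.logm) List.mem_finRange
  have h3 : I.stage4.reverse.prod = par (fun j => Sum.elim (blk (.idx j)) (blk (.midx j))) fun _ =>
      opOf (blkList.map fun q => Gate.cnot (Sum.inl q) (Sum.inr q)) := by
    rw [← h, stage4, List.map_map]
    rfl
  rw [h3]
  refine par_semiconj I.blocks_idxPair I.blocks_idxBlk fun j => ?_
  rw [← Gate.op_map (I.blocks_idxPair.injective j)]
  have h4 := isoOn_semiconj₂ I.blocks
    (i := .idx j) (j := .midx j) (s := s)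
    (hs (by simp [idxRegS, idxS])) (hs (by simp [idxRegS, midxS]))
    (by simp) semiconj_cnot
  rw [← Gate.op_map (I.blocks_idxBlk.injective j)] at h4
  exact h4

/-- Projecting onto an encoded index is testing the index qubits before encoding. -/
theorem idxProj_semiconj (i : Fin I.m) {s : Finset (Lbl I.n γ I.logm)}
    (hs : idxS I.n γ I.logm ⊆ s) :
    SemiconjBy (isoOn blk s)
      (par I.idxPair fun j => valProj (Sum.inl ()) (I.idxBit i j)) (I.idxProj i) := by
  have h : (par I.idxPair fun j => valProj (Sum.inl ()) (I.idxBit i j)) =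
      par blk (I.onIdx fun j => valProj 0 (I.idxBit i j)) := by
    rw [onIdx_valProj_eq_diagonal]
    exact par_diagonal _ _
  rw [h]
  exact (I.idxProj_mul_isoOn i hs).symm

end QSAT

namespace QSAT

variable {k γ : ℕ} (I : QSAT k γ)

/-- The ancilla qubits. -/
def ancQ : Set I.St := {q | ancPart q ≠ none}

/-- All ancilla blocks of `N` qubits. -/
def ancS : Finset (Lbl I.n γ I.logm) := I.idxRegS ∪ workS I.n γ I.logm

/-- The unitary preparing the encoded index `i` in both index registers. -/
def idxPrep (i : Fin I.m) : Op I.St :=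
  encOn blk I.idxRegS * par I.idxPair fun j => shiftOp (I.idxBit i j)

theorem disjoint_idxRegS_workS : Disjoint I.idxRegS (workS I.n γ I.logm) := by
  rw [Finset.disjoint_left]
  intro i h
  cases i <;> simp_all [idxRegS, idxS, midxS, workS]

theorem blockQ_ancS_subset : blockQ blk I.ancS ⊆ I.ancQ := by
  rintro _ ⟨i, hi, q, rfl⟩
  cases i <;> simp_all [ancS, idxRegS, idxS, midxS, workS, ancQ, ancPart, blk]

theorem zeroProj_mul_ancQ {S : Set I.St} (h : S ⊆ I.ancQ) :
    zeroProj S * zeroProj I.ancQ = zeroProj I.ancQ := zeroProj_mul_of_subset h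

theorem magicPrep_mem_loc : I.magicPrep ∈ loc (firstQ (workS I.n γ I.logm)) := by
  refine par_mem_loc I.blocks_magic (T := fun _ => Set.univ) (fun _ => mem_loc_univ _) ?_
  exact fun r a _ => ⟨.magic r, by simp [workS], rfl⟩

theorem idxPair_par_mem_loc (M : Fin I.logm → Op (Unit ⊕ Unit)) :
    par I.idxPair M ∈ loc (firstQ I.idxRegS) := by
  refine par_mem_loc I.blocks_idxPair (T := fun _ => Set.univ) (fun _ => mem_loc_univ _) ?_
  rintro j (a | a) _
  · exact ⟨.idx j, by simp [idxRegS, idxS], rfl⟩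
  · exact ⟨.midx j, by simp [idxRegS, midxS], rfl⟩

theorem idxPrep_mem_unitary (i : Fin I.m) : I.idxPrep i ∈ unitary (Op I.St) :=
  mul_mem (encOn_mem_unitary I.blocks _)
    (par_mem_unitary I.blocks_idxPair fun _ => shiftOp_mem_unitary _)

theorem idxPrep_mem_loc (i : Fin I.m) : I.idxPrep i ∈ loc (blockQ blk I.idxRegS) :=
  mul_mem (encOn_mem_loc I.blocks _) (loc_mono firstQ_subset (I.idxPair_par_mem_loc _))

/-- The state before the checks, in terms of the logical index register. -/
theorem prep_eq : I.stage4.reverse.prod * (I.stage3.reverse.prod * (I.stage2.reverse.prod *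
    (I.stage1.reverse.prod * zeroProj I.ancQ))) =
    isoOn blk I.ancS * ((par I.idxPair fun _ => (Gate.cnot (Sum.inl ()) (Sum.inr ())).op) *
      ((par I.idxPair fun _ => (Gate.H (Sum.inl ())).op) * (I.magicPrep * zeroProj I.ancQ))) := by
  have hidx : idxS I.n γ I.logm ⊆ I.ancS :=
    Finset.subset_union_left.trans Finset.subset_union_left
  have h1 : encOn blk I.ancS * (I.magicPrep * zeroProj I.ancQ) =
      isoOn blk I.ancS * (I.magicPrep * zeroProj I.ancQ) := by
    have ht := I.zeroProj_mul_ancQ ((tailQ_subset blk I.ancS).trans I.blockQ_ancS_subset)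
    have hc : Commute I.magicPrep (zeroProj (tailQ blk I.ancS)) :=
      loc_commute disjoint_firstQ_tailQ I.magicPrep_mem_loc (zeroProj_mem_loc _)
    rw [← encOn_mul_zeroProj I.blocks, mul_assoc, ← mul_assoc (zeroProj _), ← hc.eq, mul_assoc,
      ht]
  rw [stage1_prod, stage2_prod, ← ancS, h1, ← mul_assoc I.stage3.reverse.prod,
    ← (I.stage3_semiconj hidx).eq, mul_assoc, ← mul_assoc I.stage4.reverse.prod,
    ← (I.stage4_semiconj (s := I.ancS) Finset.subset_union_left).eq, mul_assoc]

/-- After the preparation the index register lies in the span of the `|Enc(i)⟩`. -/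
theorem sum_idxProj_mul_prep (hm : ∃ l, I.m = 2 ^ l) :
    (∑ i, I.idxProj i) * (I.stage4.reverse.prod * (I.stage3.reverse.prod *
      (I.stage2.reverse.prod * (I.stage1.reverse.prod * zeroProj I.ancQ)))) =
    I.stage4.reverse.prod * (I.stage3.reverse.prod * (I.stage2.reverse.prod *
      (I.stage1.reverse.prod * zeroProj I.ancQ))) := by
  have hidx : idxS I.n γ I.logm ⊆ I.ancS :=
    Finset.subset_union_left.trans Finset.subset_union_left
  rw [prep_eq, ← mul_assoc, Finset.sum_mul,
    Finset.sum_congr rfl fun i _ => I.idxProj_mul_isoOn i hidx, ← Finset.mul_sum,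
    I.sum_onIdx_valProj hm, mul_one]

/-- For every index, the superposition over the index register contributes the same amplitude,
and the index is encoded in both index registers. -/
theorem idxProj_mul_prep (i : Fin I.m) :
    I.idxProj i * (I.stage4.reverse.prod * (I.stage3.reverse.prod * (I.stage2.reverse.prod *
      (I.stage1.reverse.prod * zeroProj I.ancQ)))) =
    had 0 0 ^ I.logm •
      (I.idxPrep i * (encOn blk (workS I.n γ I.logm) * (I.magicPrep * zeroProj I.ancQ))) := by
  have hidx : idxS I.n γ I.logm ⊆ I.ancS :=
    Finset.subset_union_left.trans Finset.subset_union_left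
  have hfirst : (firstQ I.idxRegS : Set I.St) ⊆ I.ancQ :=
    firstQ_subset.trans ((blockQ_mono Finset.subset_union_left).trans I.blockQ_ancS_subset)
  -- Each pair of index qubits is a Bell pair, half of which is measured.
  have hbell : (par I.idxPair fun j => valProj (Sum.inl ()) (I.idxBit i j)) *
      ((par I.idxPair fun _ => (Gate.cnot (Sum.inl ()) (Sum.inr ())).op) *
        ((par I.idxPair fun _ => (Gate.H (Sum.inl ())).op) *
          par I.idxPair fun _ => zeroProj Set.univ)) =
      had 0 0 ^ I.logm • ((par I.idxPair fun j => shiftOp (I.idxBit i j)) *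
        par I.idxPair fun _ => zeroProj Set.univ) := by
    rw [← par_mul I.blocks_idxPair, ← par_mul I.blocks_idxPair, ← par_mul I.blocks_idxPair,
      ← par_mul I.blocks_idxPair]
    have hc : had 0 0 ^ I.logm = ∏ _j : Fin I.logm, had 0 0 := by
      rw [Finset.prod_const, Finset.card_univ, Fintype.card_fin]
    rw [hc, ← par_smul]
    exact par_congr _ fun j => valProj_mul_bell _
  have hZ : (par I.idxPair fun _ => zeroProj Set.univ) * (I.magicPrep * zeroProj I.ancQ) =
      I.magicPrep * zeroProj I.ancQ := by
    have hloc : (par I.idxPair fun _ => zeroProj Set.univ) ∈ loc (firstQ I.idxRegS) :=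
      I.idxPair_par_mem_loc _
    have hdis : Disjoint (firstQ I.idxRegS : Set I.St) (firstQ (workS I.n γ I.logm)) :=
      (disjoint_blockQ I.disjoint_idxRegS_workS).mono firstQ_subset firstQ_subset
    rw [← mul_assoc, (loc_commute hdis hloc I.magicPrep_mem_loc).eq, mul_assoc, par_zeroProj,
      I.zeroProj_mul_ancQ]
    rintro _ ⟨j, a | a, _, rfl⟩
    · exact hfirst ⟨.idx j, by simp [idxRegS, idxS], rfl⟩
    · exact hfirst ⟨.midx j, by simp [idxRegS, midxS], rfl⟩
  have h2 : isoOn blk I.ancS * ((par I.idxPair fun j => shiftOp (I.idxBit i j)) *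
      (I.magicPrep * zeroProj I.ancQ)) =
      I.idxPrep i * (encOn blk (workS I.n γ I.logm) * (I.magicPrep * zeroProj I.ancQ)) := by
    have ht := I.zeroProj_mul_ancQ ((tailQ_subset blk I.ancS).trans I.blockQ_ancS_subset)
    have hc : Commute I.magicPrep (zeroProj (tailQ blk I.ancS)) :=
      loc_commute disjoint_firstQ_tailQ I.magicPrep_mem_loc (zeroProj_mem_loc _)
    have hc2 : Commute (par I.idxPair fun j => shiftOp (I.idxBit i j))
        (zeroProj (tailQ blk I.ancS)) :=
      loc_commute disjoint_firstQ_tailQ (I.idxPair_par_mem_loc _) (zeroProj_mem_loc _)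
    have hc3 : Commute (encOn blk (workS I.n γ I.logm))
        (par I.idxPair fun j => shiftOp (I.idxBit i j)) :=
      loc_commute ((disjoint_blockQ I.disjoint_idxRegS_workS).symm.mono_right firstQ_subset)
        (encOn_mem_loc I.blocks _) (I.idxPair_par_mem_loc _)
    rw [← encOn_mul_zeroProj I.blocks, mul_assoc, hc2.symm.left_comm, hc.symm.left_comm, ht, ancS,
      encOn_union I.blocks I.disjoint_idxRegS_workS, mul_assoc, hc3.left_comm, idxPrep, mul_assoc]
  rw [prep_eq, ← mul_assoc, ← (I.idxProj_semiconj i hidx).eq, mul_assoc, ← h2, ← hZ,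
    ← mul_assoc (par I.idxPair fun _ => (Gate.H (Sum.inl ())).op),
    ← mul_assoc (par I.idxPair fun _ => (Gate.cnot (Sum.inl ()) (Sum.inr ())).op),
    ← mul_assoc (par I.idxPair fun j => valProj (Sum.inl ()) (I.idxBit i j)), hbell,
    Matrix.smul_mul, Matrix.mul_smul, mul_assoc]

end QSAT

/-! ### The check circuit -/

/-- The syndrome qubits of a block, listed in order. -/
def synList : List Syn := blkList.filterMap fun q => if h : q ≠ 0 then some ⟨q, h⟩ else none

theorem mem_synList (q : Syn) : q ∈ synList :=
  List.mem_filterMap.2 ⟨q.1, mem_blkList _, dif_pos q.2⟩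

theorem nodup_synList : synList.Nodup := by
  refine nodup_blkList.filterMap fun a b c ha hb => ?_
  simp only [Option.mem_def] at ha hb
  split_ifs at ha with h1
  split_ifs at hb with h2
  rw [← hb] at ha
  exact congrArg Subtype.val (Option.some_injective _ ha)

theorem uChk_eq : uChk = uDec.map (Gate.map Sum.inl) ++
    synList.map (fun q => Gate.cnot (Sum.inl q.1) (Sum.inr q)) ++
      uEnc.map (Gate.map Sum.inl) := by
  have h : synList.map (fun q => Gate.cnot (Sum.inl q.1) (Sum.inr q)) =
      blkList.filterMap fun q =>
        if h : q ≠ 0 then some (Gate.cnot (Sum.inl q) (Sum.inr ⟨q, h⟩)) else none := by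
    rw [synList, List.map_filterMap]
    generalize blkList = l
    refine congrArg (fun f => List.filterMap f l) (funext fun q => ?_)
    split_ifs <;> rfl
  rw [uChk, h]

theorem opOf_uDec : opOf uDec = (opOf uEnc)ᴴ := opOf_reverse uEnc_selfInv

theorem eq_of_mulVec {ι : Type} [Fintype ι] {M N : Matrix ι ι ℂ}
    (h : ∀ v, M *ᵥ v = N *ᵥ v) : M = N :=
  Matrix.mulVec_injective (funext h)

/-- Copying qubits into syndrome qubits and projecting the latter onto zero projects the former
onto zero. -/
theorem zeroProj_mul_copy : zeroProj (Set.range Sum.inr) *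
    (opOf (synList.map fun q => Gate.cnot (Sum.inl q.1) (Sum.inr q)) *
      zeroProj (Set.range Sum.inr)) =
    zeroProj (Sum.inl '' {q : Blk | q ≠ 0}) *
      zeroProj (Set.range (Sum.inr : Syn → Blk ⊕ Syn)) := by
  classical
  refine eq_of_mulVec fun v => funext fun x => ?_
  rw [← Matrix.mulVec_mulVec, ← Matrix.mulVec_mulVec, ← Matrix.mulVec_mulVec]
  by_cases hx : ∃ q ∈ Set.range (Sum.inr : Syn → Blk ⊕ Syn), x q ≠ 0
  · rw [zeroProj_mulVec_apply _ _ hx, Matrix.mulVec_mulVec, (zeroProj_commute _ _).eq,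
      ← Matrix.mulVec_mulVec, zeroProj_mulVec_apply _ _ hx]
  · push Not at hx
    have hx' : ∀ q : Syn, x (Sum.inr q) = 0 := fun q => hx _ ⟨q, rfl⟩
    have hc := opOf_cnots_mulVec (fun q : Syn => (q.1 : Blk)) nodup_synList
      (zeroProj (Set.range Sum.inr) *ᵥ v) x
    have h1 : ∀ w : (Blk ⊕ Syn → ZMod 2) → ℂ, (zeroProj (Set.range Sum.inr) *ᵥ w) x = w x := by
      intro w
      rw [zeroProj, Matrix.mulVec_diagonal, if_pos hx, one_mul]
    rw [h1, hc]
    simp only [mem_synList, if_true, hx', zero_add]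
    by_cases h : ∃ q ∈ Sum.inl '' {q : Blk | q ≠ 0}, x q ≠ 0
    · rw [zeroProj_mulVec_apply _ _ h]
      obtain ⟨_, ⟨q, hq, rfl⟩, hxq⟩ := h
      exact zeroProj_mulVec_apply _ _ ⟨Sum.inr ⟨q, hq⟩, ⟨_, rfl⟩, hxq⟩
    · push Not at h
      have h2 : (Sum.elim (fun q => x (Sum.inl q)) fun q : Syn => x (Sum.inl q.1)) = x := by
        funext q
        rcases q with q | q
        · rfl
        · exact (h _ ⟨q.1, q.2, rfl⟩).trans (hx' q).symm
      rw [h2, h1]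
      conv_rhs => rw [zeroProj, Matrix.mulVec_diagonal, if_pos h, one_mul, h1]

/-- If all syndrome qubits are and remain zero, the check circuit projects onto the code space. -/
theorem zeroProj_mul_uChk : zeroProj (Set.range Sum.inr) *
    (opOf uChk * zeroProj (Set.range Sum.inr)) =
    lift Sum.inl (encIso * (opOf uEnc)ᴴ) * zeroProj (Set.range (Sum.inr : Syn → Blk ⊕ Syn)) := by
  have hc : ∀ M : Op Blk, Commute (lift Sum.inl M : Op (Blk ⊕ Syn))
      (zeroProj (Set.range Sum.inr)) := fun M => by
    refine loc_commute (S := Set.range Sum.inl) ?_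
      (lift_mem_loc (fun a => Set.mem_range_self a) M) (zeroProj_mem_loc _)
    rw [Set.disjoint_left]
    rintro _ ⟨a, rfl⟩ ⟨b, hb⟩
    cases hb
  rw [uChk_eq, opOf_append, opOf_append, opOf_map Sum.inl_injective, opOf_map Sum.inl_injective,
    opOf_uDec, mul_assoc, mul_assoc, (hc _).eq, (hc _).symm.left_comm,
    ← mul_assoc (opOf _) (zeroProj _), ← mul_assoc (zeroProj _) (_ * _), zeroProj_mul_copy,
    mul_assoc, ← (hc _).eq, ← lift_zeroProj, ← mul_assoc, ← mul_assoc, ← lift_mul Sum.inl_injective,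
    ← lift_mul Sum.inl_injective]
  rfl

namespace QSAT

variable {k γ : ℕ} (I : QSAT k γ)

/-- The label of the block of the witness whose encoding is checked. -/
def chkLbl (i : Fin I.m) : Fin 3 × Fin k → Lbl I.n γ I.logm
  | (0, τ) => .data (I.elt i τ)
  | (1, τ) => .otpX (I.elt i τ)
  | (2, τ) => .otpZ (I.elt i τ)

/-- The witness blocks in the support of the `i`-th circuit. -/
def checkedS (i : Fin I.m) : Finset (Lbl I.n γ I.logm) := Finset.univ.image (I.chkLbl i)

theorem elt_injective (i : Fin I.m) : (I.elt i).Injective :=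
  ((I.S i).orderEmbOfFin (I.card_S i)).injective

theorem chkLbl_injective (i : Fin I.m) : (I.chkLbl i).Injective := by
  have hinj := I.elt_injective i
  rintro ⟨a, τ⟩ ⟨b, τ'⟩ h
  fin_cases a <;> fin_cases b <;>
    first
    | exact Prod.ext rfl (hinj (Lbl.data.inj h))
    | exact Prod.ext rfl (hinj (Lbl.otpX.inj h))
    | exact Prod.ext rfl (hinj (Lbl.otpZ.inj h))
    | cases h

theorem chkBlk_eq (i : Fin I.m) (p : Fin 3 × Fin k) :
    I.chkBlk i p.2 p.1 = blk (I.chkLbl i p) := by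
  obtain ⟨a, τ⟩ := p
  fin_cases a <;> rfl

/-- A checked block together with its syndrome qubits. -/
def chkPair (i : Fin I.m) (p : Fin 3 × Fin k) : Blk ⊕ Syn → I.St :=
  Sum.elim (I.chkBlk i p.2 p.1) (.chk p.1 p.2)

theorem blocks_chkPair (i : Fin I.m) : Blocks (I.chkPair i) := by
  rintro ⟨p, a⟩ ⟨p', a'⟩ h
  rcases a with a | a <;> rcases a' with a' | a' <;>
    simp only [chkPair, Sum.elim_inl, Sum.elim_inr, chkBlk_eq] at h
  · have := I.blocks (a₁ := (_, a)) (a₂ := (_, a')) h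
    obtain ⟨h1, h2⟩ := Prod.ext_iff.1 this
    rw [I.chkLbl_injective i h1, show a = a' from h2]
  · generalize I.chkLbl i p = q at h
    cases q <;> cases h
  · generalize I.chkLbl i p' = q at h
    cases q <;> cases h
  · injection h with h1 h2 h3
    rw [Prod.ext h1 h2, h3]

/-- The gates of the check for the index `i`. -/
def checkGates (i : Fin I.m) : List (Gate I.St) :=
  (List.finRange 3).flatMap fun s => (List.finRange k).flatMap fun τ =>
    uChk.map (Gate.map (Sum.elim (I.chkBlk i τ s) (.chk s τ)))

theorem opOf_checkGates (i : Fin I.m) :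
    opOf (I.checkGates i) = par (I.chkPair i) fun _ => opOf uChk := by
  have h := opOf_flatMap_blocks (I.blocks_chkPair i) uChk
    (List.finRange 3 ×ˢ List.finRange k) ((List.nodup_finRange 3).product (List.nodup_finRange k))
  have h1 : I.checkGates i = (List.finRange 3 ×ˢ List.finRange k).flatMap fun p =>
      uChk.map (Gate.map (I.chkPair i p)) := by
    simp only [checkGates, SProd.sprod, List.product, List.flatMap_assoc, List.flatMap_map]
    rfl
  rw [h1, h]
  refine par_congr _ fun p => if_pos ?_
  obtain ⟨a, b⟩ := p
  exact List.mem_product.2 ⟨List.mem_finRange _, List.mem_finRange _⟩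

theorem zeroProj_chkQ (i : Fin I.m) :
    (zeroProj chkQ : Op I.St) = par (I.chkPair i) fun _ => zeroProj (Set.range Sum.inr) := by
  rw [par_zeroProj]
  refine congrArg zeroProj (Set.ext fun q => ?_)
  constructor
  · rintro ⟨s, τ, w, rfl⟩
    exact ⟨(s, τ), Sum.inr w, ⟨w, rfl⟩, rfl⟩
  · rintro ⟨⟨s, τ⟩, _, ⟨w, rfl⟩, rfl⟩
    exact ⟨s, τ, w, rfl⟩

/-- If all syndrome qubits are and remain zero, the checks project onto the code space of all
checked blocks. -/
theorem zeroProj_mul_checkGates (i : Fin I.m) :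
    zeroProj chkQ * (opOf (I.checkGates i) * zeroProj chkQ) =
      isoOn blk (I.checkedS i) * ((encOn blk (I.checkedS i))ᴴ * zeroProj chkQ) := by
  have hb := I.blocks_chkPair i
  have h1 : par (I.chkPair i) (fun _ => lift Sum.inl (encIso * (opOf uEnc)ᴴ)) =
      isoOn blk (I.checkedS i) * (encOn blk (I.checkedS i))ᴴ := by
    have hbl : Blocks fun p => (blk (I.chkLbl i p) : Blk → I.St) :=
      I.blocks.comp (I.chkLbl_injective i)
    have h2 : par (I.chkPair i) (fun _ => lift Sum.inl (encIso * (opOf uEnc)ᴴ)) =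
        par (fun p => (blk (I.chkLbl i p) : Blk → I.St)) fun _ => encIso * (opOf uEnc)ᴴ := by
      refine par_eq_par hb hbl fun p => ?_
      rw [← lift_comp (hb.injective p), chkPair, Sum.elim_comp_inl, chkBlk_eq]
    rw [h2, isoOn, encOn, par_conjTranspose, ← par_mul I.blocks]
    have h3 := par_comp I.blocks (I.chkLbl_injective i)
      (fun l => if l ∈ I.checkedS i then encIso * (opOf uEnc)ᴴ else 1) (fun l hl => if_neg (by
        intro h
        obtain ⟨p, -, hp⟩ := Finset.mem_image.1 h
        exact hl p hp))
    refine Eq.trans ?_ (h3.trans ?_)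
    · refine par_congr _ fun p => (if_pos ?_).symm
      exact Finset.mem_image_of_mem _ (Finset.mem_univ p)
    · refine par_congr _ fun l => ?_
      simp only [Pi.mul_apply]
      split_ifs
      · rfl
      · rw [Matrix.conjTranspose_one, mul_one]
  rw [← mul_assoc (isoOn _ _), ← h1, opOf_checkGates, I.zeroProj_chkQ i, ← par_mul hb, ← par_mul hb,
    ← par_mul hb]
  exact par_congr _ fun p => zeroProj_mul_uChk

end QSAT

/-! ### The encoded test -/

theorem flatten_map_singleton {α β : Type} (f : α → β) (l : List α) :
    (l.map fun a => [f a]).flatten = l.map f := by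
  induction l with
  | nil => rfl
  | cons a l ih => simp [ih]

theorem flatten_flatMap_map_singleton {α β δ : Type} (f : α → β → δ) (l : List α) (l' : List β) :
    (l.flatMap fun a => l'.map fun b => [f a b]).flatten = l.flatMap fun a => l'.map (f a) := by
  induction l with
  | nil => rfl
  | cons a l ih => rw [List.flatMap_cons, List.flatten_append, ih, flatten_map_singleton,
      List.flatMap_cons]

theorem filterMap_range_getElem? {α : Type} (l : List α) {n : ℕ} (h : l.length ≤ n) :
    ((List.range n).filterMap fun j => l[j]?) = l := by
  induction l generalizing n with
  | nil => simp
  | cons a l ih =>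
    obtain ⟨n, rfl⟩ : ∃ n', n = n' + 1 := ⟨n - 1, by simp at h; omega⟩
    rw [List.range_succ_eq_map, List.filterMap_cons_some (by rfl), List.filterMap_map]
    congr 1
    exact ih (by simpa using h)

theorem filterMap_finRange_getElem? {α : Type} (l : List α) {n : ℕ} (h : l.length ≤ n) :
    ((List.finRange n).filterMap fun r => l[r.val]?) = l := by
  conv_rhs => rw [← filterMap_range_getElem? l h, ← List.map_coe_finRange_eq_range,
    List.filterMap_map]
  rfl

namespace QSAT

variable {k γ : ℕ} (I : QSAT k γ)

/-- The label of the block holding a logical qubit of the `i`-th circuit. -/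
def circLbl (i : Fin I.m) : Fin k ⊕ Fin γ → Lbl I.n γ I.logm
  | .inl τ => .data (I.elt i τ)
  | .inr r => .anc r

/-- The physical qubit holding a logical qubit of the `i`-th circuit before encoding. -/
def circQ (i : Fin I.m) (a : Fin k ⊕ Fin γ) : I.St := blk (I.circLbl i a) 0

/-- All blocks used by the encoded test. -/
def testedS (i : Fin I.m) : Finset (Lbl I.n γ I.logm) := I.checkedS i ∪ workS I.n γ I.logm

/-- The magic states, as an operator on the zero state. -/
def magicState : Op I.St := I.magicPrep * zeroProj (firstQ (Finset.univ.image Lbl.magic))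

theorem circBlk_eq (i : Fin I.m) (a : Fin k ⊕ Fin γ) : I.circBlk i a = blk (I.circLbl i a) := by
  cases a <;> rfl

theorem circLbl_injective (i : Fin I.m) : (I.circLbl i).Injective := by
  rintro (a | a) (b | b) h
  · rw [I.elt_injective i (Lbl.data.inj h)]
  · cases h
  · cases h
  · rw [Lbl.anc.inj h]

theorem circQ_injective (i : Fin I.m) : (I.circQ i).Injective := fun _ _ h =>
  I.circLbl_injective i (Prod.ext_iff.1 (I.blocks (a₁ := (_, (0 : Blk))) (a₂ := (_, (0 : Blk))) h)).1

theorem circLbl_ne_magic (i : Fin I.m) (a : Fin k ⊕ Fin γ) (r : Fin γ) :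
    I.circLbl i a ≠ .magic r := by
  cases a <;> exact fun h => by cases h

theorem circLbl_mem (i : Fin I.m) (a : Fin k ⊕ Fin γ) : I.circLbl i a ∈ I.testedS i := by
  rcases a with τ | r
  · exact Finset.mem_union_left _ (Finset.mem_image.2 ⟨(0, τ), Finset.mem_univ _, rfl⟩)
  · refine Finset.mem_union_right _ (Finset.mem_union_right _ ?_)
    exact Finset.mem_image_of_mem _ (Finset.mem_univ r)

theorem magic_mem (i : Fin I.m) (r : Fin γ) : Lbl.magic r ∈ I.testedS i :=
  Finset.mem_union_right _ (Finset.mem_union_left _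
    (Finset.mem_image_of_mem _ (Finset.mem_univ r)))

theorem magicPrep_mem_loc_magic : I.magicPrep ∈ loc (firstQ (Finset.univ.image Lbl.magic)) := by
  refine par_mem_loc I.blocks_magic (T := fun _ => Set.univ) (fun _ => mem_loc_univ _) ?_
  exact fun r a _ => ⟨.magic r, Finset.mem_image_of_mem _ (Finset.mem_univ r), rfl⟩

theorem magicState_mem_loc : I.magicState ∈ loc (firstQ (Finset.univ.image Lbl.magic)) :=
  mul_mem I.magicPrep_mem_loc_magic (zeroProj_mem_loc _)

/-- With a magic state, the gadget acts as a `T` gate. -/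
theorem gadget_mul_magicState (r : Fin γ) {a : I.St} (h : a ≠ .magic r 0) :
    (Gate.cp (.magic r 0) a).op * (Gate.cnot a (.magic r 0)).op * I.magicState =
      (Gate.T a).op * I.magicState := by
  have hb := I.blocks_magic
  -- Only the `r`-th magic state matters; the preparation of the others is collected in `N`.
  obtain ⟨N, hN⟩ : ∃ N : Op I.St, I.magicState =
      (Gate.T (.magic r 0)).op * (Gate.H (.magic r 0)).op * zeroProj {.magic r 0} * N := by
    have h1 : I.magicState = par (fun r (_ : Unit) => (.magic r 0 : I.St)) fun _ =>
        (Gate.T ()).op * (Gate.H ()).op * zeroProj Set.univ := by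
      have h2 : (zeroProj (firstQ (Finset.univ.image Lbl.magic)) : Op I.St) =
          par (fun r (_ : Unit) => (.magic r 0 : I.St)) fun _ => zeroProj Set.univ := by
        rw [par_zeroProj]
        refine congrArg zeroProj (Set.ext fun q => ?_)
        constructor
        · rintro ⟨l, hl, rfl⟩
          obtain ⟨r, -, rfl⟩ := Finset.mem_image.1 hl
          exact ⟨r, (), Set.mem_univ _, rfl⟩
        · rintro ⟨r, _, _, rfl⟩
          exact ⟨.magic r, Finset.mem_image_of_mem _ (Finset.mem_univ r), rfl⟩
      rw [magicState, magicPrep, h2, ← par_mul hb]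
      rfl
    refine ⟨par (fun r (_ : Unit) => (.magic r 0 : I.St)) fun r' => if r' = r then 1 else
      (Gate.T ()).op * (Gate.H ()).op * zeroProj Set.univ, ?_⟩
    have h3 : (Gate.T (.magic r 0)).op * (Gate.H (.magic r 0)).op *
        zeroProj {(.magic r 0 : I.St)} =
        lift (fun _ : Unit => (.magic r 0 : I.St)) ((Gate.T ()).op * (Gate.H ()).op *
          zeroProj Set.univ) := by
      have hinj := hb.injective r
      rw [lift_mul hinj, lift_mul hinj, ← Gate.op_map hinj, ← Gate.op_map hinj, lift_zeroProj]
      have : (fun _ : Unit => (.magic r 0 : I.St)) '' Set.univ = {.magic r 0} := by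
        ext q
        simp
      rw [this]
      rfl
    rw [h3, ← par_mulSingle hb r, ← par_mul hb, h1]
    refine par_congr _ fun r' => ?_
    rw [Pi.mul_apply]
    rcases eq_or_ne r' r with rfl | hr
    · rw [Pi.mulSingle_eq_same, if_pos rfl, mul_one]
    · rw [Pi.mulSingle_eq_of_ne hr, if_neg hr, one_mul]
  rw [hN, ← mul_assoc, gadget_magic h, mul_assoc (Gate.T a).op]

theorem disjoint_circQ_magic (i : Fin I.m) :
    Disjoint (Set.range (I.circQ i)) (firstQ (Finset.univ.image Lbl.magic)) := by
  rw [Set.disjoint_left]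
  rintro _ ⟨a, rfl⟩ ⟨l, hl, h⟩
  obtain ⟨r, -, rfl⟩ := Finset.mem_image.1 hl
  exact I.blocks.ne (I.circLbl_ne_magic i a r).symm _ _ h

theorem circ_gate_commute (i : Fin I.m) (g : Gate (Fin k ⊕ Fin γ)) :
    Commute I.magicState (g.map (I.circQ i)).op := by
  rw [Gate.op_map (I.circQ_injective i)]
  exact (loc_commute (I.disjoint_circQ_magic i) (lift_mem_loc (fun a => Set.mem_range_self a) _)
    I.magicState_mem_loc).symm

/-- The fault-tolerant gates implement the logical gates on encoded states. -/
theorem ftGate_semiconj (i : Fin I.m) (r : Fin γ) (g : CTGate (Fin k ⊕ Fin γ)) :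
    SemiconjBy (isoOn blk (I.testedS i) * I.magicState) (g.toGate.map (I.circQ i)).op
      (opOf (ftGate (I.circBlk i) (.magic r) g).flatten) := by
  have hb := I.blocks
  cases g with
  | cnot a b h =>
    refine SemiconjBy.mul_left ?_ (I.circ_gate_commute i _)
    have hne : I.circLbl i a ≠ I.circLbl i b := fun h' => h (I.circLbl_injective i h')
    have h1 := isoOn_semiconj₂ hb (I.circLbl_mem i a) (I.circLbl_mem i b) hne semiconj_cnot
    rw [← Gate.op_map (elim_injective hb hne), ← opOf_map (elim_injective hb hne),
      List.map_map] at h1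
    rw [ftGate, flatten_map_singleton, circBlk_eq, circBlk_eq]
    exact h1
  | P a =>
    refine SemiconjBy.mul_left ?_ (I.circ_gate_commute i _)
    have h1 := isoOn_semiconj hb (I.circLbl_mem i a) semiconj_P
    rw [← Gate.op_map (hb.injective _), ← opOf_map (hb.injective _), List.map_map] at h1
    rw [ftGate, flatten_map_singleton, circBlk_eq]
    exact h1
  | H a =>
    refine SemiconjBy.mul_left ?_ (I.circ_gate_commute i _)
    have h1 := isoOn_semiconj hb (I.circLbl_mem i a) semiconj_H
    rw [← Gate.op_map (hb.injective _), ← opOf_map (hb.injective _), List.map_map] at h1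
    rw [ftGate, flatten_map_singleton, circBlk_eq]
    exact h1
  | T a =>
    have hne := I.circLbl_ne_magic i a r
    have h1 := isoOn_semiconj₂ hb (I.circLbl_mem i a) (I.magic_mem i r) hne semiconj_gadget
    have hinj := elim_injective hb hne
    rw [lift_mul hinj, ← Gate.op_map hinj, ← Gate.op_map hinj, ← opOf_map hinj, List.map_append,
      List.map_map, List.map_flatMap] at h1
    have h2 : (ftGate (I.circBlk i) (.magic r) (CTGate.T a)).flatten =
        (blkList.map fun q => Gate.cnot (blk (I.circLbl i a) q) (.magic r q)) ++
          blkList.flatMap fun q => blkList.map fun q' =>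
            Gate.cp (.magic r q) (blk (I.circLbl i a) q') := by
      rw [ftGate, List.flatten_append, flatten_map_singleton, circBlk_eq,
        flatten_flatMap_map_singleton]
    have h3 : SemiconjBy (isoOn blk (I.testedS i))
        ((Gate.cp (.magic r 0) (I.circQ i a)).op * (Gate.cnot (I.circQ i a) (.magic r 0)).op)
        (opOf (ftGate (I.circBlk i) (.magic r) (CTGate.T a)).flatten) := by
      rw [h2]
      simp only [List.map_map] at h1
      exact h1
    have hq : I.circQ i a ≠ .magic r 0 := I.blocks.ne hne 0 0
    have hc := I.circ_gate_commute i (.T a)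
    rw [SemiconjBy, ← mul_assoc, ← h3.eq, mul_assoc, mul_assoc,
      I.gadget_mul_magicState r hq]
    exact congrArg _ hc.eq

end QSAT

/-- Removing the one-time pad of qubit `0`, with the keys in qubits `1` and `2`. -/
def unpad : Op (Fin 3) := (Gate.cz 2 0).op * (Gate.cnot 1 0).op

theorem unpad_mem_unitary : unpad ∈ unitary (Op (Fin 3)) :=
  mul_mem (Gate.op_mem_unitary trivial) (Gate.op_mem_unitary (g := .cnot 1 0) one_ne_zero)

namespace QSAT

variable {k γ : ℕ} (I : QSAT k γ)

/-- The first qubits of the blocks of the witness belonging to the qubit `u`. -/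
def padQ (u : Fin I.n) : Fin 3 → I.St := ![.data u 0, .otpX u 0, .otpZ u 0]

/-- Removing the one-time pad, before encoding, from the qubits in `t`. -/
def unpadOn (t : Finset (Fin I.n)) : Op I.St := par I.padQ fun u => if u ∈ t then unpad else 1

theorem blocks_padQ : Blocks I.padQ := by
  rintro ⟨u, a⟩ ⟨u', a'⟩ h
  fin_cases a <;> fin_cases a' <;>
    first
    | exact Prod.ext (StQ.data.inj h).1 rfl
    | exact Prod.ext (StQ.otpX.inj h).1 rfl
    | exact Prod.ext (StQ.otpZ.inj h).1 rfl
    | cases h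

theorem disjoint_witness_magic (l : Lbl I.n γ I.logm) (i : Fin I.m) (hl : l ∈ I.checkedS i)
    (r : Fin γ) : l ≠ .magic r := by
  rintro rfl
  obtain ⟨⟨a, τ⟩, -, h⟩ := Finset.mem_image.1 hl
  fin_cases a <;> cases h

theorem padQ_mem (i : Fin I.m) (τ : Fin k) (a : Fin 3) :
    I.padQ (I.elt i τ) a ∈ (firstQ (I.checkedS i) : Set I.St) := by
  refine ⟨I.chkLbl i (a, τ), Finset.mem_image_of_mem _ (Finset.mem_univ _), ?_⟩
  fin_cases a <;> rfl

theorem disjoint_checkedS_magic (i : Fin I.m) :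
    Disjoint (I.checkedS i) (Finset.univ.image Lbl.magic) := by
  rw [Finset.disjoint_left]
  intro l h h'
  obtain ⟨r, -, rfl⟩ := Finset.mem_image.1 h'
  exact I.disjoint_witness_magic _ i h r rfl

theorem unpadOn_eq (i : Fin I.m) :
    I.unpadOn (I.S i) = par (fun τ => I.padQ (I.elt i τ)) fun _ => unpad := by
  have h := par_comp I.blocks_padQ (I.elt_injective i)
    (fun u => if u ∈ I.S i then unpad else 1) (fun u hu => if_neg fun h => by
      have : u ∈ Set.range (I.elt i) := by
        change u ∈ Set.range ((I.S i).orderEmbOfFin (I.card_S i))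
        rw [Finset.range_orderEmbOfFin]
        exact h
      obtain ⟨τ, hτ⟩ := this
      exact hu τ hτ)
  rw [unpadOn, ← h]
  exact par_congr _ fun τ => if_pos (Finset.orderEmbOfFin_mem _ _ _)

/-- A transversal two-qubit gate between key blocks and data blocks implements the logical gate on
all pairs. -/
theorem pad_semiconj (i : Fin I.m) {lbl : Fin I.n → Lbl I.n γ I.logm} (hl : lbl.Injective)
    (hne : ∀ u v, lbl u ≠ .data v) (hmem : ∀ τ, lbl (I.elt i τ) ∈ I.checkedS i)
    {gs : List (Gate (Blk ⊕ Blk))} {g₀ : Gate (Blk ⊕ Blk)} (h : SemiconjBy encIso₂ g₀.op (opOf gs))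
    {M : Op (Fin 3)} (hM : ∀ u, (g₀.map (Sum.elim (blk (lbl u)) (blk (.data u)))).op =
      lift (I.padQ u) M) :
    SemiconjBy (isoOn blk (I.testedS i) * I.magicState)
      (par (fun τ => I.padQ (I.elt i τ)) fun _ => M)
      (opOf (gs.map fun g => (List.finRange k).map fun τ =>
        g.map (Sum.elim (blk (lbl (I.elt i τ))) (blk (.data (I.elt i τ))))).flatten) := by
  have hb := I.blocks
  have hbl : Blocks fun τ => (Sum.elim (blk (lbl (I.elt i τ))) (blk (.data (I.elt i τ))) :
      Blk ⊕ Blk → I.St) := by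
    rintro ⟨τ, a⟩ ⟨τ', a'⟩ h
    rcases a with a | a <;> rcases a' with a' | a'
    · obtain ⟨h1, h2⟩ := hb.eq h
      exact Prod.ext (I.elt_injective i (hl h1)) (congrArg Sum.inl h2)
    · exact absurd h (hb.ne (hne _ _) _ _)
    · exact absurd h (hb.ne (hne _ _).symm _ _)
    · obtain ⟨h1, h2⟩ := hb.eq (i := .data (I.elt i τ)) (j := .data (I.elt i τ')) h
      exact Prod.ext (I.elt_injective i (Lbl.data.inj h1)) (congrArg Sum.inr h2)
  have hbp := I.blocks_padQ.comp (I.elt_injective i)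
  rw [opOf_flatten, List.map_map]
  have h1 := layers_prod_univ hbl gs (List.nodup_finRange k) List.mem_finRange
  have h2 : (gs.map (opOf ∘ fun g => (List.finRange k).map fun τ =>
      g.map (Sum.elim (blk (lbl (I.elt i τ))) (blk (.data (I.elt i τ)))))).reverse.prod =
      par (fun τ => (Sum.elim (blk (lbl (I.elt i τ))) (blk (.data (I.elt i τ))) :
        Blk ⊕ Blk → I.St)) fun _ => opOf gs := h1
  rw [h2]
  refine SemiconjBy.mul_left (par_semiconj hbp hbl (M := fun _ => M) fun τ => ?_) ?_
  · have h3 := isoOn_semiconj₂ hb (s := I.testedS i) (Finset.mem_union_left _ (hmem τ))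
      (I.circLbl_mem i (.inl τ)) (hne _ _) h
    rw [← hM, Gate.op_map (elim_injective hb (hne _ _))]
    exact h3
  · refine (loc_commute (S := firstQ (I.checkedS i)) ?_
      (par_mem_loc hbp (T := fun _ => Set.univ) (fun _ => mem_loc_univ _)
        fun τ a _ => I.padQ_mem i τ a) I.magicState_mem_loc).symm
    exact (disjoint_blockQ (I.disjoint_checkedS_magic i)).mono firstQ_subset firstQ_subset

/-- The encoded circuit implements the circuit on encoded states. -/
theorem circuit_semiconj (i : Fin I.m) :
    SemiconjBy (isoOn blk (I.testedS i) * I.magicState) (lift (I.circQ i) (I.C i).op)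
      (opOf ((List.finRange γ).flatMap fun r =>
        match (I.C i).gates[r.val]? with
        | none => []
        | some g => ftGate (I.circBlk i) (.magic r) g).flatten) := by
  have h : ∀ rs : List (Fin γ), SemiconjBy (isoOn blk (I.testedS i) * I.magicState)
      (opOf ((rs.filterMap fun r => (I.C i).gates[r.val]?).map
        fun g => g.toGate.map (I.circQ i)))
      (opOf (rs.flatMap fun r =>
        match (I.C i).gates[r.val]? with
        | none => []
        | some g => ftGate (I.circBlk i) (.magic r) g).flatten) := by
    intro rs
    induction rs with
    | nil => exact SemiconjBy.one_right _
    | cons r rs ih =>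
      rw [List.flatMap_cons, List.flatten_append, opOf_append, List.filterMap_cons]
      cases h : (I.C i).gates[r.val]? with
      | none =>
        simp only [List.flatten_nil, opOf, mul_one]
        exact ih
      | some g =>
        simp only [List.map_cons, opOf]
        exact ih.mul_right (I.ftGate_semiconj i r g)
  have h1 := h (List.finRange γ)
  rw [filterMap_finRange_getElem? _ (I.C i).size_le] at h1
  rw [Circuit.op, ← opOf_map (I.circQ_injective i), List.map_map]
  exact h1

/-- The encoded test implements the removal of the one-time pad followed by the circuit. -/
theorem testLayers_semiconj (i : Fin I.m) :
    SemiconjBy (isoOn blk (I.testedS i) * I.magicState)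
      (lift (I.circQ i) (I.C i).op * I.unpadOn (I.S i)) (opOf (I.testLayers i).flatten) := by
  have hbp := I.blocks_padQ.comp (I.elt_injective i)
  have h1 := I.pad_semiconj i (lbl := .otpX) (fun _ _ h => Lbl.otpX.inj h)
    (fun _ _ h => by cases h)
    (fun τ => Finset.mem_image.2 ⟨(1, τ), Finset.mem_univ _, rfl⟩) semiconj_cnot
    (M := (Gate.cnot 1 0).op) (fun u => by
      rw [← Gate.op_map (I.blocks_padQ.injective u)]; rfl)
  have h2 := I.pad_semiconj i (lbl := .otpZ) (fun _ _ h => Lbl.otpZ.inj h)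
    (fun _ _ h => by cases h)
    (fun τ => Finset.mem_image.2 ⟨(2, τ), Finset.mem_univ _, rfl⟩) semiconj_cz
    (M := (Gate.cz 2 0).op) (fun u => by
      rw [← Gate.op_map (I.blocks_padQ.injective u)]; rfl)
  rw [List.map_map] at h1 h2
  rw [testLayers, List.flatten_append, List.flatten_append, opOf_append, opOf_append, unpadOn_eq]
  refine (I.circuit_semiconj i).mul_right ?_
  have h3 : (par (fun τ => I.padQ (I.elt i τ)) fun _ => unpad) =
      (par (fun τ => I.padQ (I.elt i τ)) fun _ => (Gate.cz 2 0).op) *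
        par (fun τ => I.padQ (I.elt i τ)) fun _ => (Gate.cnot 1 0).op := (par_mul hbp _ _)
  rw [h3]
  exact h2.mul_right h1

end QSAT

/-! ### The sequence of unitaries of the verifier -/

/-- Padding by empty layers does not change the sequence of gates. -/
theorem flatMap_range_getD {α : Type} (l : List (List α)) {n : ℕ} (h : l.length ≤ n) :
    ((List.range n).flatMap fun j => l.getD j []) = l.flatten := by
  induction l generalizing n with
  | nil => simp
  | cons a l ih =>
    obtain ⟨n, rfl⟩ : ∃ n', n = n' + 1 := ⟨n - 1, by simp at h; omega⟩
    rw [List.range_succ_eq_map, List.flatMap_cons, List.flatMap_map, List.flatten_cons]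
    exact congrArg (a ++ ·) (ih (by simpa using h))

theorem uEnc_valid : ∀ g ∈ uEnc, g.Valid := fun g hg => (uEnc_selfInv g hg).valid

theorem uDec_valid : ∀ g ∈ uDec, g.Valid := fun g hg => uEnc_valid g (List.mem_reverse.1 hg)

theorem uChk_valid : ∀ g ∈ uChk, g.Valid := by
  intro g hg
  rw [uChk_eq, List.mem_append, List.mem_append, List.mem_map, List.mem_map, List.mem_map] at hg
  rcases hg with (⟨g, hg, rfl⟩ | ⟨q, -, rfl⟩) | ⟨g, hg, rfl⟩
  · exact (uDec_valid g hg).map Sum.inl_injective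
  · exact Sum.inl_ne_inr
  · exact (uEnc_valid g hg).map Sum.inl_injective

theorem oneProj_mem_loc {R : Type} [Fintype R] [DecidableEq R] {S : Set R} {q : R} (h : q ∈ S) :
    oneProj q ∈ loc S := by
  refine diagonal_mem_loc fun x y hxy => ?_
  rw [hxy q h]

namespace QSAT

variable {k γ : ℕ} (I : QSAT k γ)

/-- The controlled layers of the check. -/
def checkLayers : List (Fin I.m → List (Gate I.St)) :=
  (List.finRange 3).flatMap fun s => (List.finRange k).flatMap fun τ => uChk.map fun g =>
    fun i => [g.map (Sum.elim (I.chkBlk i τ s) (.chk s τ))]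

/-- The controlled layers of the verifier. -/
def ctlLayers : List (Fin I.m → List (Gate I.St)) :=
  I.checkLayers ++ (List.range (cTest * γ)).map fun j i => (I.testLayers i).getD j []

/-- The checks and the tests form a single sequence of controlled layers. -/
theorem stage56_eq : I.stage5 ++ I.stage6 = I.ctlLayers.map I.select := by
  simp only [stage5, stage6, ctlLayers, checkLayers, List.map_append, List.map_flatMap,
    List.map_map]
  rfl

theorem flatMap_checkLayers (i : Fin I.m) :
    (I.checkLayers.flatMap fun W => W i) = I.checkGates i := by
  simp only [checkLayers, checkGates, List.flatMap_assoc, List.flatMap_map]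
  generalize uChk = l
  have h : ∀ s τ, (l.flatMap fun g => [g.map (Sum.elim (I.chkBlk i τ s) (.chk s τ))]) =
      l.map (Gate.map (Sum.elim (I.chkBlk i τ s) (.chk s τ))) := fun s τ => by
    induction l with
    | nil => rfl
    | cons a l ih => rw [List.flatMap_cons, ih]; rfl
  simp only [h]

theorem flatMap_ctlLayers [NeZero γ] (i : Fin I.m) :
    (I.ctlLayers.flatMap fun W => W i) = I.checkGates i ++ (I.testLayers i).flatten := by
  rw [ctlLayers, List.flatMap_append, List.flatMap_map,
    flatMap_range_getD _ (I.testLayers_length_le i), flatMap_checkLayers]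

theorem checkedS_subset (i : Fin I.m) : I.checkedS i ⊆ witS I.n γ I.logm := by
  intro l hl
  obtain ⟨⟨a, τ⟩, -, rfl⟩ := Finset.mem_image.1 hl
  fin_cases a <;> simp [chkLbl, witS]

theorem disjoint_witS_ancS : Disjoint (witS I.n γ I.logm) I.ancS := by
  rw [Finset.disjoint_left]
  intro l h
  cases l <;> simp_all [witS, ancS, idxRegS, idxS, midxS, workS]

theorem disjoint_testedS_idxRegS (i : Fin I.m) : Disjoint (I.testedS i) I.idxRegS := by
  rw [testedS, Finset.disjoint_union_left]
  refine ⟨?_, I.disjoint_idxRegS_workS.symm⟩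
  exact (I.disjoint_witS_ancS.mono_left (I.checkedS_subset i)).mono_right Finset.subset_union_left

theorem testedS_subset_compl (i : Fin I.m) :
    (blockQ blk (I.testedS i) : Set I.St) ⊆ (blockQ blk I.idxRegS)ᶜ :=
  (disjoint_blockQ (I.disjoint_testedS_idxRegS i)).subset_compl_right

theorem mem_blockQ {s : Finset (Lbl I.n γ I.logm)} {l : Lbl I.n γ I.logm} (hl : l ∈ s)
    (q : Blk) : blk l q ∈ (blockQ blk s : Set I.St) := ⟨l, hl, q, rfl⟩

theorem mem_compl_of_tested (i : Fin I.m) {l : Lbl I.n γ I.logm} (hl : l ∈ I.testedS i) (q : Blk) :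
    blk l q ∈ (blockQ blk I.idxRegS : Set I.St)ᶜ :=
  I.testedS_subset_compl i ⟨l, hl, q, rfl⟩

theorem chkQ_subset_compl : (chkQ : Set I.St) ⊆ (blockQ blk I.idxRegS)ᶜ :=
  disjoint_chkQ.symm.subset_compl_right

/-- The physical gates of an encoded gate are well formed and act on the tested blocks only. -/
theorem ftGate_good (i : Fin I.m) (r : Fin γ) (g : CTGate (Fin k ⊕ Fin γ)) :
    ∀ l ∈ ftGate (I.circBlk i) (.magic r) g, ∀ g' ∈ l,
      g'.Valid ∧ ∀ q ∈ g'.qubits, q ∈ (blockQ blk (I.testedS i) : Set I.St) := by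
  have ha : ∀ a q, I.circBlk i a q ∈ (blockQ blk (I.testedS i) : Set I.St) := fun a q => by
    rw [circBlk_eq]
    exact I.mem_blockQ (I.circLbl_mem i a) q
  have hm : ∀ q, (.magic r q : I.St) ∈ (blockQ blk (I.testedS i) : Set I.St) := fun q =>
    I.mem_blockQ (I.magic_mem i r) q
  intro l hl g' hg'
  cases g with
  | cnot a b h =>
    obtain ⟨q, -, rfl⟩ := List.mem_map.1 hl
    rw [List.mem_singleton.1 hg']
    refine ⟨?_, ?_⟩
    · change I.circBlk i a q ≠ I.circBlk i b q
      rw [circBlk_eq, circBlk_eq]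
      exact I.blocks.ne (fun h' => h (I.circLbl_injective i h')) _ _
    · simp only [Gate.qubits, List.mem_cons, List.not_mem_nil, or_false]
      rintro q' (rfl | rfl)
      exacts [ha _ _, ha _ _]
  | P a =>
    obtain ⟨q, -, rfl⟩ := List.mem_map.1 hl
    rw [List.mem_singleton.1 hg']
    refine ⟨trivial, fun q' hq' => ?_⟩
    rw [List.mem_singleton.1 hq']
    exact ha _ _
  | H a =>
    obtain ⟨q, -, rfl⟩ := List.mem_map.1 hl
    rw [List.mem_singleton.1 hg']
    refine ⟨trivial, fun q' hq' => ?_⟩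
    rw [List.mem_singleton.1 hq']
    exact ha _ _
  | T a =>
    rcases List.mem_append.1 hl with hl | hl
    · obtain ⟨q, -, rfl⟩ := List.mem_map.1 hl
      rw [List.mem_singleton.1 hg']
      refine ⟨?_, ?_⟩
      · change I.circBlk i a q ≠ .magic r q
        rw [circBlk_eq]
        exact I.blocks.ne (j := .magic r) (I.circLbl_ne_magic i a r) _ _
      · simp only [Gate.qubits, List.mem_cons, List.not_mem_nil, or_false]
        rintro q' (rfl | rfl)
        exacts [ha _ _, hm _]
    · obtain ⟨q, -, hl⟩ := List.mem_flatMap.1 hl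
      obtain ⟨q', -, rfl⟩ := List.mem_map.1 hl
      rw [List.mem_singleton.1 hg']
      refine ⟨trivial, ?_⟩
      simp only [Gate.qubits, List.mem_cons, List.not_mem_nil, or_false]
      rintro q' (rfl | rfl)
      exacts [hm _, ha _ _]

theorem testLayers_good (i : Fin I.m) : ∀ l ∈ I.testLayers i, ∀ g ∈ l,
    g.Valid ∧ ∀ q ∈ g.qubits, q ∈ (blockQ blk (I.testedS i) : Set I.St) := by
  have hc : ∀ p q, blk (I.chkLbl i p) q ∈ (blockQ blk (I.testedS i) : Set I.St) := fun p q =>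
    I.mem_blockQ
      (Finset.mem_union_left _ (Finset.mem_image_of_mem _ (Finset.mem_univ p))) q
  intro l hl g hg
  rw [testLayers, List.mem_append, List.mem_append] at hl
  rcases hl with (hl | hl) | hl
  · obtain ⟨q, -, rfl⟩ := List.mem_map.1 hl
    obtain ⟨τ, -, rfl⟩ := List.mem_map.1 hg
    refine ⟨fun h => (by cases h), ?_⟩
    simp only [Gate.qubits, List.mem_cons, List.not_mem_nil, or_false]
    rintro q' (rfl | rfl)
    exacts [hc (1, τ) q, hc (0, τ) q]
  · obtain ⟨q, -, rfl⟩ := List.mem_map.1 hl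
    obtain ⟨τ, -, rfl⟩ := List.mem_map.1 hg
    refine ⟨trivial, ?_⟩
    simp only [Gate.qubits, List.mem_cons, List.not_mem_nil, or_false]
    rintro q' (rfl | rfl)
    exacts [hc (2, τ) q, hc (0, τ) q]
  · obtain ⟨r, -, hl⟩ := List.mem_flatMap.1 hl
    cases h : (I.C i).gates[r.val]? with
    | none =>
      rw [h] at hl
      exact absurd hl List.not_mem_nil
    | some g' =>
      rw [h] at hl
      exact I.ftGate_good i r g' l hl g hg

/-- The controlled gates are unitary and do not act on the index registers. -/
theorem ctlLayers_good : ∀ W ∈ I.ctlLayers, ∀ i, ∀ g ∈ W i,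
    g.Valid ∧ ∀ q ∈ g.qubits, q ∈ (blockQ blk I.idxRegS : Set I.St)ᶜ := by
  intro W hW i g hg
  rcases List.mem_append.1 hW with hW | hW
  · obtain ⟨s, -, hW⟩ := List.mem_flatMap.1 hW
    obtain ⟨τ, -, hW⟩ := List.mem_flatMap.1 hW
    obtain ⟨g', hg', rfl⟩ := List.mem_map.1 hW
    rw [List.mem_singleton.1 hg]
    refine ⟨(uChk_valid g' hg').map ((I.blocks_chkPair i).injective (s, τ)), fun q hq => ?_⟩
    rw [Gate.qubits_map] at hq
    obtain ⟨q | q, -, rfl⟩ := List.mem_map.1 hq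
    · rw [Sum.elim_inl, I.chkBlk_eq i (s, τ)]
      exact I.mem_compl_of_tested i
        (Finset.mem_union_left _ (Finset.mem_image_of_mem _ (Finset.mem_univ _))) q
    · exact I.chkQ_subset_compl ⟨s, τ, q, rfl⟩
  · obtain ⟨j, -, rfl⟩ := List.mem_map.1 hW
    change g ∈ (I.testLayers i).getD j [] at hg
    by_cases hj : j < (I.testLayers i).length
    · rw [List.getD_eq_getElem _ _ hj] at hg
      obtain ⟨h1, h2⟩ := I.testLayers_good i _ (List.getElem_mem hj) g hg
      exact ⟨h1, fun q hq => I.testedS_subset_compl i (h2 q hq)⟩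
    · rw [List.getD_eq_default _ _ (not_lt.1 hj)] at hg
      exact absurd hg List.not_mem_nil

theorem commute_idxProj {M : Op I.St} (h : M ∈ loc (blockQ blk I.idxRegS)ᶜ) (i : Fin I.m) :
    Commute M (I.idxProj i) :=
  loc_commute disjoint_compl_left h
    (loc_mono (blockQ_mono Finset.subset_union_left) (I.idxProj_mem_loc i))

theorem ctlLayers_mem_loc {W : Fin I.m → List (Gate I.St)} (hW : W ∈ I.ctlLayers) (i : Fin I.m) :
    opOf (W i) ∈ loc (blockQ blk I.idxRegS : Set I.St)ᶜ :=
  opOf_mem_loc fun g hg => (I.ctlLayers_good W hW i g hg).2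

theorem select_mem_unitary (hm : ∃ l, I.m = 2 ^ l) {W : Fin I.m → List (Gate I.St)}
    (hW : W ∈ I.ctlLayers) : I.select W ∈ unitary (Op I.St) :=
  controlled_mem_unitary (p := I.idxProj) (A := fun i => opOf (W i)) (I.idxProj_mul hm)
    I.idxProj_conjTranspose (fun i j => I.commute_idxProj (I.ctlLayers_mem_loc hW i) j)
    fun i => opOf_mem_unitary fun g hg => (I.ctlLayers_good W hW i g hg).1

/-- On the index `i` the controlled layers are the check and the test for `i`. -/
theorem idxProj_mul_ctl [NeZero γ] (hm : ∃ l, I.m = 2 ^ l) (i : Fin I.m) :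
    I.idxProj i * (I.ctlLayers.map I.select).reverse.prod =
      opOf (I.testLayers i).flatten * opOf (I.checkGates i) * I.idxProj i := by
  have h := proj_mul_controlled_prod (I.idxProj_mul hm) (L := I.ctlLayers)
    (fun W hW i j => I.commute_idxProj (I.ctlLayers_mem_loc hW i) j) i
  rw [flatMap_ctlLayers, opOf_append] at h
  exact h

theorem vEnc_mem_unitary [NeZero γ] (hm : ∃ l, I.m = 2 ^ l) :
    ∀ U ∈ I.vEnc, U ∈ unitary (Op I.St) := by
  intro U hU
  rw [vEnc, List.append_assoc _ I.stage5, stage56_eq] at hU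
  simp only [List.mem_append] at hU
  rcases hU with ((((hU | hU) | hU) | hU) | hU) | hU
  · simp only [stage1, List.mem_cons, List.not_mem_nil, or_false] at hU
    rcases hU with rfl | rfl
    all_goals
      refine opOf_mem_unitary fun g hg => ?_
      obtain ⟨r, -, rfl⟩ := List.mem_map.1 hg
      trivial
  · obtain ⟨g, hg, rfl⟩ := List.mem_map.1 hU
    refine opOf_mem_unitary fun g' hg' => ?_
    have hv := uEnc_valid g hg
    simp only [List.mem_append] at hg'
    rcases hg' with ((hg' | hg') | hg') | hg'
    all_goals obtain ⟨r, -, rfl⟩ := List.mem_map.1 hg'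
    · exact hv.map (I.blocks.injective (.anc r))
    · exact hv.map (I.blocks.injective (.magic r))
    · exact hv.map (I.blocks.injective (.idx r))
    · exact hv.map (I.blocks.injective (.midx r))
  · obtain ⟨q, -, rfl⟩ := List.mem_map.1 hU
    refine opOf_mem_unitary fun g hg => ?_
    obtain ⟨r, -, rfl⟩ := List.mem_map.1 hg
    trivial
  · obtain ⟨q, -, rfl⟩ := List.mem_map.1 hU
    refine opOf_mem_unitary fun g hg => ?_
    obtain ⟨r, -, rfl⟩ := List.mem_map.1 hg
    exact fun h => by cases h
  · obtain ⟨W, hW, rfl⟩ := List.mem_map.1 hU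
    exact I.select_mem_unitary hm hW
  · obtain ⟨g, hg, rfl⟩ := List.mem_map.1 hU
    refine opOf_mem_unitary fun g' hg' => ?_
    rw [List.mem_singleton.1 hg']
    exact (uDec_valid g hg).map (I.blocks.injective (.anc 0))

theorem stage7_prod [NeZero γ] : I.stage7.reverse.prod = (encOn blk {.anc 0})ᴴ := by
  have h1 : I.stage7 = (uDec.map (Gate.map (blk (.anc 0)))).map Gate.op := by
    rw [stage7, List.map_map]
    refine congrArg (fun f => List.map f uDec) (funext fun g => ?_)
    exact one_mul _
  have h2 : (encOn blk {.anc 0} : Op I.St) = lift (blk (.anc 0)) (opOf uEnc) := by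
    rw [encOn, ← par_mulSingle I.blocks]
    refine par_congr _ fun l => ?_
    rcases eq_or_ne l (.anc 0) with rfl | hl
    · rw [Pi.mulSingle_eq_same, if_pos (Finset.mem_singleton_self _)]
    · rw [Pi.mulSingle_eq_of_ne hl, if_neg (Finset.mem_singleton.not.2 hl)]
  rw [h1, ← opOf_eq_prod, opOf_map (I.blocks.injective _), opOf_uDec, h2, lift_conjTranspose]

theorem vEnc_prod [NeZero γ] : I.vEnc.reverse.prod =
    (encOn blk {.anc 0})ᴴ * ((I.ctlLayers.map I.select).reverse.prod *
      (I.stage4.reverse.prod * (I.stage3.reverse.prod * (I.stage2.reverse.prod *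
        I.stage1.reverse.prod)))) := by
  rw [vEnc, List.append_assoc _ I.stage5, stage56_eq]
  simp only [List.reverse_append, List.prod_append, ← stage7_prod]

end QSAT

/-! ### The acceptance probability -/

theorem unitary_conjTranspose_mul {R : Type} [Fintype R] [DecidableEq R] {U : Op R}
    (h : U ∈ unitary (Op R)) (M : Op R) : Uᴴ * (U * M) = M := by
  rw [← mul_assoc, ← Matrix.star_eq_conjTranspose, (Unitary.mem_iff.1 h).1, one_mul]

theorem conjTranspose_mem_unitary {R : Type} [Fintype R] [DecidableEq R] {U : Op R}
    (h : U ∈ unitary (Op R)) : Uᴴ ∈ unitary (Op R) := Unitary.star_mem h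

namespace QSAT

variable {k γ : ℕ} [NeZero γ] (I : QSAT k γ)

/-- The projection onto the accepted outcomes. -/
def outProj : Op I.St := zeroProj chkQ * oneProj (.anc 0 0)

/-- The accepting operator for the index `i` on the witness: decode, project onto the code space,
remove the one-time pad, run the circuit and test the output. -/
def accOp (i : Fin I.m) : Op I.St :=
  oneProj (.anc 0 0) * (lift (I.circQ i) (I.C i).op * (I.unpadOn (I.S i) *
    (zeroProj (tailQ blk (I.checkedS i)) * (encOn blk (I.checkedS i))ᴴ)))

theorem anc_zero_mem : (.anc 0 0 : I.St) ∈ firstQ ({.anc 0} : Finset (Lbl I.n γ I.logm)) :=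
  ⟨.anc 0, Finset.mem_singleton_self _, rfl⟩

theorem anc_mem_testedS (i : Fin I.m) : Lbl.anc 0 ∈ I.testedS i := I.circLbl_mem i (.inr 0)

theorem outProj_mem_loc : I.outProj ∈ loc (blockQ blk I.idxRegS : Set I.St)ᶜ := by
  refine mul_mem (loc_mono I.chkQ_subset_compl (zeroProj_mem_loc _)) (oneProj_mem_loc ?_)
  rintro ⟨l, hl, q, h⟩
  cases l <;> simp_all [idxRegS, idxS, midxS, blk]

theorem decode_mem_loc :
    ((encOn blk {.anc 0})ᴴ : Op I.St) ∈ loc (blockQ blk I.idxRegS : Set I.St)ᶜ := by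
  refine conjTranspose_mem_loc (loc_mono ?_ (encOn_mem_loc I.blocks _))
  refine (disjoint_blockQ (I.disjoint_idxRegS_workS.symm.mono_left ?_)).subset_compl_right
  exact Finset.singleton_subset_iff.2 (by simp [workS])

theorem testLayers_mem_loc (i : Fin I.m) :
    opOf (I.testLayers i).flatten ∈ loc (blockQ blk I.idxRegS : Set I.St)ᶜ :=
  opOf_mem_loc fun g hg q hq => by
    obtain ⟨l, hl, hg⟩ := List.mem_flatten.1 hg
    exact I.testedS_subset_compl i ((I.testLayers_good i l hl g hg).2 q hq)

theorem checkGates_mem_loc (i : Fin I.m) :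
    opOf (I.checkGates i) ∈ loc (blockQ blk I.idxRegS : Set I.St)ᶜ :=
  opOf_mem_loc fun g hg => by
    rw [← flatMap_checkLayers] at hg
    obtain ⟨W, hW, hg⟩ := List.mem_flatMap.1 hg
    exact (I.ctlLayers_good W (List.mem_append_left _ hW) i g hg).2

/-- The logical operations of the encoded test. -/
def logicalOp (i : Fin I.m) : Op I.St := lift (I.circQ i) (I.C i).op * I.unpadOn (I.S i)

theorem unpadOn_mem_loc (i : Fin I.m) : I.unpadOn (I.S i) ∈ loc (firstQ (I.checkedS i)) := by
  rw [unpadOn_eq]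
  exact par_mem_loc (I.blocks_padQ.comp (I.elt_injective i)) (T := fun _ => Set.univ)
    (fun _ => mem_loc_univ _) fun τ a _ => I.padQ_mem i τ a

theorem logicalOp_mem_loc (i : Fin I.m) :
    I.logicalOp i ∈ loc (firstQ (I.checkedS i ∪ Finset.univ.image Lbl.anc)) := by
  refine mul_mem (lift_mem_loc ?_ _) (loc_mono ?_ (I.unpadOn_mem_loc i))
  · rintro (τ | r)
    · exact ⟨.data (I.elt i τ), Finset.mem_union_left _
        (Finset.mem_image.2 ⟨(0, τ), Finset.mem_univ _, rfl⟩), rfl⟩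
    · exact ⟨.anc r, Finset.mem_union_right _
        (Finset.mem_image_of_mem _ (Finset.mem_univ r)), rfl⟩
  · rintro _ ⟨l, hl, rfl⟩
    exact ⟨l, Finset.mem_union_left _ hl, rfl⟩

theorem disjoint_logical_magic (i : Fin I.m) :
    Disjoint (I.checkedS i ∪ Finset.univ.image Lbl.anc) (Finset.univ.image Lbl.magic) := by
  rw [Finset.disjoint_union_left]
  refine ⟨I.disjoint_checkedS_magic i, ?_⟩
  rw [Finset.disjoint_left]
  intro l h
  cases l <;> simp_all

/-- The encoded test, applied to a state with correct syndromes, acts as the logical test on the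
decoded witness; the remaining operators preserve norms. -/
theorem accept_operator (i : Fin I.m) :
    I.outProj * ((encOn blk {.anc 0})ᴴ * (opOf (I.testLayers i).flatten *
      (opOf (I.checkGates i) * (encOn blk (workS I.n γ I.logm) *
        (I.magicPrep * zeroProj I.ancQ))))) =
    encOn blk ((I.testedS i).erase (.anc 0)) * (I.magicPrep * (I.accOp i * zeroProj I.ancQ)) := by
  have hb := I.blocks
  have hdw : Disjoint (I.checkedS i) (workS I.n γ I.logm) :=
    (I.disjoint_witS_ancS.mono_left (I.checkedS_subset i)).mono_right Finset.subset_union_right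
  have hwa : (blockQ blk (workS I.n γ I.logm) : Set I.St) ⊆ I.ancQ :=
    (blockQ_mono Finset.subset_union_right).trans I.blockQ_ancS_subset
  have hmw : Finset.univ.image Lbl.magic ⊆ workS I.n γ I.logm := Finset.subset_union_left
  have hblk : ∀ {M : Op I.St} {s : Finset (Lbl I.n γ I.logm)}, M ∈ loc (blockQ blk s) →
      Commute (zeroProj chkQ) M := fun h =>
    (loc_commute disjoint_chkQ h (zeroProj_mem_loc _)).symm
  -- Only the check acts on the syndrome qubits, so the projection onto zero syndromes can be placed
  -- on both sides of the check.
  have hc1 : Commute (zeroProj chkQ) (oneProj (.anc 0 0 : I.St)) :=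
    hblk (loc_mono firstQ_subset (oneProj_mem_loc I.anc_zero_mem))
  have hc2 : Commute (zeroProj chkQ) ((encOn blk {.anc 0})ᴴ : Op I.St) :=
    hblk (conjTranspose_mem_loc (encOn_mem_loc hb _))
  have hT : opOf (I.testLayers i).flatten ∈ loc (blockQ blk (I.testedS i)) := by
    refine opOf_mem_loc fun g hg => ?_
    obtain ⟨l, hl, hg⟩ := List.mem_flatten.1 hg
    exact (I.testLayers_good i l hl g hg).2
  have hc3 : Commute (zeroProj chkQ) (opOf (I.testLayers i).flatten) := hblk hT
  have hc4 : Commute (zeroProj chkQ) (encOn blk (workS I.n γ I.logm) : Op I.St) :=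
    hblk (encOn_mem_loc hb _)
  have hc5 : Commute (zeroProj chkQ) I.magicPrep :=
    hblk (loc_mono firstQ_subset I.magicPrep_mem_loc)
  have hchk : zeroProj chkQ * zeroProj I.ancQ = zeroProj I.ancQ := by
    refine I.zeroProj_mul_ancQ ?_
    rintro _ ⟨s, τ, q, rfl⟩
    exact Option.some_ne_none _
  have hin : encOn blk (workS I.n γ I.logm) * (I.magicPrep * zeroProj I.ancQ) =
      zeroProj chkQ * (encOn blk (workS I.n γ I.logm) * (I.magicPrep * zeroProj I.ancQ)) := by
    rw [hc4.left_comm, hc5.left_comm, hchk]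
  -- The work blocks do not interfere with decoding the witness.
  have hd4 : Commute ((encOn blk (I.checkedS i))ᴴ) (encOn blk (workS I.n γ I.logm) : Op I.St) :=
    loc_commute (disjoint_blockQ hdw) (conjTranspose_mem_loc (encOn_mem_loc hb _))
      (encOn_mem_loc hb _)
  have hd5 : Commute ((encOn blk (I.checkedS i))ᴴ) I.magicPrep :=
    loc_commute (disjoint_blockQ hdw) (conjTranspose_mem_loc (encOn_mem_loc hb _))
      (loc_mono firstQ_subset I.magicPrep_mem_loc)
  have hd6 : Commute ((encOn blk (I.checkedS i))ᴴ) (zeroProj I.ancQ) := by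
    refine loc_commute ?_ (conjTranspose_mem_loc (encOn_mem_loc hb _)) (zeroProj_mem_loc _)
    rw [Set.disjoint_left]
    rintro _ ⟨l, hl, q, rfl⟩ h
    have := I.checkedS_subset i hl
    cases l <;> simp_all [witS, ancQ, blk, ancPart]
  -- The encoded work blocks are the image under the encoding isometry of magic states and zeros.
  have hiso : encOn blk (workS I.n γ I.logm) * (I.magicPrep * zeroProj I.ancQ) =
      isoOn blk (workS I.n γ I.logm) * (I.magicState * zeroProj I.ancQ) := by
    have ht := I.zeroProj_mul_ancQ ((tailQ_subset blk (workS I.n γ I.logm)).trans hwa)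
    have hf : (zeroProj (firstQ (Finset.univ.image Lbl.magic)) : Op I.St) * zeroProj I.ancQ =
        zeroProj I.ancQ := I.zeroProj_mul_ancQ ((firstQ_subset.trans (blockQ_mono hmw)).trans hwa)
    have hc : Commute (zeroProj (tailQ blk (workS I.n γ I.logm))) I.magicPrep :=
      (loc_commute disjoint_firstQ_tailQ I.magicPrep_mem_loc (zeroProj_mem_loc _)).symm
    rw [← encOn_mul_zeroProj hb, magicState, mul_assoc, mul_assoc, hc.left_comm, hf, ht]
  have hs : (isoOn blk (I.testedS i) : Op I.St) =
      isoOn blk (I.checkedS i) * isoOn blk (workS I.n γ I.logm) := isoOn_union hdw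
  -- Of all encoding unitaries, only the one of the output block is undone; the others commute with
  -- the measurement of the output qubit.
  have he : (encOn blk (I.testedS i) : Op I.St) =
      encOn blk {.anc 0} * encOn blk ((I.testedS i).erase (.anc 0)) := by
    rw [← encOn_union hb (Finset.disjoint_singleton_left.2 (Finset.notMem_erase _ _)),
      ← Finset.insert_eq, Finset.insert_erase (I.anc_mem_testedS i)]
  have hone : Commute (oneProj (.anc 0 0 : I.St))
      (encOn blk ((I.testedS i).erase (.anc 0))) :=
    loc_commute ((disjoint_blockQ (Finset.disjoint_singleton_left.2
      (Finset.notMem_erase _ _))).mono_left firstQ_subset) (oneProj_mem_loc I.anc_zero_mem)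
      (encOn_mem_loc hb _)
  have htail : Commute (zeroProj (tailQ blk (I.testedS i))) I.magicState :=
    (loc_commute disjoint_firstQ_tailQ I.magicState_mem_loc (zeroProj_mem_loc _)).symm
  have htail2 : Commute (zeroProj (tailQ blk (I.testedS i))) (I.logicalOp i) :=
    (loc_commute disjoint_firstQ_tailQ (I.logicalOp_mem_loc i) (zeroProj_mem_loc _)).symm
  have htail3 : zeroProj (tailQ blk (I.testedS i)) * zeroProj I.ancQ =
      zeroProj (tailQ blk (I.checkedS i)) * zeroProj I.ancQ := by
    rw [testedS, tailQ_union, ← zeroProj_mul, mul_assoc,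
      I.zeroProj_mul_ancQ ((tailQ_subset blk (workS I.n γ I.logm)).trans hwa)]
  have hone2 : Commute (oneProj (.anc 0 0 : I.St)) I.magicPrep := by
    refine loc_commute ((disjoint_blockQ ?_).mono firstQ_subset firstQ_subset)
      (oneProj_mem_loc I.anc_zero_mem) I.magicPrep_mem_loc_magic
    rw [Finset.disjoint_singleton_left]
    simp
  have hm : Commute (zeroProj (firstQ (Finset.univ.image Lbl.magic))) (I.logicalOp i) :=
    loc_commute ((disjoint_blockQ (I.disjoint_logical_magic i).symm).mono firstQ_subset
      firstQ_subset) (zeroProj_mem_loc _) (I.logicalOp_mem_loc i)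
  have hm2 : (zeroProj (firstQ (Finset.univ.image Lbl.magic)) : Op I.St) * zeroProj I.ancQ =
      zeroProj I.ancQ := I.zeroProj_mul_ancQ ((firstQ_subset.trans (blockQ_mono hmw)).trans hwa)
  have hJ := I.testLayers_semiconj i
  rw [← logicalOp] at hJ
  calc _ = oneProj (.anc 0 0) * ((encOn blk {.anc 0})ᴴ * (opOf (I.testLayers i).flatten *
        ((zeroProj chkQ * (opOf (I.checkGates i) * zeroProj chkQ)) *
          (encOn blk (workS I.n γ I.logm) * (I.magicPrep * zeroProj I.ancQ))))) := by
        rw [outProj, hc1.eq, mul_assoc, hc2.left_comm, hc3.left_comm]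
        conv_lhs => rw [hin]
        simp only [mul_assoc]
    _ = oneProj (.anc 0 0) * ((encOn blk {.anc 0})ᴴ * (opOf (I.testLayers i).flatten *
        (isoOn blk (I.checkedS i) * (encOn blk (workS I.n γ I.logm) *
          (I.magicPrep * (zeroProj I.ancQ * (encOn blk (I.checkedS i))ᴴ)))))) := by
        rw [I.zeroProj_mul_checkGates, mul_assoc, mul_assoc, ← hin, hd4.left_comm, hd5.left_comm,
          hd6.eq]
    _ = oneProj (.anc 0 0) * ((encOn blk {.anc 0})ᴴ * ((opOf (I.testLayers i).flatten *
        (isoOn blk (I.testedS i) * I.magicState)) *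
          (zeroProj I.ancQ * (encOn blk (I.checkedS i))ᴴ))) := by
        rw [← mul_assoc I.magicPrep, ← mul_assoc (encOn blk (workS _ _ _)), hiso, hs]
        simp only [mul_assoc]
    _ = oneProj (.anc 0 0) * ((encOn blk {.anc 0})ᴴ * (encOn blk (I.testedS i) *
        (zeroProj (tailQ blk (I.testedS i)) * (I.magicState * (I.logicalOp i *
          (zeroProj I.ancQ * (encOn blk (I.checkedS i))ᴴ)))))) := by
        rw [← hJ.eq, ← encOn_mul_zeroProj hb]
        simp only [mul_assoc]
    _ = encOn blk ((I.testedS i).erase (.anc 0)) * (oneProj (.anc 0 0) *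
        (I.magicState * (I.logicalOp i * (zeroProj (tailQ blk (I.testedS i)) *
          (zeroProj I.ancQ * (encOn blk (I.checkedS i))ᴴ))))) := by
        rw [he, mul_assoc (encOn blk {.anc 0}),
          unitary_conjTranspose_mul (encOn_mem_unitary hb _), hone.left_comm, htail.left_comm,
          htail2.left_comm]
    _ = encOn blk ((I.testedS i).erase (.anc 0)) * (I.magicPrep * (oneProj (.anc 0 0) *
        (I.logicalOp i * (zeroProj (tailQ blk (I.checkedS i)) *
          (zeroProj I.ancQ * (encOn blk (I.checkedS i))ᴴ))))) := by
        rw [← mul_assoc (zeroProj (tailQ _ _)), htail3, magicState, mul_assoc I.magicPrep,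
          hm.left_comm, (zeroProj_commute (tailQ blk (I.checkedS i)) I.ancQ).eq,
          mul_assoc (zeroProj I.ancQ), ← mul_assoc (zeroProj (firstQ _)), hm2, hone2.left_comm,
          (zeroProj_commute (tailQ blk (I.checkedS i)) I.ancQ).left_comm]
    _ = _ := by
        rw [accOp, logicalOp, ← hd6.eq]
        simp only [mul_assoc]

end QSAT

theorem controlled_mul_proj {M α : Type} [Ring M] [Fintype α] [DecidableEq α] {p A : α → M}
    (hp : ∀ i j, p i * p j = if i = j then p i else 0) (j : α) :
    controlled p A * p j = A j * p j := by
  rw [controlled, add_mul, sub_mul, one_mul, sum_orthogonal_mul hp, sub_self, add_zero,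
    Finset.sum_mul]
  simp only [mul_assoc, hp]
  simp only [mul_ite, mul_zero]
  rw [Finset.sum_ite_eq', if_pos (Finset.mem_univ j)]

theorem norm_had_zero_sq : ‖had 0 0‖ ^ 2 = 1 / 2 := by
  rw [had, if_neg (by simp), norm_div, norm_one, Complex.norm_real, div_pow, one_pow,
    Real.norm_eq_abs, sq_abs, Real.sq_sqrt (by norm_num)]

/-- Extension of a vector by the zero state of all other qubits. -/
def zeroExtend {A R : Type} (e : A → R) (v : (A → ZMod 2) → ℂ) : (R → ZMod 2) → ℂ :=
  open Classical in fun x => if ∀ r, (∀ a, e a ≠ r) → x r = 0 then v (x ∘ e) else 0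

theorem zeroExtend_apply_of_ne {A R : Type} (e : A → R) (v : (A → ZMod 2) → ℂ) {x : R → ZMod 2}
    (h : ∃ r, (∀ a, e a ≠ r) ∧ x r ≠ 0) : zeroExtend e v x = 0 := by
  obtain ⟨r, h1, h2⟩ := h
  exact if_neg fun h => h2 (h r h1)

section ZeroExtend

variable {A R : Type} [Fintype A] [DecidableEq A] [Fintype R] [DecidableEq R]

theorem zeroExtend_extend {e : A → R} (he : e.Injective) (v : (A → ZMod 2) → ℂ)
    (a : A → ZMod 2) : zeroExtend e v (Function.extend e a 0) = v a := by
  rw [zeroExtend, if_pos, extend_comp_self he]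
  exact fun r hr => extend_off a 0 hr

/-- Adding qubits in the zero state does not change the reduced state. -/
theorem reduced_pureOp_zeroExtend {e : A → R} (he : e.Injective) (v : (A → ZMod 2) → ℂ) :
    reduced e (pureOp (zeroExtend e v)) = pureOp v := by
  have huniq : ∀ {x : R → ZMod 2} {a : A → ZMod 2}, x ∘ e = a → x ≠ Function.extend e a 0 →
      zeroExtend e v x = 0 := by
    rintro x _ rfl hx
    refine zeroExtend_apply_of_ne e v ?_
    by_contra! h
    exact hx (eq_extend he fun r hr => (h r hr).symm)
  ext a b
  rw [reduced, Matrix.of_apply, Finset.sum_eq_single (Function.extend e a 0),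
    Finset.sum_eq_single (Function.extend e b 0)]
  · rw [if_pos ⟨extend_comp_self he _ _, extend_comp_self he _ _, fun r hr => by
      rw [extend_off _ _ hr, extend_off _ _ hr]⟩]
    simp only [pureOp, Matrix.vecMulVec_apply, Pi.star_apply, zeroExtend_extend he]
  · intro y _ hy
    split_ifs with h
    · simp only [pureOp, Matrix.vecMulVec_apply, Pi.star_apply, huniq h.2.1 hy, star_zero,
        mul_zero]
    · rfl
  · exact fun h => absurd (Finset.mem_univ _) h
  · intro x _ hx
    refine Finset.sum_eq_zero fun y _ => ?_
    split_ifs with h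
    · simp only [pureOp, Matrix.vecMulVec_apply, huniq h.1 hx, zero_mul]
    · rfl
  · exact fun h => absurd (Finset.mem_univ _) h

theorem isState_zeroExtend {e : A → R} (he : e.Injective) {v : (A → ZMod 2) → ℂ}
    (hv : IsState v) : IsState (zeroExtend e v) := by
  have h := trace_reduced e (pureOp (zeroExtend e v))
  rw [reduced_pureOp_zeroExtend he, (isDensity_pureOp hv).2, pureOp, Matrix.trace_vecMulVec,
    dotProduct_comm] at h
  exact h.symm

end ZeroExtend

namespace QSAT

variable {k γ : ℕ} [NeZero γ] (I : QSAT k γ)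

/-- The acceptance probability of the verifier is the average over the indices of the acceptance
probabilities of the tests. -/
theorem accept_eq (hm : ∃ l, I.m = 2 ^ l) {ψ : (I.St → ZMod 2) → ℂ}
    (hψ : zeroProj I.ancQ *ᵥ ψ = ψ) :
    nsq (I.outProj *ᵥ (I.vEnc.reverse.prod *ᵥ ψ)) =
      (∑ i, nsq (I.accOp i *ᵥ ψ)) / I.m := by
  have hvec : I.outProj *ᵥ (I.vEnc.reverse.prod *ᵥ ψ) =
      (I.outProj * ((encOn blk {.anc 0})ᴴ * ((I.ctlLayers.map I.select).reverse.prod *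
        (I.stage4.reverse.prod * (I.stage3.reverse.prod * (I.stage2.reverse.prod *
          (I.stage1.reverse.prod * zeroProj I.ancQ))))))) *ᵥ ψ := by
    conv_lhs => rw [← hψ]
    rw [Matrix.mulVec_mulVec, Matrix.mulVec_mulVec, vEnc_prod]
    simp only [mul_assoc]
  have hc1 : ∀ i, Commute (I.idxProj i) I.outProj := fun i =>
    (I.commute_idxProj I.outProj_mem_loc i).symm
  have hc2 : ∀ i, Commute (I.idxProj i) ((encOn blk {.anc 0})ᴴ) := fun i =>
    (I.commute_idxProj I.decode_mem_loc i).symm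
  have hc3 : ∀ i, Commute (I.idxProj i) (I.ctlLayers.map I.select).reverse.prod := fun i => by
    refine (Commute.list_prod_left _ _ fun U hU => ?_).symm
    obtain ⟨W, hW, rfl⟩ := List.mem_map.1 (List.mem_reverse.1 hU)
    have h1 := controlled_mul_proj (A := fun i => opOf (W i)) (I.idxProj_mul hm) i
    have h2 := proj_mul_controlled (A := fun i => opOf (W i)) (I.idxProj_mul hm)
      (fun i j => I.commute_idxProj (I.ctlLayers_mem_loc hW i) j) i
    exact h1.trans h2.symm
  -- The state before the measurement lies in the span of the `|Enc(i)⟩`, and its `i`-th component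
  -- is the `i`-th test with amplitude `2^(-(log m)/2)`.
  rw [hvec, nsq_eq_sum_proj (p := I.idxProj) (fun i => by rw [I.idxProj_mul hm, if_pos rfl])
    I.idxProj_conjTranspose, Finset.sum_div]
  · refine Finset.sum_congr rfl fun i _ => ?_
    have hu1 : I.idxPrep i * (encOn blk ((I.testedS i).erase (.anc 0)) * I.magicPrep) ∈
        unitary (Op I.St) :=
      mul_mem (I.idxPrep_mem_unitary i) (mul_mem (encOn_mem_unitary I.blocks _)
        (par_mem_unitary I.blocks_magic fun _ => mul_mem (Gate.op_mem_unitary trivial)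
          (Gate.op_mem_unitary trivial)))
    have hx : ∀ {M : Op I.St}, M ∈ loc (blockQ blk I.idxRegS : Set I.St)ᶜ →
        Commute M (I.idxPrep i) := fun h =>
      loc_commute disjoint_compl_left h (I.idxPrep_mem_loc i)
    rw [Matrix.mulVec_mulVec, (hc1 i).left_comm, (hc2 i).left_comm,
      ← mul_assoc (I.idxProj i), I.idxProj_mul_ctl hm, mul_assoc _ (I.idxProj i),
      I.idxProj_mul_prep, mul_assoc (opOf _), Matrix.mul_smul, Matrix.mul_smul, Matrix.mul_smul,
      Matrix.mul_smul, (hx (I.checkGates_mem_loc i)).left_comm,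
      (hx (I.testLayers_mem_loc i)).left_comm, (hx I.decode_mem_loc).left_comm,
      (hx I.outProj_mem_loc).left_comm, I.accept_operator, Matrix.smul_mulVec, nsq_smul,
      ← mul_assoc (encOn blk _) I.magicPrep, ← mul_assoc (I.idxPrep i), ← Matrix.mulVec_mulVec,
      nsq_mulVec_of_unitary hu1, ← Matrix.mulVec_mulVec, hψ, norm_pow, ← pow_mul, mul_comm _ 2,
      pow_mul, norm_had_zero_sq]
    have h2 : (I.m : ℝ) = 2 ^ I.logm := by
      obtain ⟨l, hl⟩ := hm
      rw [logm, hl, Nat.log_pow (by norm_num)]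
      push_cast
      rfl
    rw [h2, one_div, inv_pow, div_eq_inv_mul]
  · rw [Matrix.mulVec_mulVec]
    refine congrArg (· *ᵥ ψ) ?_
    have hs1 : Commute (∑ i, I.idxProj i) I.outProj :=
      Commute.sum_left _ _ _ fun i _ => hc1 i
    have hs2 : Commute (∑ i, I.idxProj i) ((encOn blk {.anc 0})ᴴ) :=
      Commute.sum_left _ _ _ fun i _ => hc2 i
    have hs3 : Commute (∑ i, I.idxProj i) (I.ctlLayers.map I.select).reverse.prod :=
      Commute.sum_left _ _ _ fun i _ => hc3 i
    rw [hs1.left_comm, hs2.left_comm, hs3.left_comm, I.sum_idxProj_mul_prep hm]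

/-! ### The decoded witness -/

/-- The qubits holding the witness state after decoding and removal of the one-time pad. -/
def dataQ (u : Fin I.n) : I.St := .data u 0

theorem dataQ_injective : I.dataQ.Injective := fun _ _ h => (StQ.data.inj h).1

/-- Decoding of the whole witness and removal of the one-time pad. -/
def decodeOp : Op I.St := I.unpadOn Finset.univ * (encOn blk (witS I.n γ I.logm))ᴴ

/-- The part of `decodeOp` which does not act on the blocks used by the `i`-th test. -/
def restOp (i : Fin I.m) : Op I.St :=
  I.unpadOn (I.S i)ᶜ * (encOn blk (witS I.n γ I.logm \ I.checkedS i))ᴴ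

theorem unpadOn_mem_unitary (t : Finset (Fin I.n)) : I.unpadOn t ∈ unitary (Op I.St) :=
  par_mem_unitary I.blocks_padQ fun u => by
    split_ifs
    exacts [unpad_mem_unitary, one_mem _]

theorem unpadOn_mem_loc_of {t : Finset (Fin I.n)} {s : Finset (Lbl I.n γ I.logm)}
    (h : ∀ u ∈ t, .data u ∈ s ∧ .otpX u ∈ s ∧ .otpZ u ∈ s) :
    I.unpadOn t ∈ loc (blockQ blk s : Set I.St) := by
  refine par_mem_loc I.blocks_padQ (T := fun u => {_a | u ∈ t}) (fun u => ?_) fun u a ha => ?_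
  · split_ifs with hu
    · have : {_a : Fin 3 | u ∈ t} = Set.univ := Set.eq_univ_of_forall fun _ => hu
      rw [this]
      exact mem_loc_univ _
    · exact one_mem_loc _
  · obtain ⟨h1, h2, h3⟩ := h u ha
    fin_cases a
    exacts [⟨_, h1, 0, rfl⟩, ⟨_, h2, 0, rfl⟩, ⟨_, h3, 0, rfl⟩]

theorem decodeOp_mem_unitary : I.decodeOp ∈ unitary (Op I.St) :=
  mul_mem (I.unpadOn_mem_unitary _) (conjTranspose_mem_unitary (encOn_mem_unitary I.blocks _))

theorem restOp_mem_unitary (i : Fin I.m) : I.restOp i ∈ unitary (Op I.St) :=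
  mul_mem (I.unpadOn_mem_unitary _) (conjTranspose_mem_unitary (encOn_mem_unitary I.blocks _))

theorem decodeOp_mem_loc : I.decodeOp ∈ loc (blockQ blk (witS I.n γ I.logm) : Set I.St) :=
  mul_mem (I.unpadOn_mem_loc_of fun u _ => by simp [witS])
    (conjTranspose_mem_loc (encOn_mem_loc I.blocks _))

theorem elt_mem (i : Fin I.m) (τ : Fin k) : I.elt i τ ∈ I.S i := Finset.orderEmbOfFin_mem _ _ _

theorem restOp_mem_loc (i : Fin I.m) :
    I.restOp i ∈ loc (blockQ blk (witS I.n γ I.logm \ I.checkedS i) : Set I.St) := by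
  refine mul_mem (I.unpadOn_mem_loc_of fun u hu => ?_)
    (conjTranspose_mem_loc (encOn_mem_loc I.blocks _))
  have hu' : ∀ τ, I.elt i τ ≠ u := fun τ h => Finset.mem_compl.1 hu (h ▸ I.elt_mem i τ)
  simp only [Finset.mem_sdiff, checkedS, Finset.mem_image, not_exists, not_and]
  refine ⟨⟨by simp [witS], ?_⟩, ⟨by simp [witS], ?_⟩, by simp [witS], ?_⟩ <;>
  · rintro ⟨a, τ⟩ - h
    fin_cases a <;> first
      | exact hu' τ (Lbl.data.inj h)
      | exact hu' τ (Lbl.otpX.inj h)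
      | exact hu' τ (Lbl.otpZ.inj h)
      | cases h

/-- Decoding the whole witness decodes the tested blocks; the rest acts elsewhere. -/
theorem decodeOp_eq (i : Fin I.m) :
    I.decodeOp = I.restOp i * (I.unpadOn (I.S i) * (encOn blk (I.checkedS i))ᴴ) := by
  have h1 : I.unpadOn Finset.univ = I.unpadOn (I.S i)ᶜ * I.unpadOn (I.S i) := by
    rw [unpadOn, unpadOn, unpadOn, ← par_mul I.blocks_padQ]
    refine par_congr _ fun u => ?_
    by_cases hu : u ∈ I.S i <;> simp [hu]
  have h2 : (encOn blk (witS I.n γ I.logm) : Op I.St) =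
      encOn blk (I.checkedS i) * encOn blk (witS I.n γ I.logm \ I.checkedS i) := by
    rw [← encOn_union I.blocks Finset.disjoint_sdiff,
      Finset.union_sdiff_of_subset (I.checkedS_subset i)]
  have h3 : Commute (I.unpadOn (I.S i))
      ((encOn blk (witS I.n γ I.logm \ I.checkedS i))ᴴ) :=
    loc_commute ((disjoint_blockQ Finset.disjoint_sdiff).mono_left firstQ_subset)
      (I.unpadOn_mem_loc i) (conjTranspose_mem_loc (encOn_mem_loc I.blocks _))
  rw [decodeOp, restOp, h1, h2, Matrix.conjTranspose_mul, mul_assoc, mul_assoc, h3.left_comm]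

theorem zeroProj_mul_decodeOp : Commute (zeroProj I.ancQ) I.decodeOp := by
  refine (loc_commute ?_ I.decodeOp_mem_loc (zeroProj_mem_loc _)).symm
  rw [Set.disjoint_left]
  rintro _ ⟨l, hl, q, rfl⟩ h
  cases l <;> simp_all [witS, ancQ, blk, ancPart]

/-- Testing the output of the `i`-th circuit. -/
def runOp (i : Fin I.m) : Op I.St := oneProj (.anc 0 0) * lift (I.circQ i) (I.C i).op

theorem runOp_mem_loc (i : Fin I.m) :
    I.runOp i ∈ loc (firstQ (I.checkedS i ∪ Finset.univ.image Lbl.anc)) := by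
  refine mul_mem (oneProj_mem_loc ?_) (lift_mem_loc ?_ _)
  · exact ⟨.anc 0, Finset.mem_union_right _ (Finset.mem_image_of_mem _ (Finset.mem_univ 0)), rfl⟩
  · rintro (τ | r)
    · exact ⟨.data (I.elt i τ), Finset.mem_union_left _
        (Finset.mem_image.2 ⟨(0, τ), Finset.mem_univ _, rfl⟩), rfl⟩
    · exact ⟨.anc r, Finset.mem_union_right _
        (Finset.mem_image_of_mem _ (Finset.mem_univ r)), rfl⟩

theorem runOp_commute_restOp (i : Fin I.m) : Commute (I.runOp i) (I.restOp i) := by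
  refine loc_commute ((disjoint_blockQ ?_).mono_left firstQ_subset) (I.runOp_mem_loc i)
    (I.restOp_mem_loc i)
  rw [Finset.disjoint_union_left]
  refine ⟨Finset.disjoint_sdiff, ?_⟩
  rw [Finset.disjoint_left]
  intro l h
  cases l <;> simp_all [witS]

/-- Up to a unitary on untested blocks, the accepting operator is the circuit applied to the decoded
witness, followed by the projection onto trivial syndromes of the tested blocks. -/
theorem restOp_mul_accOp (i : Fin I.m) :
    I.restOp i * I.accOp i = zeroProj (tailQ blk (I.checkedS i)) * (I.runOp i * I.decodeOp) := by
  have h1 : Commute (zeroProj (tailQ blk (I.checkedS i))) (I.unpadOn (I.S i)) :=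
    (loc_commute disjoint_firstQ_tailQ (I.unpadOn_mem_loc i) (zeroProj_mem_loc _)).symm
  have h2 : Commute (zeroProj (tailQ blk (I.checkedS i))) (I.runOp i) :=
    (loc_commute disjoint_firstQ_tailQ (I.runOp_mem_loc i) (zeroProj_mem_loc _)).symm
  have h3 : Commute (zeroProj (tailQ blk (I.checkedS i))) (I.restOp i) :=
    loc_commute ((disjoint_blockQ Finset.disjoint_sdiff).mono_left (tailQ_subset _ _))
      (zeroProj_mem_loc _) (I.restOp_mem_loc i)
  rw [I.decodeOp_eq i, (I.runOp_commute_restOp i).left_comm, h3.left_comm, h2.left_comm,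
    h1.left_comm, accOp, runOp, mul_assoc]

/-- The acceptance probability of the `i`-th circuit on the decoded witness. -/
theorem nsq_runOp (i : Fin I.m) {ψ : (I.St → ZMod 2) → ℂ} (hψ : zeroProj I.ancQ *ᵥ ψ = ψ) :
    nsq (I.runOp i *ᵥ ψ) = (I.C i).prOne (reduced (I.elt i) (reduced I.dataQ (pureOp ψ))) := by
  have h := prOne_reduced (I.C i) (I.circQ_injective i) ψ (by
    rintro x ⟨c, hc⟩
    rw [← hψ]
    exact zeroProj_mulVec_apply _ _ ⟨_, Option.some_ne_none _, hc⟩)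
  rw [reduced_reduced I.dataQ_injective, runOp, ← Matrix.mulVec_mulVec]
  exact h.symm

/-- The value bounds the acceptance probability of every witness state. -/
theorem sum_accOp_le {ψ : (I.St → ZMod 2) → ℂ} (hs : IsState ψ)
    (hψ : zeroProj I.ancQ *ᵥ ψ = ψ) : (∑ i, nsq (I.accOp i *ᵥ ψ)) / I.m ≤ I.val := by
  obtain ⟨_, _, _, hmax⟩ := I.exists_val_eq
  have hφ : zeroProj I.ancQ *ᵥ (I.decodeOp *ᵥ ψ) = I.decodeOp *ᵥ ψ := by
    rw [Matrix.mulVec_mulVec, I.zeroProj_mul_decodeOp.eq, ← Matrix.mulVec_mulVec, hψ]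
  have hst : IsState (I.decodeOp *ᵥ ψ) := by
    rw [isState_iff, nsq_mulVec_of_unitary I.decodeOp_mem_unitary, isState_iff.1 hs]
  refine le_trans ?_ (hmax _ (isDensity_reduced_pureOp I.dataQ_injective hst))
  rw [valAt]
  refine div_le_div_of_nonneg_right (Finset.sum_le_sum fun i _ => ?_) (Nat.cast_nonneg _)
  rw [← I.nsq_runOp i hφ, ← nsq_mulVec_of_unitary (I.restOp_mem_unitary i), Matrix.mulVec_mulVec,
    restOp_mul_accOp, ← Matrix.mulVec_mulVec, ← Matrix.mulVec_mulVec]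
  exact nsq_zeroProj_le _ _

/-- The encoding of an optimal state is accepted with probability `val`. -/
theorem exists_sum_accOp_eq : ∃ ψ : (I.St → ZMod 2) → ℂ, IsState ψ ∧
    zeroProj I.ancQ *ᵥ ψ = ψ ∧ (∑ i, nsq (I.accOp i *ᵥ ψ)) / I.m = I.val := by
  obtain ⟨v₀, hv₀, hval, -⟩ := I.exists_val_eq
  have hzero : ∀ S : Set I.St, (∀ q ∈ S, ∀ u, I.dataQ u ≠ q) →
      zeroProj S *ᵥ zeroExtend I.dataQ v₀ = zeroExtend I.dataQ v₀ := fun S hS => by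
    refine zeroProj_mulVec ?_
    rintro x ⟨q, hq, hx⟩
    exact zeroExtend_apply_of_ne _ _ ⟨q, hS q hq, hx⟩
  have hD : I.decodeOp *ᵥ (I.decodeOpᴴ *ᵥ zeroExtend I.dataQ v₀) = zeroExtend I.dataQ v₀ := by
    rw [Matrix.mulVec_mulVec, ← Matrix.star_eq_conjTranspose,
      (Unitary.mem_iff.1 I.decodeOp_mem_unitary).2, Matrix.one_mulVec]
  have hanc : zeroProj I.ancQ *ᵥ zeroExtend I.dataQ v₀ = zeroExtend I.dataQ v₀ :=
    hzero _ fun q hq u h => hq (by rw [← h]; rfl)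
  -- The encoding of the optimal state, with trivial keys of the one-time pad.
  refine ⟨I.decodeOpᴴ *ᵥ zeroExtend I.dataQ v₀, ?_, ?_, ?_⟩
  · rw [isState_iff, nsq_mulVec_of_unitary (conjTranspose_mem_unitary I.decodeOp_mem_unitary),
      ← isState_iff]
    exact isState_zeroExtend I.dataQ_injective hv₀
  · have hc := congrArg Matrix.conjTranspose I.zeroProj_mul_decodeOp.eq
    rw [Matrix.conjTranspose_mul, Matrix.conjTranspose_mul, zeroProj_conjTranspose] at hc
    rw [Matrix.mulVec_mulVec, ← hc, ← Matrix.mulVec_mulVec, hanc]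
  · rw [← hval, valAt]
    refine congrArg (· / (I.m : ℝ)) (Finset.sum_congr rfl fun i _ => ?_)
    have h2 : Commute (zeroProj (tailQ blk (I.checkedS i))) (I.runOp i) :=
      (loc_commute disjoint_firstQ_tailQ (I.runOp_mem_loc i) (zeroProj_mem_loc _)).symm
    rw [← nsq_mulVec_of_unitary (I.restOp_mem_unitary i), Matrix.mulVec_mulVec, restOp_mul_accOp,
      ← mul_assoc, h2.eq, mul_assoc, ← Matrix.mulVec_mulVec, ← Matrix.mulVec_mulVec, hD, hzero,
      I.nsq_runOp i hanc, reduced_pureOp_zeroExtend I.dataQ_injective]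
    rintro _ ⟨l, hl, q, hq, rfl⟩ u h
    exact hq (I.blocks.eq (i := .data u) h).2.symm

end QSAT

/-! ### Bounds on the minimum eigenvalue -/

theorem eq_zero_of_nsq_eq_zero {ι : Type} [Fintype ι] {v : ι → ℂ} (h : nsq v = 0) : v = 0 := by
  funext x
  have h1 := (Finset.sum_eq_zero_iff_of_nonneg fun x _ => sq_nonneg ‖v x‖).1 h x (Finset.mem_univ x)
  exact norm_eq_zero.1 (pow_eq_zero_iff two_ne_zero |>.1 h1)

namespace QSAT

variable {k γ : ℕ} [NeZero γ] (I : QSAT k γ)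

/-- Basis states accepted by the verifier: `1` on the output qubit and a zero syndrome. -/
def Accepting (x : I.St → ZMod 2) : Prop := x (.anc 0 0) = 1 ∧ ∀ s τ q, x (.chk s τ q) = 0

instance decidablePredAccepting : DecidablePred I.Accepting := fun x =>
  inferInstanceAs (Decidable (x (.anc 0 0) = 1 ∧ ∀ s τ q, x (.chk s τ q) = 0))

theorem hEnc_eq : I.hEnc = historyHam I.vEnc ancPart + outTerm I.vEnc.length I.Accepting := rfl

theorem sum_accepting (v : (I.St → ZMod 2) → ℂ) :
    (∑ x, if I.Accepting x then ‖v x‖ ^ 2 else 0) = nsq (I.outProj *ᵥ v) := by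
  refine Finset.sum_congr rfl fun x _ => ?_
  rw [outProj, ← Matrix.mulVec_mulVec, zeroProj, oneProj, Matrix.mulVec_diagonal,
    Matrix.mulVec_diagonal]
  by_cases h1 : x (.anc 0 0) = 1
  · by_cases h2 : ∀ q ∈ (chkQ : Set I.St), x q = 0
    · rw [if_pos ⟨h1, fun s τ q => h2 _ ⟨s, τ, q, rfl⟩⟩, if_pos h1, if_pos h2, one_mul, one_mul]
    · rw [if_neg h2, zero_mul, norm_zero, zero_pow two_ne_zero, if_neg]
      rintro ⟨-, h⟩
      refine h2 ?_
      rintro _ ⟨s, τ, q, rfl⟩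
      exact h s τ q
  · rw [if_neg fun h : I.Accepting x => h1 h.1, if_neg h1, zero_mul, mul_zero, norm_zero,
      zero_pow two_ne_zero]

theorem sum_accepting_eq (hm : ∃ l, I.m = 2 ^ l) {ψ : (I.St → ZMod 2) → ℂ}
    (hψ : zeroProj I.ancQ *ᵥ ψ = ψ) :
    (∑ x, if I.Accepting x then ‖(prefixOp I.vEnc I.vEnc.length *ᵥ ψ) x‖ ^ 2 else 0) =
      (∑ i, nsq (I.accOp i *ᵥ ψ)) / I.m := by
  rw [I.sum_accepting, prefixOp_length, I.accept_eq hm hψ]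

/-- Every witness is accepted with probability at most `val`. -/
theorem sum_accepting_le (hm : ∃ l, I.m = 2 ^ l) {ψ : (I.St → ZMod 2) → ℂ}
    (hz : ∀ x, (∃ q, ancPart q ≠ none ∧ x q ≠ 0) → ψ x = 0) :
    (∑ x, if I.Accepting x then ‖(prefixOp I.vEnc I.vEnc.length *ᵥ ψ) x‖ ^ 2 else 0) ≤
      I.val * nsq ψ := by
  have hψ : zeroProj I.ancQ *ᵥ ψ = ψ := zeroProj_mulVec hz
  rw [I.sum_accepting_eq hm hψ]
  rcases (nsq_nonneg ψ).eq_or_lt with h0 | h0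
  · rw [← h0, eq_zero_of_nsq_eq_zero h0.symm]
    simp [nsq]
  · have hc : ‖((Real.sqrt (nsq ψ))⁻¹ : ℂ)‖ ^ 2 = (nsq ψ)⁻¹ := by
      rw [norm_inv, inv_pow, Complex.norm_real, Real.norm_eq_abs, sq_abs, Real.sq_sqrt h0.le]
    have hs : IsState (((Real.sqrt (nsq ψ))⁻¹ : ℂ) • ψ) := by
      rw [isState_iff, nsq_smul, hc, inv_mul_cancel₀ h0.ne']
    have h := I.sum_accOp_le hs (by rw [Matrix.mulVec_smul, hψ])
    simp only [Matrix.mulVec_smul, nsq_smul, hc, ← Finset.mul_sum] at h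
    rw [mul_div_assoc, inv_mul_le_iff₀ h0] at h
    rwa [mul_comm]

/-- Some witness is accepted with probability exactly `val`. -/
theorem exists_outside_eq (hm : ∃ l, I.m = 2 ^ l) : ∃ ψ : (I.St → ZMod 2) → ℂ, IsState ψ ∧
    (∀ x, (∃ q, ancPart q ≠ none ∧ x q ≠ 0) → ψ x = 0) ∧
    (∑ x, if I.Accepting x then ‖(prefixOp I.vEnc I.vEnc.length *ᵥ ψ) x‖ ^ 2 else 0) = I.val ∧
    nsq (outside I.Accepting (prefixOp I.vEnc I.vEnc.length *ᵥ ψ)) = 1 - I.val := by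
  obtain ⟨ψ, hs, hψ, hv⟩ := I.exists_sum_accOp_eq
  have h1 := I.sum_accepting_eq hm hψ
  rw [hv] at h1
  refine ⟨ψ, hs, fun x hx => ?_, h1, ?_⟩
  · rw [← hψ]
    exact zeroProj_mulVec_apply _ _ hx
  · have h2 := nsq_eq_add_outside I.Accepting (prefixOp I.vEnc I.vEnc.length *ᵥ ψ)
    rw [nsq_mulVec_of_unitary (prefixOp_mem_unitary (I.vEnc_mem_unitary hm) _ le_rfl),
      isState_iff.1 hs, h1] at h2
    linarith

theorem val_nonneg (hm : ∃ l, I.m = 2 ^ l) : 0 ≤ I.val := by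
  obtain ⟨ψ, -, -, h, -⟩ := I.exists_outside_eq hm
  rw [← h]
  exact Finset.sum_nonneg fun x _ => by split_ifs <;> positivity

theorem val_le_one (hm : ∃ l, I.m = 2 ^ l) : I.val ≤ 1 := by
  obtain ⟨ψ, -, -, -, h⟩ := I.exists_outside_eq hm
  have := nsq_nonneg (outside I.Accepting (prefixOp I.vEnc I.vEnc.length *ᵥ ψ))
  linarith

/-- The number of unitaries, which depends only on `k` and `γ` since the encoded test is padded. -/
theorem vEnc_length : I.vEnc.length =
    (2 + uEnc.length + 2 * blkList.length + uDec.length) + 3 * uChk.length * k + cTest * γ := by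
  have hf : ∀ (s : Fin 3), ((List.finRange k).flatMap fun τ => uChk.map fun g =>
      I.select fun i => [g.map (Sum.elim (I.chkBlk i τ s) (.chk s τ))]).length =
        k * uChk.length := fun s => by
    simp only [List.length_flatMap, List.length_map, List.map_const', List.sum_replicate,
      List.length_finRange, smul_eq_mul]
  have h5 : I.stage5.length = 3 * (k * uChk.length) := by
    rw [stage5, List.length_flatMap]
    simp only [hf, List.map_const', List.sum_replicate, List.length_finRange, smul_eq_mul]
  simp only [vEnc, List.length_append, h5, stage1, stage2, stage3, stage4, stage6, stage7,
    List.length_map, List.length_range, List.length_cons, List.length_nil]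
  ring

end QSAT

/-- The number of unitaries of the verifier is a linear function of `k` and `γ`. -/
theorem exists_vEnc_length : ∃ a b c : ℕ, ∀ (k γ : ℕ) [NeZero γ] (I : QSAT k γ),
    I.vEnc.length = a + b * k + c * γ ∧ 0 < I.vEnc.length :=
  ⟨2 + uEnc.length + 2 * blkList.length + uDec.length, 3 * uChk.length, cTest, fun _ _ _ I =>
    ⟨I.vEnc_length, by rw [I.vEnc_length]; omega⟩⟩

end EncHam

end

theorem mainTheorem4 :
    ∃ p : MvPolynomial (Fin 2) ℝ,
      (∀ k γ : ℕ, 0 < MvPolynomial.eval ![(k : ℝ), (γ : ℝ)] p) ∧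
      ∀ (k γ : ℕ) [NeZero γ] (I : EncHam.QSAT k γ), (∃ l : ℕ, I.m = 2 ^ l) →
        I.hEnc.IsHermitian ∧
        ((1 - I.val) / MvPolynomial.eval ![(k : ℝ), (γ : ℝ)] p) ^ 2 ≤ EncHam.lambdaMin I.hEnc ∧
        EncHam.lambdaMin I.hEnc ≤ 1 - I.val ∧
        (∀ (Φ : EncHam.HIdx I.vEnc.length I.St → ℂ) (δ : ℝ), EncHam.IsState Φ → EncHam.energy I.hEnc Φ ≤ δ →
          1 - MvPolynomial.eval ![(k : ℝ), (γ : ℝ)] p * Real.sqrt δ ≤ I.val) ∧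
        ∃ Ψ : EncHam.HIdx I.vEnc.length I.St → ℂ,
          EncHam.IsHistoryState I.vEnc EncHam.ancPart Ψ ∧ EncHam.energy I.hEnc Ψ ≤ 1 - I.val := by
  obtain ⟨a, b, c, hlen⟩ := EncHam.exists_vEnc_length
  -- The polynomial is the constant of `history_soundness` at `T = a + b k + c γ`.
  have hp : ∀ k γ : ℕ, MvPolynomial.eval ![(k : ℝ), (γ : ℝ)]
      (1 + 16 * (MvPolynomial.C (a : ℝ) + MvPolynomial.C (b : ℝ) * MvPolynomial.X 0 +
        MvPolynomial.C (c : ℝ) * MvPolynomial.X 1 + 1) ^ 3 : MvPolynomial (Fin 2) ℝ) =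
      1 + 16 * ((a : ℝ) + b * k + c * γ + 1) ^ 3 := fun k γ => by
    simp
  refine ⟨1 + 16 * (MvPolynomial.C (a : ℝ) + MvPolynomial.C (b : ℝ) * MvPolynomial.X 0 +
    MvPolynomial.C (c : ℝ) * MvPolynomial.X 1 + 1) ^ 3, fun k γ => ?_, fun k γ _ I hm => ?_⟩
  · rw [hp]
    positivity
  obtain ⟨hT, hpos⟩ := hlen k γ I
  have hU := I.vEnc_mem_unitary hm
  have hH : I.hEnc.IsHermitian := EncHam.historyHam_isHermitian hU EncHam.ancPart I.Accepting
  have hT' : (I.vEnc.length : ℝ) = a + b * k + c * γ := by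
    rw [hT]
    push_cast
    rfl
  rw [hp, ← hT']
  have hsound : ∀ (Φ : EncHam.HIdx I.vEnc.length I.St → ℂ) (δ : ℝ), EncHam.IsState Φ →
      EncHam.energy I.hEnc Φ ≤ δ →
      1 - (1 + 16 * ((I.vEnc.length : ℝ) + 1) ^ 3) * Real.sqrt δ ≤ I.val := fun Φ δ hΦ hδ => by
    have h := EncHam.history_soundness hU EncHam.ancPart I.Accepting (I.val_nonneg hm)
      (I.val_le_one hm) (fun ψ hz => I.sum_accepting_le hm hz) hΦ hδ
    linarith
  obtain ⟨ψ, hs, hz, -, hout⟩ := I.exists_outside_eq hm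
  have hcomp : EncHam.energy I.hEnc (EncHam.historyState I.vEnc ψ) ≤ 1 - I.val := by
    rw [I.hEnc_eq, EncHam.energy_historyState hU hpos _ _ hz, hout]
    refine mul_le_of_le_one_left (sub_nonneg.2 (I.val_le_one hm)) ?_
    rw [div_le_one (by positivity)]
    linarith [(Nat.cast_nonneg I.vEnc.length : (0 : ℝ) ≤ _)]
  obtain ⟨⟨Φ, hΦ, hE⟩, hmin⟩ := EncHam.exists_state_energy_eq_lambdaMin hH
  have hnonneg : 0 ≤ EncHam.lambdaMin I.hEnc := by
    rw [← hE, I.hEnc_eq, EncHam.energy_hamiltonian]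
    have h1 := EncHam.energy_hProp_nonneg hU Φ
    have h2 := EncHam.energy_hIn_nonneg I.vEnc.length EncHam.ancPart Φ
    have h3 := EncHam.energy_hStab_nonneg I.vEnc.length Φ
    have h4 := EncHam.energy_outTerm_nonneg I.vEnc.length I.Accepting Φ
    linarith
  refine ⟨hH, ?_, ?_, hsound, EncHam.historyState I.vEnc ψ,
    EncHam.isHistoryState_historyState hs hz, hcomp⟩
  · have h := hsound Φ _ hΦ hE.le
    have hP : 0 < 1 + 16 * ((I.vEnc.length : ℝ) + 1) ^ 3 := by positivity
    rw [← Real.sq_sqrt hnonneg]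
    refine pow_le_pow_left₀ (div_nonneg (sub_nonneg.2 (I.val_le_one hm)) hP.le) ?_ 2
    rw [div_le_iff₀ hP]
    linarith
  · have h := hmin (EncHam.historyState I.vEnc ψ)
    rw [EncHam.isState_iff.1 (EncHam.isState_historyState hU hs), mul_one] at h
    exact h.trans hcomp
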